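/- Let $\Omega\subset\mathbb R^d$, $d\ge 2$, be a bounded simply connected Lipschitz domain and $\|\cdot\|$ the norm of $L^2(\Omega)$. Let $H^1_0(\Omega)$ be normed by $\|\nabla v\|$ and $H^1(\Omega)$ by $(\|v\|^2+\|\nabla v\|^2)^{1/2}$; let $H^{-1}(\Omega)=(H^1_0(\Omega))'$ and $\widetilde H^{-1}(\Omega)=(H^1(\Omega))'$ carry the dual norms $\|\cdot\|_{-1}$ and $\|\cdot\|_{-1,\sim}$, where $\phi\in L^2(\Omega)$ acts by $v\mapsto\int_\Omega\phi v$. For $s\in(0,1)$ let $\|\cdot\|_{-s}$ and $\|\cdot\|_{-s,\sim}$ be the norms of $H^{-s}(\Omega)=\big([L^2(\Omega),H^1_0(\Omega)]_{s,2}\big)'$ and $\widetilde H^{-s}(\Omega)=\big([L^2(\Omega),H^1(\Omega)]_{s,2}\big)'$ (real interpolation by the K-method). Meshes are conforming meshes of $\Omega$ into open simplices, $h_T=\mathrm{diam}(T)$, and $P^0(\mathcal T)$ is the space of functions in $L^2(\Omega)$ that are constant on each $T\in\mathcal T$. A sequence of uniform meshes $(\mathcal T_\ell)_{\ell=0}^L$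 is one in which $\mathcal T_{\ell+1}$ arises from $\mathcal T_\ell$ by iterated application of the elementary steps (e.g. bisections) of some refinement rule, and which satisfies, with $\mathrm{gen}(T)$ the number of elementary steps needed to obtain $T$ from an element of $\mathcal T_0$: * $\mathrm{diam}(T)^d/|T|\le C_{\rm reg}$ for all $T\in\mathcal T_\ell$, $\ell\le L$; * $C_{\rm ref}^{-1}h_T\le q_{\rm ref}^{\mathrm{gen}(T)}\le C_{\rm ref}h_T$ for all $T\in\mathcal T_\ell$, $\ell\le L$; * $1\le|\mathrm{gen}(T)-\mathrm{gen}(T_F)|\le k_{\rm ref}$ for all $T\in\mathcal T_{\ell+1}\setminus\mathcal T_\ell$ with father $T_F\in\mathcal T_\ell$, $\ell<L$; * $\mathcal T_{\ell+1}\cap\mathcal T_\ell=\emptyset$ for $\ell<L$, and $\mathrm{gen}$ is constant on each $\mathcal T_\ell$, $\ell\le L$. Let $h_\ell=\max_{T\in\mathcal T_\ell}h_T$. Let $\Pi^{(-1)}_\ell$ and $\Pi^{(-1),\sim}_\ell$ denote the orthogonal projections onto $P^0(\mathcal T_\ell)$ in $H^{-1}(\Omega)$ and in $\widetilde H^{-1}(\Omega)$,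 respectively, with $\Pi^{(-1)}_{-1}=\Pi^{(-1),\sim}_{-1}=0$. **Corollary.** Let $s\in(0,1)$, $C_{\rm reg},C_{\rm ref}>0$, $q_{\rm ref}\in(0,1)$ and $k_{\rm ref}\in\mathbb N_0$. There is a constant $C>0$, depending only on $\Omega$, $s$, $C_{\rm reg}$, $C_{\rm ref}$, $q_{\rm ref}$ and $k_{\rm ref}$ (in particular neither on $L$ nor on the meshes), such that for every $L\in\mathbb N_0$, every sequence of uniform meshes $(\mathcal T_\ell)_{\ell=0}^L$ as above, and every $\phi\in P^0(\mathcal T_L)$, $$\|\phi\|_{-s}^2\simeq\sum_{\ell=0}^L h_\ell^{-2+2s}\,\|(\Pi^{(-1)}_\ell-\Pi^{(-1)}_{\ell-1})\phi\|_{-1}^2,$$ $$\|\phi\|_{-s,\sim}^2\simeq\sum_{\ell=0}^L h_\ell^{-2+2s}\,\|(\Pi^{(-1),\sim}_\ell-\Pi^{(-1),\sim}_{\ell-1})\phi\|_{-1,\sim}^2,$$ $$\|\phi\|_{-s,\sim}^2\simeq\sum_{\ell=0}^L h_\ell^{-2+2s}\,\|(\Pi^{(-1),\sim}_\ell-\Pi^{(-1),\sim}_{\ell-1})\phi\|_{-1}^2,$$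 where $a\simeq b$ means $a\le Cb$ and $b\le Ca$, and in the last line the norm $\|\cdot\|_{-1}$ of a functional on $H^1(\Omega)$ is that of its restriction to $H^1_0(\Omega)$. -/

import Mathlib

open MeasureTheory Set
open scoped ENNReal NNReal ContDiff RealInnerProductSpace

noncomputable section

/-! ## Domains -/

/-- `ℝᵈ` with the Euclidean norm. -/
abbrev Eu (d : ℕ) : Type := EuclideanSpace ℝ (Fin d)

/-- Near each of its boundary points, `Ω` is, in suitable orthonormal coordinates, the set of points
above the graph of a Lipschitz function; `e` is the vertical direction. -/
def HasLipschitzBoundary {d : ℕ} (Ω : Set (Eu d)) : Prop :=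
  ∀ x ∈ frontier Ω, ∃ (e : Eu d) (K : ℝ≥0) (g : (Submodule.span ℝ {e})ᗮ → ℝ) (r : ℝ),
    ‖e‖ = 1 ∧ LipschitzWith K g ∧ 0 < r ∧
      ∀ y ∈ Metric.ball x r,
        y ∈ Ω ↔ g ((Submodule.span ℝ {e})ᗮ.orthogonalProjectionOnto y) < ⟪e, y⟫

/-- A bounded simply connected Lipschitz domain in `ℝᵈ`, `d ≥ 2`
(simple connectedness includes that the domain is non-empty and connected). -/
structure LipschitzDomain (d : ℕ) where
  carrier : Set (Eu d)
  two_le_dim : 2 ≤ d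
  isOpen : IsOpen carrier
  isBounded : Bornology.IsBounded carrier
  isSimplyConnected : IsSimplyConnected carrier
  hasLipschitzBoundary : HasLipschitzBoundary carrier

namespace LipschitzDomain

variable {d : ℕ} (Ω : LipschitzDomain d)

/-- Lebesgue measure on `Ω`. -/
abbrev vol : Measure (Eu d) := volume.restrict Ω.carrier

/-- `L²(Ω)`. -/
abbrev L2 : Type := Lp ℝ 2 Ω.vol

/-- `L²(Ω)ᵈ`. -/
abbrev L2Vec : Type := Lp (Eu d) 2 Ω.vol

/-- `ψ ∈ C_c^∞(Ω)`. -/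
structure IsTestFunction (ψ : Eu d → ℝ) : Prop where
  contDiff : ContDiff ℝ ∞ ψ
  hasCompactSupport : HasCompactSupport ψ
  tsupport_subset : tsupport ψ ⊆ Ω.carrier

/-- The partial derivative `∂ᵢ ψ`. -/
def partialDeriv (i : Fin d) (ψ : Eu d → ℝ) (x : Eu d) : ℝ :=
  fderiv ℝ ψ x (EuclideanSpace.single i 1)

/-- `g` is the distributional gradient of `u` on `Ω`. -/
def IsWeakGradient (u : Ω.L2) (g : Ω.L2Vec) : Prop :=
  ∀ ψ : Eu d → ℝ, Ω.IsTestFunction ψ → ∀ i : Fin d,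
    ∫ x in Ω.carrier, u x * partialDeriv i ψ x = - ∫ x in Ω.carrier, ψ x * (g x) i

/-! ## The spaces `H¹(Ω)` and `H¹₀(Ω)` -/

variable {Ω}

theorem IsTestFunction.continuous_partialDeriv {ψ : Eu d → ℝ} (hψ : Ω.IsTestFunction ψ)
    (i : Fin d) : Continuous (partialDeriv i ψ) :=
  (hψ.contDiff.continuous_fderiv (by simp)).clm_apply continuous_const

theorem IsTestFunction.hasCompactSupport_partialDeriv {ψ : Eu d → ℝ} (hψ : Ω.IsTestFunction ψ)
    (i : Fin d) : HasCompactSupport (partialDeriv i ψ) :=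
  (hψ.hasCompactSupport.fderiv (𝕜 := ℝ)).comp_left
    (g := fun L : Eu d →L[ℝ] ℝ => L (EuclideanSpace.single i 1)) (by simp)

theorem IsTestFunction.memLp_partialDeriv {ψ : Eu d → ℝ} (hψ : Ω.IsTestFunction ψ) (i : Fin d) :
    MemLp (partialDeriv i ψ) 2 Ω.vol :=
  ((hψ.continuous_partialDeriv i).memLp_of_hasCompactSupport
    (hψ.hasCompactSupport_partialDeriv i)).restrict _

theorem IsTestFunction.memLp_smul_single {ψ : Eu d → ℝ} (hψ : Ω.IsTestFunction ψ) (i : Fin d) :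
    MemLp (fun x => ψ x • (EuclideanSpace.single i (1 : ℝ) : Eu d)) 2 Ω.vol :=
  ((hψ.contDiff.continuous.smul continuous_const).memLp_of_hasCompactSupport
    (hψ.hasCompactSupport.smul_right)).restrict _

theorem IsTestFunction.integral_left {ψ : Eu d → ℝ} (hψ : Ω.IsTestFunction ψ) (i : Fin d)
    (u : Ω.L2) : ∫ x in Ω.carrier, u x * partialDeriv i ψ x =
      ⟪(hψ.memLp_partialDeriv i).toLp _, u⟫ := by
  rw [L2.inner_def]
  refine integral_congr_ae ?_
  filter_upwards [(hψ.memLp_partialDeriv i).coeFn_toLp] with x hx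
  simp [hx]

theorem IsTestFunction.integral_right {ψ : Eu d → ℝ} (hψ : Ω.IsTestFunction ψ) (i : Fin d)
    (g : Ω.L2Vec) : ∫ x in Ω.carrier, ψ x * (g x) i =
      ⟪(hψ.memLp_smul_single i).toLp _, g⟫ := by
  rw [L2.inner_def]
  refine integral_congr_ae ?_
  filter_upwards [(hψ.memLp_smul_single i).coeFn_toLp] with x hx
  rw [hx, real_inner_smul_left, EuclideanSpace.inner_single_left]
  simp

theorem isWeakGradient_iff (u : Ω.L2) (g : Ω.L2Vec) :
    Ω.IsWeakGradient u g ↔ ∀ (ψ : Eu d → ℝ) (hψ : Ω.IsTestFunction ψ) (i : Fin d),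
      ⟪(hψ.memLp_partialDeriv i).toLp _, u⟫ + ⟪(hψ.memLp_smul_single i).toLp _, g⟫ = 0 := by
  refine forall_congr' fun ψ => forall_congr' fun hψ => forall_congr' fun i => ?_
  rw [hψ.integral_left, hψ.integral_right, eq_neg_iff_add_eq_zero]

variable (Ω)

/-- `H¹(Ω)`, the space of pairs `(v, ∇v)` with `v ∈ L²(Ω)` and `∇v ∈ L²(Ω)ᵈ`, as a subspace of
`L²(Ω) × L²(Ω)ᵈ`; its norm is `(‖v‖² + ‖∇v‖²)^{1/2}`. -/
def H1 : Submodule ℝ (WithLp 2 (Ω.L2 × Ω.L2Vec)) where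
  carrier := {p | Ω.IsWeakGradient p.fst p.snd}
  zero_mem' := by
    simp only [mem_ofPred_eq, isWeakGradient_iff]
    intro ψ hψ i
    simp
  add_mem' := by
    intro p q hp hq
    simp only [mem_ofPred_eq, isWeakGradient_iff] at hp hq ⊢
    intro ψ hψ i
    have h1 := hp ψ hψ i
    have h2 := hq ψ hψ i
    simp only [WithLp.add_fst, WithLp.add_snd, inner_add_right]
    linarith
  smul_mem' := by
    intro c p hp
    simp only [mem_ofPred_eq, isWeakGradient_iff] at hp ⊢
    intro ψ hψ i
    have h1 := hp ψ hψ i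
    simp only [WithLp.smul_fst, WithLp.smul_snd, real_inner_smul_right]
    rw [← mul_add, h1, mul_zero]

theorem isClosed_H1 : IsClosed (Ω.H1 : Set (WithLp 2 (Ω.L2 × Ω.L2Vec))) := by
  have : (Ω.H1 : Set (WithLp 2 (Ω.L2 × Ω.L2Vec))) =
      ⋂ (ψ : Eu d → ℝ) (hψ : Ω.IsTestFunction ψ) (i : Fin d),
        {p | ⟪(hψ.memLp_partialDeriv i).toLp _, p.fst⟫ +
          ⟪(hψ.memLp_smul_single i).toLp _, p.snd⟫ = 0} := by
    ext p
    simp only [mem_iInter, mem_ofPred_eq]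
    exact isWeakGradient_iff p.fst p.snd
  rw [this]
  refine isClosed_iInter fun ψ => isClosed_iInter fun hψ => isClosed_iInter fun i => ?_
  refine isClosed_eq ?_ continuous_const
  have h1 : Continuous (fun p : WithLp 2 (Ω.L2 × Ω.L2Vec) => p.fst) := WithLp.continuous_fst ..
  have h2 : Continuous (fun p : WithLp 2 (Ω.L2 × Ω.L2Vec) => p.snd) := WithLp.continuous_snd ..
  exact (continuous_const.inner h1).add (continuous_const.inner h2)

instance : CompleteSpace Ω.H1 := Ω.isClosed_H1.completeSpace_coe

/-- The test functions, as elements of `H¹(Ω)`. -/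
def testSpace : Submodule ℝ Ω.H1 where
  carrier := {p | ∃ ψ : Eu d → ℝ, Ω.IsTestFunction ψ ∧ p.1.fst =ᵐ[Ω.vol] ψ ∧
    ∀ i : Fin d, (fun x => (p.1.snd x) i) =ᵐ[Ω.vol] partialDeriv i ψ}
  zero_mem' := by
    refine ⟨fun _ => 0, ⟨contDiff_const, HasCompactSupport.zero, ?_⟩, ?_, fun i => ?_⟩
    · simp [tsupport]
    · exact Lp.coeFn_zero ℝ 2 Ω.vol
    · filter_upwards [Lp.coeFn_zero (Eu d) 2 Ω.vol] with x hx
      have : ((0 : Ω.H1).1.snd : Ω.L2Vec) = 0 := rfl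
      rw [this, hx]
      simp [partialDeriv]
  add_mem' := by
    rintro p q ⟨ψ, hψ, h1, h2⟩ ⟨χ, hχ, h3, h4⟩
    refine ⟨ψ + χ, ⟨hψ.contDiff.add hχ.contDiff,
      hψ.hasCompactSupport.add hχ.hasCompactSupport, ?_⟩, ?_, fun i => ?_⟩
    · exact (tsupport_add ψ χ).trans (union_subset hψ.tsupport_subset hχ.tsupport_subset)
    · filter_upwards [Lp.coeFn_add p.1.fst q.1.fst, h1, h3] with x hx a b
      have : (p + q).1.fst = p.1.fst + q.1.fst := rfl
      rw [this, hx]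
      simp [a, b]
    · filter_upwards [Lp.coeFn_add p.1.snd q.1.snd, h2 i, h4 i] with x hx a b
      have : (p + q).1.snd = p.1.snd + q.1.snd := rfl
      rw [this, hx]
      have e : fderiv ℝ (ψ + χ) x = fderiv ℝ ψ x + fderiv ℝ χ x :=
        fderiv_add (hψ.contDiff.differentiable (by simp) x)
          (hχ.contDiff.differentiable (by simp) x)
      simp only [partialDeriv] at a b ⊢
      simp [e, a, b]
  smul_mem' := by
    rintro c p ⟨ψ, hψ, h1, h2⟩
    refine ⟨c • ψ, ⟨hψ.contDiff.const_smul c, hψ.hasCompactSupport.smul_left (f := fun _ => c), ?_⟩,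
      ?_, fun i => ?_⟩
    · exact (closure_mono (Function.support_const_smul_subset c ψ)).trans hψ.tsupport_subset
    · filter_upwards [Lp.coeFn_smul c p.1.fst, h1] with x hx a
      have : (c • p).1.fst = c • p.1.fst := rfl
      rw [this, hx]
      simp [a]
    · filter_upwards [Lp.coeFn_smul c p.1.snd, h2 i] with x hx a
      have : (c • p).1.snd = c • p.1.snd := rfl
      rw [this, hx]
      have e : fderiv ℝ (c • ψ) x = c • fderiv ℝ ψ x :=
        fderiv_const_smul (hψ.contDiff.differentiable (by simp) x) c
      simp only [partialDeriv] at a ⊢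
      simp [e, a]

/-- `H¹₀(Ω)` as a closed subspace of `H¹(Ω)`: the closure of the test functions. -/
def H10Sub : Submodule ℝ Ω.H1 := Ω.testSpace.topologicalClosure

theorem norm_sq_eq_integral (u : Ω.L2) {ψ : Eu d → ℝ} (hψ : Ω.IsTestFunction ψ)
    (hu : u =ᵐ[Ω.vol] ψ) : ‖u‖ ^ 2 = ∫ x, ψ x * ψ x := by
  rw [← real_inner_self_eq_norm_sq, L2.inner_def]
  have : ∫ x, ψ x * ψ x = ∫ x in Ω.carrier, ψ x * ψ x := by
    refine (setIntegral_eq_integral_of_forall_compl_eq_zero fun x hx => ?_).symm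
    have : ψ x = 0 := image_eq_zero_of_notMem_tsupport fun h => hx (hψ.tsupport_subset h)
    simp [this]
  rw [this]
  refine integral_congr_ae ?_
  filter_upwards [hu] with x hx
  simp [hx, pow_two]

theorem integral_norm_mul_norm_le (u : Ω.L2) (g : Ω.L2Vec) :
    ∫ x in Ω.carrier, ‖u x‖ * ‖g x‖ ≤ ‖u‖ * ‖g‖ := by
  have hu : MemLp (fun x => ‖u x‖) 2 Ω.vol := (Lp.memLp u).norm
  have hg : MemLp (fun x => ‖g x‖) 2 Ω.vol := (Lp.memLp g).norm
  have e1 : ‖hu.toLp‖ = ‖u‖ := by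
    rw [Lp.norm_toLp, Lp.norm_def, eLpNorm_norm]
  have e2 : ‖hg.toLp‖ = ‖g‖ := by
    rw [Lp.norm_toLp, Lp.norm_def, eLpNorm_norm]
  rw [← e1, ← e2]
  refine le_trans (le_of_eq ?_) (real_inner_le_norm _ _)
  rw [L2.inner_def]
  refine integral_congr_ae ?_
  filter_upwards [hu.coeFn_toLp, hg.coeFn_toLp] with x a b
  rw [a, b]
  exact mul_comm _ _

/-- Friedrichs' inequality. -/
theorem exists_friedrichs :
    ∃ C : ℝ, 0 ≤ C ∧ ∀ p ∈ Ω.H10Sub, ‖p.1.fst‖ ≤ C * ‖p.1.snd‖ := by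
  obtain ⟨R, hR0, hR⟩ := Ω.isBounded.exists_pos_norm_le
  let i : Fin d := ⟨0, by have := Ω.two_le_dim; omega⟩
  refine ⟨2 * R, by positivity, ?_⟩
  have hcl : IsClosed {p : Ω.H1 | ‖p.1.fst‖ ≤ 2 * R * ‖p.1.snd‖} := by
    have h1 : Continuous (fun p : Ω.H1 => p.1.fst) :=
      (WithLp.continuous_fst ..).comp continuous_subtype_val
    have h2 : Continuous (fun p : Ω.H1 => p.1.snd) :=
      (WithLp.continuous_snd ..).comp continuous_subtype_val
    exact isClosed_le h1.norm (continuous_const.mul h2.norm)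
  refine closure_minimal (s := (Ω.testSpace : Set Ω.H1)) ?_ hcl
  rintro p ⟨ψ, hψ, h1, h2⟩
  change ‖p.1.fst‖ ≤ 2 * R * ‖p.1.snd‖
  have hd := hψ.contDiff.differentiable (by simp)
  have hc := hψ.contDiff.continuous
  have hcs := hψ.hasCompactSupport
  have hc' := hψ.continuous_partialDeriv i
  let f : Eu d → ℝ := fun x => x i
  have hf : Continuous f := by fun_prop
  have hfd : ∀ x, fderiv ℝ f x (EuclideanSpace.single i 1) = 1 := by
    intro x
    have : f = (EuclideanSpace.proj i : Eu d →L[ℝ] ℝ) := rfl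
    rw [this, ContinuousLinearMap.fderiv]
    simp
  have hsq : ∀ x, fderiv ℝ (fun x => ψ x * ψ x) x (EuclideanSpace.single i 1) =
      2 * (ψ x * partialDeriv i ψ x) := by
    intro x
    rw [fderiv_fun_mul (hd x) (hd x)]
    simp only [partialDeriv, add_apply, smul_apply, smul_eq_mul]
    ring
  have hibp := integral_mul_fderiv_eq_neg_fderiv_mul_of_integrable (μ := (volume : Measure (Eu d)))
    (f := fun x => ψ x * ψ x) (g := f) (v := EuclideanSpace.single i 1)
    (by
      simp only [hsq]
      exact ((continuous_const.mul (hc.mul hc')).mul hf).integrable_of_hasCompactSupport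
        ((hcs.mul_right.mul_left).mul_right))
    (by
      simp only [hfd, mul_one]
      exact (hc.mul hc).integrable_of_hasCompactSupport hcs.mul_right)
    (((hc.mul hc).mul hf).integrable_of_hasCompactSupport hcs.mul_right.mul_right)
    (fun x _ => (hd x).mul (hd x))
    (fun x _ => (EuclideanSpace.proj i : Eu d →L[ℝ] ℝ).differentiableAt)
  simp only [hfd, mul_one, hsq] at hibp
  have hsupp : ∀ x, x ∉ Ω.carrier → ψ x = 0 := fun x hx =>
    image_eq_zero_of_notMem_tsupport fun h => hx (hψ.tsupport_subset h)
  have hkey : ‖p.1.fst‖ ^ 2 ≤ 2 * R * (‖p.1.fst‖ * ‖p.1.snd‖) := by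
    have hint : Integrable (fun x => ‖p.1.fst x‖ * ‖p.1.snd x‖) Ω.vol :=
      (Lp.memLp p.1.fst).norm.integrable_mul (Lp.memLp p.1.snd).norm
    calc ‖p.1.fst‖ ^ 2 = ∫ x, ψ x * ψ x := Ω.norm_sq_eq_integral _ hψ h1
      _ = ∫ x, -(2 * (ψ x * partialDeriv i ψ x) * f x) := by rw [hibp, integral_neg]
      _ = ∫ x in Ω.carrier, -(2 * (ψ x * partialDeriv i ψ x) * f x) := by
        refine (setIntegral_eq_integral_of_forall_compl_eq_zero fun x hx => ?_).symm
        simp [hsupp x hx]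
      _ ≤ ∫ x in Ω.carrier, 2 * R * (‖p.1.fst x‖ * ‖p.1.snd x‖) := by
        refine integral_mono_ae ?_ (hint.const_mul _) ?_
        · exact (((continuous_const.mul (hc.mul hc')).mul hf).neg.integrable_of_hasCompactSupport
            ((hcs.mul_right.mul_left).mul_right.neg)).restrict
        · filter_upwards [h1, h2 i, ae_restrict_mem Ω.isOpen.measurableSet] with x a b hx
          rw [← b, ← a]
          have c1 : ‖f x‖ ≤ R := (PiLp.norm_apply_le x i).trans (hR x hx)
          have c2 : ‖(p.1.snd x) i‖ ≤ ‖p.1.snd x‖ := PiLp.norm_apply_le _ i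
          calc _ ≤ ‖-(2 * (p.1.fst x * (p.1.snd x) i) * f x)‖ := Real.le_norm_self _
            _ = 2 * (‖p.1.fst x‖ * ‖(p.1.snd x) i‖ * ‖f x‖) := by
              simp only [norm_neg, norm_mul, Real.norm_ofNat]; ring
            _ ≤ 2 * (‖p.1.fst x‖ * ‖p.1.snd x‖ * R) := by gcongr
            _ = _ := by ring
      _ = 2 * R * ∫ x in Ω.carrier, ‖p.1.fst x‖ * ‖p.1.snd x‖ := integral_const_mul _ _
      _ ≤ 2 * R * (‖p.1.fst‖ * ‖p.1.snd‖) := by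
        gcongr
        exact Ω.integral_norm_mul_norm_le _ _
  by_cases h0 : ‖p.1.fst‖ = 0
  · rw [h0]; positivity
  · have : 0 < ‖p.1.fst‖ := lt_of_le_of_ne (norm_nonneg _) (Ne.symm h0)
    nlinarith

/-- A constant in Friedrichs' inequality. -/
def friedrichsConst : ℝ := Ω.exists_friedrichs.choose

theorem friedrichsConst_nonneg : 0 ≤ Ω.friedrichsConst := Ω.exists_friedrichs.choose_spec.1

/-- `H¹₀(Ω)`, normed by `‖∇v‖`. -/
def H10 : Type := Ω.H10Sub

namespace H10

instance : AddCommGroup Ω.H10 := inferInstanceAs (AddCommGroup Ω.H10Sub)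

instance : Module ℝ Ω.H10 := inferInstanceAs (Module ℝ Ω.H10Sub)

/-- The gradient on `H¹₀(Ω)`. -/
def grad : Ω.H10 →ₗ[ℝ] Ω.L2Vec where
  toFun v := v.1.1.snd
  map_add' _ _ := rfl
  map_smul' _ _ := rfl

/-- The inclusion of `H¹₀(Ω)` into `L²(Ω)`, as a linear map. -/
def toL2ₗ : Ω.H10 →ₗ[ℝ] Ω.L2 where
  toFun v := v.1.1.fst
  map_add' _ _ := rfl
  map_smul' _ _ := rfl

theorem norm_toL2ₗ_le (v : Ω.H10) : ‖toL2ₗ Ω v‖ ≤ Ω.friedrichsConst * ‖grad Ω v‖ :=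
  Ω.exists_friedrichs.choose_spec.2 v.1 v.2

theorem grad_injective : Function.Injective (grad Ω) := by
  rw [← LinearMap.ker_eq_bot, LinearMap.ker_eq_bot']
  intro v hv
  have h := norm_toL2ₗ_le Ω v
  rw [hv, norm_zero, mul_zero, norm_le_zero_iff] at h
  apply Subtype.ext
  apply Subtype.ext
  apply WithLp.ofLp_injective
  exact Prod.ext h hv

instance : NormedAddCommGroup Ω.H10 :=
  NormedAddCommGroup.induced Ω.H10 Ω.L2Vec (grad Ω) (grad_injective Ω)

theorem norm_def (v : Ω.H10) : ‖v‖ = ‖grad Ω v‖ := rfl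

instance : InnerProductSpace ℝ Ω.H10 where
  toNormedSpace := NormedSpace.induced ℝ Ω.H10 Ω.L2Vec (grad Ω)
  inner v w := ⟪grad Ω v, grad Ω w⟫
  norm_sq_eq_re_inner v := by simp [norm_def]
  conj_inner_symm v w := by simp [real_inner_comm]
  add_left u v w := by simp [inner_add_left]
  smul_left u v r := by simp [real_inner_smul_left]

theorem norm_coe_le (v : Ω.H10) : ‖v.1‖ ≤ (Ω.friedrichsConst + 1) * ‖grad Ω v‖ := by
  have h := norm_toL2ₗ_le Ω v
  have h0 := Ω.friedrichsConst_nonneg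
  have e : ‖v.1‖ ^ 2 = ‖toL2ₗ Ω v‖ ^ 2 + ‖grad Ω v‖ ^ 2 := WithLp.prod_norm_sq_eq_of_L2 v.1.1
  refine le_of_sq_le_sq ?_ (by positivity)
  have h2 := norm_nonneg (toL2ₗ Ω v)
  have h3 := norm_nonneg (grad Ω v)
  rw [e]
  nlinarith [mul_nonneg h0 (mul_nonneg h3 h3), mul_self_le_mul_self h2 h]

/-- The inclusion of `H¹₀(Ω)` into `H¹(Ω)`. -/
def toH1 : Ω.H10 →L[ℝ] Ω.H1 :=
  LinearMap.mkContinuous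
    { toFun := fun v => v.1
      map_add' := fun _ _ => rfl
      map_smul' := fun _ _ => rfl } (Ω.friedrichsConst + 1) (norm_coe_le Ω)

instance : CompleteSpace Ω.H10 := by
  have hiso : Isometry (grad Ω) := AddMonoidHomClass.isometry_of_norm _ fun _ => rfl
  rw [completeSpace_iff_isComplete_range hiso.isUniformInducing]
  let G : Ω.H1 →L[ℝ] Ω.L2Vec := (WithLp.sndL 2 ℝ Ω.L2 Ω.L2Vec).comp Ω.H1.subtypeL
  let F : Ω.H10Sub →L[ℝ] Ω.L2Vec := G.comp Ω.H10Sub.subtypeL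
  have hanti : AntilipschitzWith (Real.toNNReal (Ω.friedrichsConst + 1)) F := by
    refine AddMonoidHomClass.antilipschitz_of_bound F fun v => ?_
    rw [Real.coe_toNNReal _ (by linarith [Ω.friedrichsConst_nonneg])]
    exact norm_coe_le Ω v
  have : CompleteSpace Ω.H10Sub := Ω.testSpace.isClosed_topologicalClosure.completeSpace_coe
  exact hanti.isComplete_range F.uniformContinuous

/-- The inclusion of `H¹₀(Ω)` into `L²(Ω)`. -/
def toL2 : Ω.H10 →L[ℝ] Ω.L2 :=
  (toL2ₗ Ω).mkContinuous Ω.friedrichsConst (norm_toL2ₗ_le Ω)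

end H10

/-- The inclusion of `H¹(Ω)` into `L²(Ω)`. -/
def H1.toL2 : Ω.H1 →L[ℝ] Ω.L2 := (WithLp.fstL 2 ℝ Ω.L2 Ω.L2Vec).comp Ω.H1.subtypeL

end LipschitzDomain

/-! ## Dual spaces, interpolation norms and orthogonal projections

Here `ι : V → H` stands for the inclusion of `V = H¹₀(Ω)` or `V = H¹(Ω)` into `H = L²(Ω)`. The dual
`V'` (`H⁻¹(Ω)` resp. `H̃⁻¹(Ω)`) carries the dual norm. -/

section Dual

variable {V H : Type*} [NormedAddCommGroup V] [InnerProductSpace ℝ V] [CompleteSpace V]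
  [NormedAddCommGroup H] [InnerProductSpace ℝ H]

/-- The scalar product of the dual of a Hilbert space; it induces the dual norm. -/
instance dualInnerProductSpace : InnerProductSpace ℝ (StrongDual ℝ V) where
  inner F G := ⟪(InnerProductSpace.toDual ℝ V).symm F, (InnerProductSpace.toDual ℝ V).symm G⟫
  norm_sq_eq_re_inner F := by
    rw [real_inner_self_eq_norm_sq, LinearIsometryEquiv.norm_map]; rfl
  conj_inner_symm F G := real_inner_comm _ _
  add_left F G K := by simp [inner_add_left]
  smul_left F G r := by simp [real_inner_smul_left]

/-- `φ ∈ H` as the functional `v ↦ ⟨φ, v⟩` on `V` (extended `L²` duality). -/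
def toDualSpace (ι : V →L[ℝ] H) : H →ₗ[ℝ] StrongDual ℝ V where
  toFun φ := (innerSL ℝ φ).comp ι
  map_add' φ ψ := by ext v; simp
  map_smul' c φ := by ext v; simp

/-- The orthogonal projection in `V'` onto the subspace `P ⊆ H ⊆ V'`. -/
def dualProj (ι : V →L[ℝ] H) (P : Submodule ℝ H) [FiniteDimensional ℝ P] :
    StrongDual ℝ V →L[ℝ] StrongDual ℝ V :=
  (P.map (toDualSpace ι)).starProjection

/-- The K-functional `K(t, v) = inf_{w ∈ V} (‖v - w‖_H + t ‖w‖_V)`. -/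
def kFunctional (ι : V →L[ℝ] H) (t : ℝ) (v : H) : ℝ := ⨅ w : V, ‖v - ι w‖ + t * ‖w‖

/-- The norm of the real interpolation space `[H, V]_{s,2}`,
`(∫₀^∞ (t^{-s} K(t, v))² dt / t)^{1/2}`; the space consists of all `v` where it is finite. -/
def interpNorm (ι : V →L[ℝ] H) (s : ℝ) (v : H) : ℝ≥0∞ :=
  (∫⁻ t in Ioi (0 : ℝ), ENNReal.ofReal ((t ^ (-s) * kFunctional ι t v) ^ 2 / t)) ^ (1 / 2 : ℝ)

/-- The norm of `φ ∈ H` in the dual of `[H, V]_{s,2}`. -/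
def dualInterpNorm (ι : V →L[ℝ] H) (s : ℝ) (φ : H) : ℝ≥0∞ :=
  ⨆ (v : H) (_ : v ≠ 0) (_ : interpNorm ι s v < ⊤), ENNReal.ofReal ⟪φ, v⟫ / interpNorm ι s v

end Dual

/-! ## Meshes -/

/-- A non-degenerate simplex in `ℝᵈ`, given by its set of vertices. -/
structure MeshSimplex (d : ℕ) where
  verts : Finset (Eu d)
  card_verts : verts.card = d + 1
  affineIndependent : AffineIndependent ℝ ((↑) : verts → Eu d)

namespace MeshSimplex

variable {d : ℕ} (T : MeshSimplex d)

/-- The closed simplex. -/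
def closedSet : Set (Eu d) := convexHull ℝ (T.verts : Set (Eu d))

/-- The open simplex. -/
def openSet : Set (Eu d) := interior T.closedSet

/-- `h_T`, the diameter of `T`. -/
def diam : ℝ := Metric.diam T.openSet

/-- `|T|`. -/
def vol : ℝ := (volume : Measure (Eu d)).real T.openSet

theorem measurableSet_openSet : MeasurableSet T.openSet := isOpen_interior.measurableSet

theorem volume_closedSet_diff : (volume : Measure (Eu d)) (T.closedSet \ T.openSet) = 0 := by
  have h : T.closedSet \ T.openSet ⊆ frontier T.closedSet := by
    intro x hx
    exact ⟨subset_closure hx.1, hx.2⟩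
  exact measure_mono_null h ((convex_convexHull ℝ _).addHaar_frontier _)

end MeshSimplex

/-- A regular (conforming) mesh of `Ω` into simplices: the closed simplices cover `closure Ω`, and
any two of them meet in the common face spanned by their common vertices (or not at all). -/
structure Mesh {d : ℕ} (Ω : LipschitzDomain d) where
  elems : Finset (MeshSimplex d)
  cover : closure Ω.carrier = ⋃ T ∈ elems, T.closedSet
  conforming : ∀ T ∈ elems, ∀ T' ∈ elems, T.closedSet ∩ T'.closedSet ⊆
    convexHull ℝ ((T.verts : Set (Eu d)) ∩ (T'.verts : Set (Eu d)))

namespace Mesh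

variable {d : ℕ} {Ω : LipschitzDomain d} (𝒯 : Mesh Ω)

/-- The mesh size `max_{T ∈ 𝒯} h_T`. -/
def size : ℝ := ⨆ T : 𝒯.elems, T.1.diam

/-- `P⁰(𝒯)`: the functions in `L²(Ω)` that are constant on every element. -/
def P0 : Submodule ℝ Ω.L2 where
  carrier := {v | ∀ T ∈ 𝒯.elems, ∃ c : ℝ, ∀ᵐ x ∂Ω.vol, x ∈ T.openSet → v x = c}
  zero_mem' := by
    intro T _
    refine ⟨0, ?_⟩
    filter_upwards [Lp.coeFn_zero ℝ 2 Ω.vol] with x hx _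
    rw [hx, Pi.zero_apply]
  add_mem' := by
    intro v w hv hw T hT
    obtain ⟨a, ha⟩ := hv T hT
    obtain ⟨b, hb⟩ := hw T hT
    refine ⟨a + b, ?_⟩
    filter_upwards [Lp.coeFn_add v w, ha, hb] with x hx h1 h2 hxT
    rw [hx, Pi.add_apply, h1 hxT, h2 hxT]
  smul_mem' := by
    intro r v hv T hT
    obtain ⟨a, ha⟩ := hv T hT
    refine ⟨r * a, ?_⟩
    filter_upwards [Lp.coeFn_smul r v, ha] with x hx h1 hxT
    rw [hx, Pi.smul_apply, h1 hxT, smul_eq_mul]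

theorem ae_mem : ∀ᵐ x ∂Ω.vol, ∃ T ∈ 𝒯.elems, x ∈ T.openSet := by
  have h : ∀ T ∈ 𝒯.elems, ∀ᵐ x ∂Ω.vol, x ∉ T.closedSet \ T.openSet := fun T _ =>
    ae_restrict_of_ae (measure_eq_zero_iff_ae_notMem.1 T.volume_closedSet_diff)
  have h' := (Filter.eventually_all_finset 𝒯.elems).2 h
  filter_upwards [h', ae_restrict_mem Ω.isOpen.measurableSet] with x h1 h2
  have h3 : x ∈ closure Ω.carrier := subset_closure h2
  rw [𝒯.cover] at h3
  simp only [mem_iUnion, exists_prop] at h3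
  obtain ⟨T, hT, hx⟩ := h3
  exact ⟨T, hT, by_contra fun hn => h1 T hT ⟨hx, hn⟩⟩

instance finiteDimensional_P0 : FiniteDimensional ℝ 𝒯.P0 := by
  have : IsFiniteMeasure Ω.vol := ⟨by
    rw [Measure.restrict_apply_univ]; exact Ω.isBounded.measure_lt_top⟩
  let A : 𝒯.P0 →ₗ[ℝ] (𝒯.elems → ℝ) :=
    { toFun := fun v T => ⟪indicatorConstLp 2 T.1.measurableSet_openSet
        (measure_ne_top Ω.vol T.1.openSet) (1 : ℝ), v.1⟫
      map_add' := by intro v w; ext T; simp [inner_add_right]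
      map_smul' := by intro r v; ext T; simp [real_inner_smul_right] }
  refine FiniteDimensional.of_injective A ?_
  rw [← LinearMap.ker_eq_bot, LinearMap.ker_eq_bot']
  intro v hv
  have key : ∀ T ∈ 𝒯.elems, ∀ᵐ x ∂Ω.vol, x ∈ T.openSet → v.1 x = 0 := by
    intro T hT
    obtain ⟨c, hc⟩ := v.2 T hT
    have h1 : ∫ x in T.openSet, v.1 x ∂Ω.vol = 0 := by
      have := congrFun hv ⟨T, hT⟩
      rw [← L2.inner_indicatorConstLp_one (𝕜 := ℝ) T.measurableSet_openSet
        (measure_ne_top Ω.vol T.openSet) v.1]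
      exact this
    rw [setIntegral_congr_ae (g := fun _ => c) T.measurableSet_openSet hc, setIntegral_const,
      smul_eq_mul, mul_eq_zero] at h1
    rcases h1 with h1 | h1
    · rw [measureReal_eq_zero_iff] at h1
      filter_upwards [measure_eq_zero_iff_ae_notMem.1 h1] with x hx hxT
      exact absurd hxT hx
    · filter_upwards [hc] with x hx hxT
      rw [hx hxT, h1]
  apply Subtype.ext
  refine Lp.ext ?_
  filter_upwards [𝒯.ae_mem, (Filter.eventually_all_finset 𝒯.elems).2 key,
    Lp.coeFn_zero ℝ 2 Ω.vol] with x h1 h2 h3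
  obtain ⟨T, hT, hx⟩ := h1
  rw [h2 T hT hx]
  exact h3.symm

end Mesh

/-! ## Refinement -/

/-- A refinement rule, given by its elementary refinement steps (e.g. the bisections that newest
vertex bisection may perform): `isSon T' T` says that `T` is one of the simplices into which one
elementary refinement divides `T'`. -/
structure RefinementRule (d : ℕ) where
  isSon : MeshSimplex d → MeshSimplex d → Prop
  subset : ∀ T' T, isSon T' T → T.closedSet ⊆ T'.closedSet

namespace RefinementRule

variable {d : ℕ} (R : RefinementRule d)

/-- `T` is obtained from `T'` by `n` iterated elementary refinements. -/
def IsDescendant (n : ℕ) (T' T : MeshSimplex d) : Prop :=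
  ∃ f : ℕ → MeshSimplex d, f 0 = T' ∧ f n = T ∧ ∀ i < n, R.isSon (f i) (f (i + 1))

/-- `gen(T)`, the number of iterated elementary refinements needed to obtain `T` from an element of
the initial mesh `𝒯₀`. -/
def gen {Ω : LipschitzDomain d} (𝒯₀ : Mesh Ω) (T : MeshSimplex d) : ℕ :=
  sInf {n | ∃ T' ∈ 𝒯₀.elems, R.IsDescendant n T' T}

end RefinementRule

/-- The standing assumptions on a sequence of meshes `𝒯 0, …, 𝒯 L`. -/
structure IsMeshSequence {d : ℕ} {Ω : LipschitzDomain d} (R : RefinementRule d)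
    (Creg qref Cref : ℝ) (kref : ℕ) (L : ℕ) (𝒯 : ℕ → Mesh Ω) : Prop where
  /-- Every mesh is obtained from the previous one by refining some (or all) elements. -/
  refinement : ∀ ℓ < L, ∀ T ∈ (𝒯 (ℓ + 1)).elems,
    ∃ T' ∈ (𝒯 ℓ).elems, ∃ n, R.IsDescendant n T' T
  /-- Shape regularity. -/
  shape_regular : ∀ ℓ ≤ L, ∀ T ∈ (𝒯 ℓ).elems, T.diam ^ d / T.vol ≤ Creg
  /-- The diameters decay geometrically with the generation. -/
  diam_gen : ∀ ℓ ≤ L, ∀ T ∈ (𝒯 ℓ).elems,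
    Cref⁻¹ * T.diam ≤ qref ^ R.gen (𝒯 0) T ∧ qref ^ R.gen (𝒯 0) T ≤ Cref * T.diam
  /-- Generations of an element and of its father. -/
  gen_father : ∀ ℓ < L, ∀ T ∈ (𝒯 (ℓ + 1)).elems, T ∉ (𝒯 ℓ).elems →
    ∀ T' ∈ (𝒯 ℓ).elems, (∃ n, R.IsDescendant n T' T) →
      1 ≤ |(R.gen (𝒯 0) T : ℤ) - R.gen (𝒯 0) T'| ∧
        |(R.gen (𝒯 0) T : ℤ) - R.gen (𝒯 0) T'| ≤ kref

/-- A sequence `𝒯 0, …, 𝒯 L` of uniform meshes: in each step all elements are refined, and all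
elements of a mesh have the same generation. -/
structure IsUniformMeshSequence {d : ℕ} {Ω : LipschitzDomain d} (R : RefinementRule d)
    (Creg qref Cref : ℝ) (kref : ℕ) (L : ℕ) (𝒯 : ℕ → Mesh Ω) : Prop
    extends IsMeshSequence R Creg qref Cref kref L 𝒯 where
  all_refined : ∀ ℓ < L, ∀ T ∈ (𝒯 (ℓ + 1)).elems, T ∉ (𝒯 ℓ).elems
  gen_eq : ∀ ℓ ≤ L, ∀ T ∈ (𝒯 ℓ).elems, ∀ T' ∈ (𝒯 ℓ).elems, R.gen (𝒯 0) T = R.gen (𝒯 0) T'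

/-! ## The multilevel norms -/

namespace LipschitzDomain

variable {d : ℕ} (Ω : LipschitzDomain d)

/-- `‖φ‖_{-s}` for `φ ∈ L²(Ω)`: the norm of `H⁻ˢ(Ω) = (H̃ˢ(Ω))'`, `H̃ˢ(Ω) = [L²(Ω), H¹₀(Ω)]_{s,2}`. -/
def normNeg (s : ℝ) (φ : Ω.L2) : ℝ≥0∞ := dualInterpNorm (H10.toL2 Ω) s φ

/-- `‖φ‖_{-s,∼}` for `φ ∈ L²(Ω)`: the norm of `H̃⁻ˢ(Ω) = (Hˢ(Ω))'`, `Hˢ(Ω) = [L²(Ω), H¹(Ω)]_{s,2}`. -/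
def normNegTilde (s : ℝ) (φ : Ω.L2) : ℝ≥0∞ := dualInterpNorm (H1.toL2 Ω) s φ

variable {Ω}

/-- `(Π_ℓ^{(-1)} - Π_{ℓ-1}^{(-1)}) φ ∈ H⁻¹(Ω)`, with `Π_{-1}^{(-1)} = 0`. -/
def levelPart (𝒯 : ℕ → Mesh Ω) (φ : Ω.L2) : ℕ → StrongDual ℝ Ω.H10
  | 0 => dualProj (H10.toL2 Ω) (𝒯 0).P0 (toDualSpace (H10.toL2 Ω) φ)
  | ℓ + 1 => dualProj (H10.toL2 Ω) (𝒯 (ℓ + 1)).P0 (toDualSpace (H10.toL2 Ω) φ) -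
      dualProj (H10.toL2 Ω) (𝒯 ℓ).P0 (toDualSpace (H10.toL2 Ω) φ)

/-- `(Π_ℓ^{(-1),∼} - Π_{ℓ-1}^{(-1),∼}) φ ∈ H̃⁻¹(Ω)`, with `Π_{-1}^{(-1),∼} = 0`. -/
def levelPartTilde (𝒯 : ℕ → Mesh Ω) (φ : Ω.L2) : ℕ → StrongDual ℝ Ω.H1
  | 0 => dualProj (H1.toL2 Ω) (𝒯 0).P0 (toDualSpace (H1.toL2 Ω) φ)
  | ℓ + 1 => dualProj (H1.toL2 Ω) (𝒯 (ℓ + 1)).P0 (toDualSpace (H1.toL2 Ω) φ) -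
      dualProj (H1.toL2 Ω) (𝒯 ℓ).P0 (toDualSpace (H1.toL2 Ω) φ)

/-- The restriction `H̃⁻¹(Ω) → H⁻¹(Ω)` of functionals on `H¹(Ω)` to `H¹₀(Ω)`. -/
def restrictDual (F : StrongDual ℝ Ω.H1) : StrongDual ℝ Ω.H10 := F.comp (H10.toH1 Ω)

end LipschitzDomain

/-- `a ≤ C b` and `b ≤ C a`. -/
def EquivWith (C : ℝ) (a b : ℝ≥0∞) : Prop := a ≤ ENNReal.ofReal C * b ∧ b ≤ ENNReal.ofReal C * a

end

/-!
Let `V` be `H¹₀(Ω)` or `H¹(Ω)`, let `P ℓ = P⁰(𝒯_ℓ)`, let `Π_ℓ` be the `V'`-orthogonal projection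
onto `P ℓ` and `F_ℓ = (Π_ℓ - Π_{ℓ-1}) φ`. The equivalences rest on two estimates, whose constants
depend only on the shape regularity and the quasi-uniformity of the meshes:

* the direct estimate `inf_{p ∈ P ℓ} ‖w - p‖ ≲ h_ℓ ‖∇w‖` (`Mesh.exists_mem_P0_norm_sub_le`);
* the inverse estimate `‖ψ‖ ≲ h_ℓ⁻¹ ‖ψ‖_{-1}` for `ψ ∈ P ℓ` (`Mesh.exists_norm_le_of_mem_P0`).

From these, the first two equivalences follow by an argument that does not refer to meshes
(`exists_equivWith_multilevelSum`).

*Upper bound.* Write `φ = ∑ ψ_ℓ`, where `ψ_ℓ ∈ P ℓ` represents `F_ℓ`. For `w ∈ V`,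
`⟪ψ_ℓ, v⟫ = ⟪ψ_ℓ, v - w⟫ + F_ℓ(w) ≤ ‖ψ_ℓ‖ ‖v - w‖ + ‖F_ℓ‖ ‖w‖`, and the inverse estimate turns the
infimum over `w` into `⟪ψ_ℓ, v⟫ ≲ h_ℓ⁻¹ ‖F_ℓ‖ K(h_ℓ, v)` (`inner_le_kFunctional`). By the
Cauchy–Schwarz inequality it remains to bound `∑ h_ℓ^{-2s} K(h_ℓ, v)²` by the square of the
interpolation norm of `v` (`sum_kFunctional_sq_le`).

*Lower bound.* Test `φ` with `v = ∑ h_ℓ^{-2+2s} w_ℓ`, where `w_ℓ` is the Riesz representative of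
`F_ℓ`: by orthogonality, `⟪φ, v⟫ = ∑ h_ℓ^{-2+2s} ‖F_ℓ‖²`. As `F_ℓ` is orthogonal to `P (ℓ-1)`, the
direct estimate yields `‖w_ℓ‖_{L²} ≲ h_ℓ ‖w_ℓ‖_V` (`norm_riesz_le_of_orthogonal`); on
the coarsest level this holds because `h_0` is bounded below. Splitting the sum at scale `t`
bounds `t^{-s} K(t, v)` by `∑ b_ℓ k(h_ℓ, t)`, with `b_ℓ = h_ℓ^{-1+s} ‖F_ℓ‖` and a kernel `k` that
decays geometrically away from `h_ℓ = t` (`scaleWeight`), and the Schur test bounds the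
interpolation norm of `v` (`interpNorm_sum_sq_le`).

Both bounds use that `h_ℓ` decays geometrically in `ℓ`. The condition on the generations does not
give this, since generations may decrease. Instead, every element is covered by its sons, which
are different from it, so that it has at least two of them and one of at most half its
volume (`Mesh.exists_son_two_mul_vol_le`); with shape regularity and quasi-uniformity
this shows `h_m ≲ 2^{-(m-ℓ)/d} h_ℓ` (`IsUniformMeshSequence.size_decay`).

The direct estimate is the Poincaré inequality on each simplex. It is derived from the bound
`∫ (u(x + z) - u(x))² ≤ |z|² ∫ |∇u|²` for translations inside a convex set
(`LipschitzDomain.integral_translate_sub_sq_le`), which follows by duality with smooth functions, so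
that no density of smooth functions in `H¹` is needed. For the inverse estimate, a piecewise
constant `ψ` is tested with the combination of bump functions inside the simplices that has the
same coefficients; this function belongs to `H¹₀(Ω)`, so that the estimate holds for both choices
of `V`.

For the third equivalence, let `F_ℓ` be an increment in `H̃⁻¹(Ω)`, represented by `ψ_ℓ ∈ P ℓ`. By
orthogonality to `P (ℓ-1)` and the direct estimate, `‖F_ℓ‖_{-1,∼} ≲ h_ℓ ‖ψ_ℓ‖`, and the inverse
estimate in `H⁻¹(Ω)` bounds this by `‖F_ℓ‖_{-1}` (`norm_multilevelPart_le_restrictDual`). The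
converse bound is Friedrichs' inequality.
-/

/-! ### Geometrically decaying mesh sizes and the Schur weight -/

/-- The kernel `(h/t)^s` for `h ≤ t` and `(t/h)^{1-s}` for `t < h`, by which the interaction of the
scale `h` with the scale `t` decays. -/
noncomputable def scaleWeight (s h t : ℝ) : ℝ := if h ≤ t then (h / t) ^ s else (t / h) ^ (1 - s)

theorem scaleWeight_nonneg {s h t : ℝ} (hh : 0 < h) (ht : 0 < t) : 0 ≤ scaleWeight s h t := by
  unfold scaleWeight
  split_ifs <;> positivity

theorem measurable_scaleWeight (s h : ℝ) : Measurable (scaleWeight s h) := by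
  unfold scaleWeight
  exact Measurable.ite measurableSet_Ici (by fun_prop) (by fun_prop)

theorem sum_pow_le_of_injOn {r : ℝ} (hr0 : 0 ≤ r) (hr1 : r < 1) (S : Finset ℕ) (g : ℕ → ℕ)
    (hg : Set.InjOn g S) : ∑ m ∈ S, r ^ g m ≤ (1 - r)⁻¹ := by
  rw [← Finset.sum_image (f := fun k => r ^ k) hg, ← tsum_geometric_of_lt_one hr0 hr1]
  exact (summable_geometric_of_lt_one hr0 hr1).sum_le_tsum _ fun i _ => pow_nonneg hr0 i

theorem mul_pow_rpow {A θ : ℝ} (hA : 0 ≤ A) (hθ : 0 ≤ θ) (k : ℕ) (s : ℝ) :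
    (A * θ ^ k) ^ s = A ^ s * (θ ^ s) ^ k := by
  rw [Real.mul_rpow hA (pow_nonneg hθ k), ← Real.rpow_natCast, ← Real.rpow_natCast,
    ← Real.rpow_mul hθ, ← Real.rpow_mul hθ, mul_comm s]

/-- For mesh sizes that decay geometrically, the weights of all levels sum up to a bounded
quantity: the sum splits into two geometric series. -/
theorem exists_sum_scaleWeight_le {s A θ : ℝ} (hs0 : 0 < s) (hs1 : s < 1) (hA : 0 < A)
    (hθ0 : 0 < θ) (hθ1 : θ < 1) :
    ∃ M : ℝ, 0 < M ∧ ∀ (L : ℕ) (h : ℕ → ℝ), (∀ ℓ ≤ L, 0 < h ℓ) →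
      (∀ ℓ m, ℓ ≤ m → m ≤ L → h m ≤ A * θ ^ (m - ℓ) * h ℓ) →
      ∀ t : ℝ, 0 < t → ∑ ℓ ∈ Finset.range (L + 1), scaleWeight s (h ℓ) t ≤ M := by
  have key : ∀ r : ℝ, 0 < r → 0 < (1 - θ ^ r)⁻¹ := fun r hr =>
    inv_pos.2 (sub_pos.2 (Real.rpow_lt_one hθ0.le hθ1 hr))
  have hs1' : 0 < 1 - s := sub_pos.2 hs1
  refine ⟨A ^ s * (1 - θ ^ s)⁻¹ + A ^ (1 - s) * (1 - θ ^ (1 - s))⁻¹, ?_, ?_⟩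
  · have := key s hs0
    have := key (1 - s) hs1'
    positivity
  intro L h hpos hdec t ht
  rw [← Finset.sum_filter_add_sum_filter_not _ (fun ℓ => h ℓ ≤ t)]
  refine add_le_add ?_ ?_
  · set S := (Finset.range (L + 1)).filter (fun ℓ => h ℓ ≤ t) with hS
    rcases S.eq_empty_or_nonempty with he | hne
    · rw [he, Finset.sum_empty]
      have := key s hs0
      positivity
    have h0 := Finset.mem_filter.1 (S.min'_mem hne)
    refine le_trans ?_ (mul_le_mul_of_nonneg_left (sum_pow_le_of_injOn (r := θ ^ s) (by positivity)
      (Real.rpow_lt_one hθ0.le hθ1 hs0) S (fun m => m - S.min' hne) ?_) (by positivity))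
    · rw [Finset.mul_sum]
      refine Finset.sum_le_sum fun m hm => ?_
      have hm' := Finset.mem_filter.1 hm
      have hmL : m ≤ L := Nat.lt_succ_iff.1 (Finset.mem_range.1 hm'.1)
      have hpm := hpos m hmL
      rw [scaleWeight, if_pos hm'.2, ← mul_pow_rpow hA.le hθ0.le]
      refine Real.rpow_le_rpow (by positivity) ?_ hs0.le
      rw [div_le_iff₀ ht]
      refine (hdec _ m (S.min'_le m hm) hmL).trans ?_
      exact mul_le_mul_of_nonneg_left h0.2 (by positivity)
    · intro a ha b hb hab
      have h1 := S.min'_le a ha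
      have h2 := S.min'_le b hb
      simp only at hab
      omega
  · set S := (Finset.range (L + 1)).filter (fun ℓ => ¬ h ℓ ≤ t) with hS
    rcases S.eq_empty_or_nonempty with he | hne
    · rw [he, Finset.sum_empty]
      have := key (1 - s) hs1'
      positivity
    have h0 := Finset.mem_filter.1 (S.max'_mem hne)
    have h0L : S.max' hne ≤ L := Nat.lt_succ_iff.1 (Finset.mem_range.1 h0.1)
    refine le_trans ?_ (mul_le_mul_of_nonneg_left (sum_pow_le_of_injOn (r := θ ^ (1 - s))
      (by positivity) (Real.rpow_lt_one hθ0.le hθ1 hs1') S (fun m => S.max' hne - m) ?_)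
      (by positivity))
    · rw [Finset.mul_sum]
      refine Finset.sum_le_sum fun m hm => ?_
      have hm' := Finset.mem_filter.1 hm
      have hmL : m ≤ L := Nat.lt_succ_iff.1 (Finset.mem_range.1 hm'.1)
      have hpm := hpos m hmL
      rw [scaleWeight, if_neg hm'.2, ← mul_pow_rpow hA.le hθ0.le]
      refine Real.rpow_le_rpow (by positivity) ?_ hs1'.le
      rw [div_le_iff₀ hpm]
      exact (not_le.1 h0.2).le.trans (hdec m _ (S.le_max' m hm) h0L)
    · intro a ha b hb hab
      have h1 := S.le_max' a ha
      have h2 := S.le_max' b hb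
      simp only at hab
      omega

/-- The weight of a single level is integrable over all scales with respect to `dt / t`. -/
theorem lintegral_scaleWeight_le {s h : ℝ} (hs0 : 0 < s) (hs1 : s < 1) (hh : 0 < h) :
    ∫⁻ t in Ioi (0 : ℝ), ENNReal.ofReal (scaleWeight s h t / t) ≤
      ENNReal.ofReal (1 / (1 - s) + 1 / s) := by
  have hs1' : 0 < 1 - s := sub_pos.2 hs1
  rw [← Ioc_union_Ioi_eq_Ioi hh.le, ENNReal.ofReal_add (by positivity) (by positivity)]
  refine (lintegral_union_le _ _ _).trans (add_le_add ?_ ?_)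
  · have e : ∀ t ∈ Ioc 0 h, ENNReal.ofReal (scaleWeight s h t / t) ≤
        ENNReal.ofReal (h ^ (-(1 - s)) * t ^ (-s)) := by
      intro t ht
      refine ENNReal.ofReal_le_ofReal ?_
      have e2 : (t / h) ^ (1 - s) / t = h ^ (-(1 - s)) * t ^ (-s) := by
        rw [Real.div_rpow ht.1.le hh.le, Real.rpow_neg hh.le, Real.rpow_sub ht.1, Real.rpow_one,
          Real.rpow_neg ht.1.le]
        have := Real.rpow_pos_of_pos ht.1 s
        have := ht.1
        field_simp
      rw [← e2]
      refine div_le_div_of_nonneg_right ?_ ht.1.le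
      unfold scaleWeight
      split_ifs with hc
      · have : t = h := le_antisymm ht.2 hc
        rw [this, div_self hh.ne']
        simp
      · exact le_rfl
    refine (setLIntegral_mono' measurableSet_Ioc e).trans ?_
    have hint : IntervalIntegrable (fun t : ℝ => h ^ (-(1 - s)) * t ^ (-s)) volume 0 h :=
      (intervalIntegral.intervalIntegrable_rpow' (by linarith)).const_mul _
    rw [← ofReal_integral_eq_lintegral_ofReal
      ((intervalIntegrable_iff_integrableOn_Ioc_of_le hh.le).1 hint)]
    · refine ENNReal.ofReal_le_ofReal (le_of_eq ?_)
      rw [← intervalIntegral.integral_of_le hh.le, intervalIntegral.integral_const_mul,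
        integral_rpow (Or.inl (by linarith)), Real.zero_rpow (by linarith), sub_zero,
        ← mul_div_assoc, ← Real.rpow_add hh]
      rw [show -(1 - s) + (-s + 1) = 0 by ring, Real.rpow_zero, show -s + 1 = 1 - s by ring]
    · filter_upwards [ae_restrict_mem measurableSet_Ioc] with t ht
      have := ht.1
      exact mul_nonneg (by positivity) (by positivity)
  · have e : ∀ t ∈ Ioi h, ENNReal.ofReal (scaleWeight s h t / t) ≤
        ENNReal.ofReal (h ^ s * t ^ (-s - 1)) := by
      intro t ht
      have ht0 : 0 < t := hh.trans ht
      refine ENNReal.ofReal_le_ofReal (le_of_eq ?_)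
      have ht' : h ≤ t := le_of_lt ht
      rw [scaleWeight, if_pos ht', Real.div_rpow hh.le ht0.le, Real.rpow_sub ht0,
        Real.rpow_one, Real.rpow_neg ht0.le]
      have := Real.rpow_pos_of_pos ht0 s
      field_simp
    refine (setLIntegral_mono' measurableSet_Ioi e).trans ?_
    have hint : IntegrableOn (fun t : ℝ => h ^ s * t ^ (-s - 1)) (Ioi h) :=
      (integrableOn_Ioi_rpow_of_lt (by linarith) hh).const_mul _
    rw [← ofReal_integral_eq_lintegral_ofReal hint]
    · refine ENNReal.ofReal_le_ofReal (le_of_eq ?_)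
      rw [integral_const_mul, integral_Ioi_rpow_of_lt (by linarith) hh]
      rw [show -s - 1 + 1 = -s by ring, Real.rpow_neg hh.le]
      have := Real.rpow_pos_of_pos hh s
      field_simp
    · filter_upwards [ae_restrict_mem measurableSet_Ioi] with t ht
      have : 0 < t := hh.trans ht
      exact mul_nonneg (by positivity) (by positivity)

/-! ### The K-functional -/

section AbstractMultilevel

variable {V H : Type*} [NormedAddCommGroup V] [InnerProductSpace ℝ V]
  [NormedAddCommGroup H] [InnerProductSpace ℝ H] (ι : V →L[ℝ] H)

theorem kFunctional_le {t : ℝ} (ht : 0 ≤ t) (v : H) (w : V) :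
    kFunctional ι t v ≤ ‖v - ι w‖ + t * ‖w‖ :=
  ciInf_le ⟨0, by rintro _ ⟨w, rfl⟩; positivity⟩ w

theorem kFunctional_nonneg {t : ℝ} (ht : 0 ≤ t) (v : H) : 0 ≤ kFunctional ι t v :=
  le_ciInf fun w => by positivity

theorem kFunctional_mono {t t' : ℝ} (ht : 0 ≤ t) (htt : t ≤ t') (v : H) :
    kFunctional ι t v ≤ kFunctional ι t' v :=
  le_ciInf fun w => (kFunctional_le ι ht v w).trans (by gcongr)

theorem interpNorm_sq (s : ℝ) (v : H) : interpNorm ι s v ^ 2 =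
    ∫⁻ t in Ioi (0 : ℝ), ENNReal.ofReal ((t ^ (-s) * kFunctional ι t v) ^ 2 / t) := by
  rw [interpNorm, ← ENNReal.rpow_natCast, ← ENNReal.rpow_mul]
  norm_num

theorem sq_rpow_mul {h : ℝ} (hh : 0 < h) (s a : ℝ) :
    (h ^ (-1 + s) * a) ^ 2 = h ^ (-2 + 2 * s) * a ^ 2 := by
  rw [mul_pow, ← Real.rpow_natCast, ← Real.rpow_mul hh.le]
  congr 2
  push_cast
  ring

/-- The values of the K-functional at the mesh sizes are controlled by the interpolation norm:
`t^{-s} K(t, v)` is comparable to `h^{-s} K(h, v)` for `h ≤ t ≤ 2h`, and these intervals overlap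
boundedly often. -/
theorem sum_kFunctional_sq_le {ι : V →L[ℝ] H} {L : ℕ} {h : ℕ → ℝ} {s M : ℝ}
    (hs0 : 0 < s) (hs1 : s < 1)
    (hpos : ∀ ℓ ≤ L, 0 < h ℓ)
    (hsum : ∀ t : ℝ, 0 < t → ∑ ℓ ∈ Finset.range (L + 1), scaleWeight s (h ℓ) t ≤ M) (v : H) :
    ENNReal.ofReal (∑ ℓ ∈ Finset.range (L + 1), (h ℓ ^ (-s) * kFunctional ι (h ℓ) v) ^ 2) ≤
      ENNReal.ofReal (16 * M) * interpNorm ι s v ^ 2 := by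
  rw [interpNorm_sq]
  set F : ℝ → ℝ≥0∞ := fun t => ENNReal.ofReal ((t ^ (-s) * kFunctional ι t v) ^ 2 / t) with hF
  have hlevel : ∀ ℓ ∈ Finset.range (L + 1),
      ENNReal.ofReal ((h ℓ ^ (-s) * kFunctional ι (h ℓ) v) ^ 2) ≤
        ∫⁻ t in Ioi (0 : ℝ), ENNReal.ofReal (16 * scaleWeight s (h ℓ) t) * F t := by
    intro ℓ hℓ
    have hh : 0 < h ℓ := hpos ℓ (Nat.lt_succ_iff.1 (Finset.mem_range.1 hℓ))
    set a := h ℓ with ha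
    set X := (a ^ (-s) * kFunctional ι a v) ^ 2 with hX
    have hsub : Icc a (2 * a) ⊆ Ioi (0 : ℝ) := fun t ht => hh.trans_le ht.1
    have hpt : ∀ t ∈ Icc a (2 * a), ENNReal.ofReal (X / a) ≤
        ENNReal.ofReal (16 * scaleWeight s a t) * F t := by
      intro t ht
      have ht0 : 0 < t := hsub ht
      have hK0 := kFunctional_nonneg ι hh.le v
      rw [hF, ← ENNReal.ofReal_mul (by have := scaleWeight_nonneg (s := s) hh ht0; positivity)]
      refine ENNReal.ofReal_le_ofReal ?_
      have hw : 1 / 2 ≤ scaleWeight s a t := by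
        rw [scaleWeight, if_pos ht.1]
        have h1 : (1 / 2 : ℝ) ≤ a / t := by
          rw [div_le_div_iff₀ (by norm_num) ht0]; linarith [ht.2]
        have h2 : a / t ≤ 1 := (div_le_one ht0).2 ht.1
        calc (1 / 2 : ℝ) ≤ a / t := h1
          _ = (a / t) ^ (1 : ℝ) := (Real.rpow_one _).symm
          _ ≤ (a / t) ^ s := Real.rpow_le_rpow_of_exponent_ge (by positivity) h2 hs1.le
      have hts : a ^ (-s) / 2 ≤ t ^ (-s) := by
        have h1 : (2 * a) ^ (-s) ≤ t ^ (-s) :=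
          Real.rpow_le_rpow_of_nonpos ht0 ht.2 (by linarith)
        refine le_trans ?_ h1
        rw [Real.mul_rpow (by norm_num) hh.le, div_eq_inv_mul]
        refine mul_le_mul_of_nonneg_right ?_ (by positivity)
        rw [← Real.rpow_neg_one]
        exact Real.rpow_le_rpow_of_exponent_le (by norm_num) (by linarith)
      have hKt := kFunctional_mono ι hh.le ht.1 v
      have h3 : X / 4 ≤ (t ^ (-s) * kFunctional ι t v) ^ 2 := by
        have : X / 4 = (a ^ (-s) / 2 * kFunctional ι a v) ^ 2 := by rw [hX]; ring
        rw [this]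
        gcongr
      have hX0 : 0 ≤ X := sq_nonneg _
      calc X / a = 16 * (1 / 2) * (X / 4 / (2 * a)) := by field_simp; ring
        _ ≤ 16 * scaleWeight s a t * ((t ^ (-s) * kFunctional ι t v) ^ 2 / t) := by
          gcongr
          exact ht.2
    calc ENNReal.ofReal X = ENNReal.ofReal (X / a) * volume (Icc a (2 * a)) := by
          rw [Real.volume_Icc, ← ENNReal.ofReal_mul (by positivity)]
          congr 1
          field_simp
          ring
      _ = ∫⁻ _ in Icc a (2 * a), ENNReal.ofReal (X / a) := by rw [setLIntegral_const]
      _ ≤ ∫⁻ t in Icc a (2 * a), ENNReal.ofReal (16 * scaleWeight s a t) * F t :=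
          setLIntegral_mono' measurableSet_Icc hpt
      _ ≤ _ := lintegral_mono_set hsub
  -- Superadditivity of the lower integral, which needs no measurability of the K-functional.
  have hsuper : ∀ (S : Finset ℕ) (f : ℕ → ℝ → ℝ≥0∞), ∑ ℓ ∈ S, ∫⁻ t in Ioi (0 : ℝ), f ℓ t ≤
      ∫⁻ t in Ioi (0 : ℝ), ∑ ℓ ∈ S, f ℓ t := by
    intro S f
    induction S using Finset.induction_on with
    | empty => simp
    | insert a S ha ih =>
      simp only [Finset.sum_insert ha]
      exact (add_le_add_right ih _).trans (le_lintegral_add _ _)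
  rw [ENNReal.ofReal_sum_of_nonneg fun _ _ => sq_nonneg _]
  refine (Finset.sum_le_sum hlevel).trans ((hsuper _ _).trans ?_)
  rw [← lintegral_const_mul' _ _ ENNReal.ofReal_ne_top]
  refine setLIntegral_mono' measurableSet_Ioi fun t ht => ?_
  rw [← Finset.sum_mul, ← ENNReal.ofReal_sum_of_nonneg]
  · rw [← Finset.mul_sum]
    gcongr
    exact hsum t ht
  · intro ℓ hℓ
    have := scaleWeight_nonneg (s := s) (hpos ℓ (Nat.lt_succ_iff.1 (Finset.mem_range.1 hℓ))) ht
    positivity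

/-- A sum of elements of `V`, each small in `H` relative to its scale, belongs to the interpolation
space with the norm of the weighted coefficients; this is the Schur test for the scale weights. -/
theorem interpNorm_sum_sq_le {ι : V →L[ℝ] H} {L : ℕ} {h : ℕ → ℝ} {s M D : ℝ}
    (hs0 : 0 < s) (hs1 : s < 1) (hM : 0 < M) (hD : 1 ≤ D)
    (hpos : ∀ ℓ ≤ L, 0 < h ℓ)
    (hsum : ∀ t : ℝ, 0 < t → ∑ ℓ ∈ Finset.range (L + 1), scaleWeight s (h ℓ) t ≤ M)
    (w : ℕ → V) (hw : ∀ ℓ ≤ L, ‖ι (w ℓ)‖ ≤ D * h ℓ * ‖w ℓ‖) :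
    interpNorm ι s (ι (∑ ℓ ∈ Finset.range (L + 1), h ℓ ^ (-2 + 2 * s) • w ℓ)) ^ 2 ≤
      ENNReal.ofReal (D ^ 2 * M * (1 / (1 - s) + 1 / s) *
        ∑ ℓ ∈ Finset.range (L + 1), h ℓ ^ (-2 + 2 * s) * ‖w ℓ‖ ^ 2) := by
  set v := ι (∑ ℓ ∈ Finset.range (L + 1), h ℓ ^ (-2 + 2 * s) • w ℓ) with hv
  set b : ℕ → ℝ := fun ℓ => h ℓ ^ (-1 + s) * ‖w ℓ‖ with hb
  have hpos' : ∀ ℓ ∈ Finset.range (L + 1), 0 < h ℓ := fun ℓ hℓ =>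
    hpos ℓ (Nat.lt_succ_iff.1 (Finset.mem_range.1 hℓ))
  have hK : ∀ t : ℝ, 0 < t → t ^ (-s) * kFunctional ι t v ≤
      D * ∑ ℓ ∈ Finset.range (L + 1), b ℓ * scaleWeight s (h ℓ) t := by
    intro t ht
    set S := Finset.range (L + 1) with hS
    -- The scales above `t` form the competitor in `V`, those below `t` remain in `H`.
    set z := ∑ ℓ ∈ S.filter (fun ℓ => ¬ h ℓ ≤ t), h ℓ ^ (-2 + 2 * s) • w ℓ with hz
    have hvz : v - ι z = ∑ ℓ ∈ S.filter (fun ℓ => h ℓ ≤ t), h ℓ ^ (-2 + 2 * s) • ι (w ℓ) := by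
      rw [hv, ← Finset.sum_filter_add_sum_filter_not S (fun ℓ => h ℓ ≤ t), map_add,
        add_sub_cancel_right, map_sum]
      simp
    have h1 := kFunctional_le ι ht.le v z
    have h2 : ‖v - ι z‖ ≤ ∑ ℓ ∈ S.filter (fun ℓ => h ℓ ≤ t),
        t ^ s * (D * (b ℓ * scaleWeight s (h ℓ) t)) := by
      rw [hvz]
      refine norm_sum_le_of_le _ fun ℓ hℓ => ?_
      have hℓ' := Finset.mem_filter.1 hℓ
      have hp := hpos' ℓ hℓ'.1
      rw [norm_smul, Real.norm_of_nonneg (by positivity), scaleWeight, if_pos hℓ'.2, hb,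
        Real.div_rpow hp.le ht.le]
      calc _ ≤ h ℓ ^ (-2 + 2 * s) * (D * h ℓ * ‖w ℓ‖) := by
            gcongr; exact hw ℓ (Nat.lt_succ_iff.1 (Finset.mem_range.1 hℓ'.1))
        _ = D * (h ℓ ^ (-2 + 2 * s) * h ℓ ^ (1 : ℝ) * ‖w ℓ‖) := by rw [Real.rpow_one]; ring
        _ = D * (h ℓ ^ (-1 + s) * h ℓ ^ s * ‖w ℓ‖) := by
            rw [← Real.rpow_add hp, ← Real.rpow_add hp,
              show -2 + 2 * s + 1 = -1 + s + s by ring]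
        _ = _ := by
            have := Real.rpow_pos_of_pos ht s
            field_simp
    have h3 : t * ‖z‖ ≤ ∑ ℓ ∈ S.filter (fun ℓ => ¬ h ℓ ≤ t),
        t ^ s * (D * (b ℓ * scaleWeight s (h ℓ) t)) := by
      have : t * ‖z‖ ≤ t * ∑ ℓ ∈ S.filter (fun ℓ => ¬ h ℓ ≤ t), h ℓ ^ (-2 + 2 * s) * ‖w ℓ‖ := by
        gcongr
        refine norm_sum_le_of_le _ fun ℓ hℓ => ?_
        have hp := hpos' ℓ (Finset.mem_filter.1 hℓ).1
        rw [norm_smul, Real.norm_of_nonneg (by positivity)]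
      refine this.trans ?_
      rw [Finset.mul_sum]
      refine Finset.sum_le_sum fun ℓ hℓ => ?_
      have hℓ' := Finset.mem_filter.1 hℓ
      have hp := hpos' ℓ hℓ'.1
      rw [scaleWeight, if_neg hℓ'.2, hb, Real.div_rpow ht.le hp.le]
      calc _ = t * (h ℓ ^ (-2 + 2 * s) * ‖w ℓ‖) := rfl
        _ = t ^ (s + (1 - s)) * (h ℓ ^ ((-1 + s) + (-(1 - s))) * ‖w ℓ‖) := by
            rw [show s + (1 - s) = 1 by ring, Real.rpow_one,
              show (-1 + s) + (-(1 - s)) = -2 + 2 * s by ring]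
        _ = t ^ s * (1 * (h ℓ ^ (-1 + s) * ‖w ℓ‖ * (t ^ (1 - s) / h ℓ ^ (1 - s)))) := by
            rw [Real.rpow_add ht, Real.rpow_add hp, Real.rpow_neg hp.le]; ring
        _ ≤ _ := by gcongr
    have h4 : kFunctional ι t v ≤ t ^ s * (D * ∑ ℓ ∈ S, b ℓ * scaleWeight s (h ℓ) t) := by
      refine (h1.trans (add_le_add h2 h3)).trans (le_of_eq ?_)
      rw [Finset.sum_filter_add_sum_filter_not, Finset.mul_sum, Finset.mul_sum]
    have hts := Real.rpow_pos_of_pos ht s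
    rw [Real.rpow_neg ht.le, inv_mul_le_iff₀ hts]
    exact h4
  rw [interpNorm_sq]
  have hpt : ∀ t ∈ Ioi (0 : ℝ), ENNReal.ofReal ((t ^ (-s) * kFunctional ι t v) ^ 2 / t) ≤
      ∑ ℓ ∈ Finset.range (L + 1), ENNReal.ofReal (D ^ 2 * M * b ℓ ^ 2) *
        ENNReal.ofReal (scaleWeight s (h ℓ) t / t) := by
    intro t ht
    have ht0 : 0 < t := ht
    have hw0 : ∀ ℓ ∈ Finset.range (L + 1), 0 ≤ scaleWeight s (h ℓ) t := fun ℓ hℓ =>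
      scaleWeight_nonneg (hpos' ℓ hℓ) ht0
    have e : ∀ ℓ ∈ Finset.range (L + 1), ENNReal.ofReal (D ^ 2 * M * b ℓ ^ 2) *
        ENNReal.ofReal (scaleWeight s (h ℓ) t / t) =
        ENNReal.ofReal (D ^ 2 * M * b ℓ ^ 2 * (scaleWeight s (h ℓ) t / t)) := fun ℓ _ =>
      (ENNReal.ofReal_mul (by positivity)).symm
    rw [Finset.sum_congr rfl e, ← ENNReal.ofReal_sum_of_nonneg]
    swap
    · intro ℓ hℓ
      have := hw0 ℓ hℓ
      positivity
    refine ENNReal.ofReal_le_ofReal ?_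
    have hKn := kFunctional_nonneg ι ht0.le v
    have hcs : (∑ ℓ ∈ Finset.range (L + 1), b ℓ * scaleWeight s (h ℓ) t) ^ 2 ≤
        M * ∑ ℓ ∈ Finset.range (L + 1), b ℓ ^ 2 * scaleWeight s (h ℓ) t := by
      refine (Finset.sum_sq_le_sum_mul_sum_of_sq_le_mul _ hw0
        (g := fun ℓ => b ℓ ^ 2 * scaleWeight s (h ℓ) t) (fun ℓ hℓ => ?_) fun ℓ _ => ?_).trans ?_
      · have := hw0 ℓ hℓ
        positivity
      · exact le_of_eq (by ring)
      · gcongr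
        · refine Finset.sum_nonneg fun ℓ hℓ => ?_
          have := hw0 ℓ hℓ
          positivity
        · exact hsum t ht0
    calc (t ^ (-s) * kFunctional ι t v) ^ 2 / t
        ≤ (D * ∑ ℓ ∈ Finset.range (L + 1), b ℓ * scaleWeight s (h ℓ) t) ^ 2 / t := by
          have := hK t ht0
          gcongr ?_ ^ 2 / t
      _ ≤ D ^ 2 * (M * ∑ ℓ ∈ Finset.range (L + 1), b ℓ ^ 2 * scaleWeight s (h ℓ) t) / t := by
          rw [mul_pow]; gcongr
      _ = _ := by
          rw [Finset.mul_sum, Finset.mul_sum, Finset.sum_div]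
          exact Finset.sum_congr rfl fun ℓ _ => by ring
  refine (setLIntegral_mono' measurableSet_Ioi hpt).trans ?_
  have hmeas : ∀ ℓ ∈ Finset.range (L + 1), Measurable fun t =>
      ENNReal.ofReal (D ^ 2 * M * b ℓ ^ 2) *
      ENNReal.ofReal (scaleWeight s (h ℓ) t / t) := fun ℓ _ =>
    (((measurable_scaleWeight s (h ℓ)).div measurable_id).ennreal_ofReal).const_mul _
  rw [lintegral_finsetSum _ hmeas]
  have hs1' : 0 < 1 - s := sub_pos.2 hs1
  have hle : ∀ ℓ ∈ Finset.range (L + 1), ∫⁻ t in Ioi (0 : ℝ),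
      ENNReal.ofReal (D ^ 2 * M * b ℓ ^ 2) * ENNReal.ofReal (scaleWeight s (h ℓ) t / t) ≤
      ENNReal.ofReal (D ^ 2 * M * (1 / (1 - s) + 1 / s) * (h ℓ ^ (-2 + 2 * s) * ‖w ℓ‖ ^ 2)) := by
    intro ℓ hℓ
    rw [lintegral_const_mul' _ _ ENNReal.ofReal_ne_top, ← sq_rpow_mul (hpos' ℓ hℓ)]
    refine (mul_le_mul_right (lintegral_scaleWeight_le hs0 hs1 (hpos' ℓ hℓ)) _).trans ?_
    rw [← ENNReal.ofReal_mul (by positivity)]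
    refine ENNReal.ofReal_le_ofReal (le_of_eq ?_)
    rw [hb]; ring
  refine (Finset.sum_le_sum hle).trans ?_
  rw [← ENNReal.ofReal_sum_of_nonneg, ← Finset.mul_sum]
  intro ℓ hℓ
  have := hpos' ℓ hℓ
  positivity

/-! ### Levels of a multilevel decomposition in the dual space -/

theorem toDualSpace_apply (φ : H) (w : V) : toDualSpace ι φ w = ⟪φ, ι w⟫ := rfl

theorem norm_toDualSpace_le (φ : H) : ‖toDualSpace ι φ‖ ≤ ‖ι‖ * ‖φ‖ := by
  refine ContinuousLinearMap.opNorm_le_bound _ (by positivity) fun w => ?_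
  rw [toDualSpace_apply]
  calc ‖⟪φ, ι w⟫‖ ≤ ‖φ‖ * ‖ι w‖ := norm_inner_le_norm _ _
    _ ≤ ‖φ‖ * (‖ι‖ * ‖w‖) := by gcongr; exact ι.le_opNorm w
    _ = _ := by ring

/-- An inverse estimate for `ψ` turns duality into a bound by the K-functional at the scale `δ`. -/
theorem inner_le_kFunctional {ι : V →L[ℝ] H} {CB δ : ℝ} (hδ : 0 < δ) (hCB : 1 ≤ CB) {ψ : H}
    (hψ : ‖ψ‖ ≤ CB / δ * ‖toDualSpace ι ψ‖) (v : H) :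
    ⟪ψ, v⟫ ≤ CB / δ * ‖toDualSpace ι ψ‖ * kFunctional ι δ v := by
  rw [kFunctional, Real.mul_iInf_of_nonneg (by positivity)]
  refine le_ciInf fun w => ?_
  have e : ⟪ψ, v⟫ = ⟪ψ, v - ι w⟫ + toDualSpace ι ψ w := by
    rw [toDualSpace_apply, inner_sub_right]; ring
  have h2 : toDualSpace ι ψ w ≤ ‖toDualSpace ι ψ‖ * ‖w‖ :=
    (Real.le_norm_self _).trans ((toDualSpace ι ψ).le_opNorm w)
  have h3 : ‖toDualSpace ι ψ‖ * ‖w‖ ≤ CB * (‖toDualSpace ι ψ‖ * ‖w‖) :=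
    le_mul_of_one_le_left (by positivity) hCB
  calc ⟪ψ, v⟫ = ⟪ψ, v - ι w⟫ + toDualSpace ι ψ w := e
    _ ≤ CB / δ * ‖toDualSpace ι ψ‖ * ‖v - ι w‖ + CB * (‖toDualSpace ι ψ‖ * ‖w‖) := by
      refine add_le_add ((real_inner_le_norm _ _).trans ?_) (h2.trans h3)
      gcongr
    _ = _ := by field_simp

/-- The direct estimate in `V'`, by duality from an approximation property of `Q` in `H`. -/
theorem exists_norm_toDualSpace_sub_le {ι : V →L[ℝ] H} {Q : Submodule ℝ H}
    [FiniteDimensional ℝ Q] {δ : ℝ}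
    (hδ : 0 ≤ δ) (hJ : ∀ w : V, ∃ p ∈ Q, ‖ι w - p‖ ≤ δ * ‖w‖) (f : H) :
    ∃ q ∈ Q, ‖toDualSpace ι (f - q)‖ ≤ δ * ‖f‖ := by
  refine ⟨Q.starProjection f, Submodule.starProjection_apply_mem _ _, ?_⟩
  refine ContinuousLinearMap.opNorm_le_bound _ (by positivity) fun w => ?_
  obtain ⟨p, hp, hpw⟩ := hJ w
  have horth : ⟪f - Q.starProjection f, p⟫ = 0 := Submodule.starProjection_inner_eq_zero f p hp
  have hnorm : ‖f - Q.starProjection f‖ ≤ ‖f‖ := by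
    have h1 : ⟪f - Q.starProjection f, Q.starProjection f⟫ = 0 :=
      Submodule.starProjection_inner_eq_zero f _ (Submodule.starProjection_apply_mem _ _)
    have h2 := norm_add_sq_eq_norm_sq_add_norm_sq_of_inner_eq_zero _ _ h1
    rw [sub_add_cancel] at h2
    nlinarith [norm_nonneg f, norm_nonneg (f - Q.starProjection f),
      norm_nonneg (Q.starProjection f)]
  rw [toDualSpace_apply]
  have e : ⟪f - Q.starProjection f, ι w⟫ = ⟪f - Q.starProjection f, ι w - p⟫ := by
    rw [inner_sub_right, horth, sub_zero]
  rw [e]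
  calc _ ≤ ‖f - Q.starProjection f‖ * ‖ι w - p‖ := norm_inner_le_norm _ _
    _ ≤ ‖f‖ * (δ * ‖w‖) := by gcongr
    _ = _ := by ring

variable [CompleteSpace V]

theorem dual_inner_eq_apply (F G : StrongDual ℝ V) :
    ⟪F, G⟫ = F ((InnerProductSpace.toDual ℝ V).symm G) := by
  conv_rhs => rw [← (InnerProductSpace.toDual ℝ V).apply_symm_apply F]
  rw [InnerProductSpace.toDual_apply_apply]
  rfl

/-- The Riesz representative of `G ∈ V'`, viewed in `H`, represents the `V'` scalar product with `G`
on `H`. -/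
theorem dual_inner_toDualSpace (φ : H) (G : StrongDual ℝ V) :
    ⟪toDualSpace ι φ, G⟫ = ⟪φ, ι ((InnerProductSpace.toDual ℝ V).symm G)⟫ := by
  rw [dual_inner_eq_apply, toDualSpace_apply]

/-- The increments `(Π_ℓ - Π_{ℓ-1}) φ`, `Π_{-1} = 0`, of the `V'`-orthogonal projections `Π_ℓ` onto
`P ℓ`. -/
noncomputable def multilevelPart (P : ℕ → Submodule ℝ H) [∀ ℓ, FiniteDimensional ℝ (P ℓ)] (φ : H) :
    ℕ → StrongDual ℝ V
  | 0 => dualProj ι (P 0) (toDualSpace ι φ)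
  | ℓ + 1 => dualProj ι (P (ℓ + 1)) (toDualSpace ι φ) - dualProj ι (P ℓ) (toDualSpace ι φ)

variable {ι}

theorem dualProj_mem (P : Submodule ℝ H) [FiniteDimensional ℝ P] (F : StrongDual ℝ V) :
    dualProj ι P F ∈ P.map (toDualSpace ι) :=
  Submodule.starProjection_apply_mem _ _

theorem inner_sub_dualProj (P : Submodule ℝ H) [FiniteDimensional ℝ P] (F G : StrongDual ℝ V)
    (hG : G ∈ P.map (toDualSpace ι)) : ⟪F - dualProj ι P F, G⟫ = 0 :=
  Submodule.starProjection_inner_eq_zero F G hG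

section Levels

variable {P : ℕ → Submodule ℝ H} [∀ ℓ, FiniteDimensional ℝ (P ℓ)] {L : ℕ}

/-- The increment of level `ℓ` is represented by an element of `P ℓ`. -/
theorem multilevelPart_mem (hP : ∀ ℓ < L, P ℓ ≤ P (ℓ + 1)) (φ : H) {ℓ : ℕ} (hℓ : ℓ ≤ L) :
    multilevelPart ι P φ ℓ ∈ (P ℓ).map (toDualSpace ι) := by
  cases ℓ with
  | zero => exact dualProj_mem _ _
  | succ ℓ =>
    exact Submodule.sub_mem _ (dualProj_mem _ _) (Submodule.map_mono (hP ℓ hℓ) (dualProj_mem _ _))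

theorem inner_multilevelPart_succ (hP : ∀ ℓ < L, P ℓ ≤ P (ℓ + 1)) (φ : H) {ℓ : ℕ} (hℓ : ℓ < L)
    {q : H} (hq : q ∈ P ℓ) : ⟪multilevelPart ι P φ (ℓ + 1), toDualSpace ι q⟫ = 0 := by
  have h1 := inner_sub_dualProj (P ℓ) (toDualSpace ι φ) (toDualSpace ι q)
    (Submodule.mem_map_of_mem hq)
  have h2 := inner_sub_dualProj (P (ℓ + 1)) (toDualSpace ι φ) (toDualSpace ι q)
    (Submodule.mem_map_of_mem (hP ℓ hℓ hq))
  rw [inner_sub_left] at h1 h2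
  rw [multilevelPart, inner_sub_left]
  linarith

theorem sum_multilevelPart (φ : H) (n : ℕ) :
    ∑ ℓ ∈ Finset.range (n + 1), multilevelPart ι P φ ℓ = dualProj ι (P n) (toDualSpace ι φ) := by
  induction n with
  | zero => simp [multilevelPart]
  | succ n ih => rw [Finset.sum_range_succ, ih, multilevelPart]; abel

theorem dualProj_eq_self {n : ℕ} {φ : H} (hφ : φ ∈ P n) :
    dualProj ι (P n) (toDualSpace ι φ) = toDualSpace ι φ :=
  Submodule.starProjection_eq_self_iff.2 (Submodule.mem_map_of_mem hφ)

theorem inner_toDualSpace_multilevelPart (hP : ∀ ℓ < L, P ℓ ≤ P (ℓ + 1)) (φ : H) {ℓ : ℕ}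
    (hℓ : ℓ ≤ L) :
    ⟪toDualSpace ι φ, multilevelPart ι P φ ℓ⟫ = ‖multilevelPart ι P φ ℓ‖ ^ 2 := by
  have h1 := inner_sub_dualProj (P ℓ) (toDualSpace ι φ) _ (multilevelPart_mem (ι := ι) hP φ hℓ)
  rw [inner_sub_left, sub_eq_zero] at h1
  rw [h1, ← real_inner_self_eq_norm_sq]
  cases ℓ with
  | zero => rfl
  | succ ℓ =>
    obtain ⟨q, hq, hq'⟩ := dualProj_mem (ι := ι) (P ℓ) (toDualSpace ι φ)
    have h2 := inner_multilevelPart_succ (ι := ι) hP φ hℓ hq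
    rw [hq', real_inner_comm] at h2
    have h3 : dualProj ι (P (ℓ + 1)) (toDualSpace ι φ) =
        multilevelPart ι P φ (ℓ + 1) + dualProj ι (P ℓ) (toDualSpace ι φ) := by
      rw [multilevelPart, sub_add_cancel]
    rw [h3, inner_add_left, h2, add_zero]

end Levels

/-- Functionals orthogonal to `Q` have Riesz representatives that are small in `H`. -/
theorem norm_riesz_le_of_orthogonal {Q : Submodule ℝ H} [FiniteDimensional ℝ Q] {δ : ℝ}
    (hδ : 0 ≤ δ) (hJ : ∀ w : V, ∃ p ∈ Q, ‖ι w - p‖ ≤ δ * ‖w‖) (G : StrongDual ℝ V)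
    (hG : ∀ q ∈ Q, ⟪G, toDualSpace ι q⟫ = 0) :
    ‖ι ((InnerProductSpace.toDual ℝ V).symm G)‖ ≤ δ * ‖G‖ := by
  set f := ι ((InnerProductSpace.toDual ℝ V).symm G) with hf
  obtain ⟨q, hq, hqf⟩ := exists_norm_toDualSpace_sub_le hδ hJ f
  have h1 : ‖f‖ ^ 2 ≤ δ * ‖f‖ * ‖G‖ := by
    calc ‖f‖ ^ 2 = ⟪toDualSpace ι f, G⟫ := by
          rw [dual_inner_toDualSpace, ← hf, real_inner_self_eq_norm_sq]
      _ = ⟪toDualSpace ι (f - q), G⟫ := by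
          rw [map_sub, inner_sub_left, real_inner_comm G (toDualSpace ι q), hG q hq, sub_zero]
      _ ≤ ‖toDualSpace ι (f - q)‖ * ‖G‖ := real_inner_le_norm _ _
      _ ≤ _ := by gcongr
  rcases (norm_nonneg f).eq_or_lt with h0 | h0
  · rw [← h0]; positivity
  · refine le_of_mul_le_mul_left ?_ h0
    nlinarith

/-- Elements of `H` that are orthogonal to `Q` in `V'` are small in `V'`. -/
theorem norm_toDualSpace_le_of_orthogonal {Q : Submodule ℝ H} [FiniteDimensional ℝ Q] {δ : ℝ}
    (hδ : 0 ≤ δ) (hJ : ∀ w : V, ∃ p ∈ Q, ‖ι w - p‖ ≤ δ * ‖w‖) (ψ : H)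
    (hψ : ∀ q ∈ Q, ⟪toDualSpace ι ψ, toDualSpace ι q⟫ = 0) :
    ‖toDualSpace ι ψ‖ ≤ δ * ‖ψ‖ := by
  obtain ⟨q, hq, hqf⟩ := exists_norm_toDualSpace_sub_le hδ hJ ψ
  have h1 : ‖toDualSpace ι ψ‖ ^ 2 ≤ ‖toDualSpace ι ψ‖ * (δ * ‖ψ‖) := by
    calc ‖toDualSpace ι ψ‖ ^ 2 = ⟪toDualSpace ι ψ, toDualSpace ι (ψ - q)⟫ := by
          rw [map_sub, inner_sub_right, hψ q hq, sub_zero, real_inner_self_eq_norm_sq]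
      _ ≤ ‖toDualSpace ι ψ‖ * ‖toDualSpace ι (ψ - q)‖ := real_inner_le_norm _ _
      _ ≤ _ := by gcongr
  rcases (norm_nonneg (toDualSpace ι ψ)).eq_or_lt with h0 | h0
  · rw [← h0]; positivity
  · refine le_of_mul_le_mul_left ?_ h0
    nlinarith

/-! ### The abstract multilevel norm equivalence -/

/-- A sequence of nested subspaces `P 0 ⊆ ⋯ ⊆ P L` of `H` with mesh sizes `h 0, …, h L` satisfying a
direct estimate (with constant `CJ`) and an inverse estimate (with constant `CB`); the mesh
sizes decay geometrically, with bounded ratios of consecutive ones, and `h 0` is bounded below. -/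
structure IsMultilevelScale (ι : V →L[ℝ] H) (CJ CB A θ κ c₀ : ℝ) (L : ℕ)
    (P : ℕ → Submodule ℝ H) (h : ℕ → ℝ) : Prop where
  nested : ∀ ℓ < L, P ℓ ≤ P (ℓ + 1)
  size_pos : ∀ ℓ ≤ L, 0 < h ℓ
  decay : ∀ ℓ m, ℓ ≤ m → m ≤ L → h m ≤ A * θ ^ (m - ℓ) * h ℓ
  ratio : ∀ ℓ < L, h ℓ ≤ κ * h (ℓ + 1)
  coarse : 1 ≤ c₀ * h 0
  direct : ∀ ℓ ≤ L, ∀ w : V, ∃ p ∈ P ℓ, ‖ι w - p‖ ≤ CJ * h ℓ * ‖w‖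
  inverse : ∀ ℓ ≤ L, ∀ ψ ∈ P ℓ, ‖ψ‖ ≤ CB / h ℓ * ‖toDualSpace ι ψ‖

/-- The square of the multilevel norm of `φ`. -/
noncomputable def multilevelSum (ι : V →L[ℝ] H) (s : ℝ) (L : ℕ) (P : ℕ → Submodule ℝ H)
    [∀ ℓ, FiniteDimensional ℝ (P ℓ)] (h : ℕ → ℝ) (φ : H) : ℝ :=
  ∑ ℓ ∈ Finset.range (L + 1), h ℓ ^ (-2 + 2 * s) * ‖multilevelPart ι P φ ℓ‖ ^ 2

section Equivalence

variable {P : ℕ → Submodule ℝ H} {L : ℕ} {h : ℕ → ℝ} {CJ CB A θ κ c₀ : ℝ}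
  [∀ ℓ, FiniteDimensional ℝ (P ℓ)]

theorem IsMultilevelScale.sum_eq (hms : IsMultilevelScale ι CJ CB A θ κ c₀ L P h) {φ : H}
    (hφ : φ ∈ P L) {ψ : ℕ → H} (hψ : ∀ ℓ ≤ L, ψ ℓ ∈ P ℓ)
    (hψ' : ∀ ℓ ≤ L, toDualSpace ι (ψ ℓ) = multilevelPart ι P φ ℓ) :
    ∑ ℓ ∈ Finset.range (L + 1), ψ ℓ = φ := by
  have hle : ∀ m ≤ L, ∀ ℓ ≤ m, P ℓ ≤ P m := by
    intro m
    induction m with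
    | zero => intro _ ℓ hℓ; rw [Nat.le_zero.1 hℓ]
    | succ m ih =>
      intro hm ℓ hℓ
      rcases Nat.le_succ_iff.1 hℓ with h1 | h1
      · exact (ih (by omega) ℓ h1).trans (hms.nested m (by omega))
      · rw [h1]
  have hmem : ∑ ℓ ∈ Finset.range (L + 1), ψ ℓ - φ ∈ P L := by
    refine Submodule.sub_mem _ (Submodule.sum_mem _ fun ℓ hℓ => ?_) hφ
    have h1 := Nat.lt_succ_iff.1 (Finset.mem_range.1 hℓ)
    exact hle L le_rfl ℓ h1 (hψ ℓ h1)
  have h0 : toDualSpace ι (∑ ℓ ∈ Finset.range (L + 1), ψ ℓ - φ) = 0 := by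
    rw [map_sub, map_sum, Finset.sum_congr rfl fun ℓ hℓ =>
      hψ' ℓ (Nat.lt_succ_iff.1 (Finset.mem_range.1 hℓ)), sum_multilevelPart, dualProj_eq_self hφ,
      sub_self]
  have h1 := hms.inverse L le_rfl _ hmem
  rw [h0, norm_zero, mul_zero, norm_le_zero_iff, sub_eq_zero] at h1
  exact h1

/-- The upper bound: the increments have representatives `ψ ℓ` in `P ℓ`, which sum up to `φ`, and
by the inverse estimate the pairing of `ψ ℓ` with `v` is bounded by the K-functional of `v` at
`h ℓ`. -/
theorem IsMultilevelScale.dualInterpNorm_sq_le (hms : IsMultilevelScale ι CJ CB A θ κ c₀ L P h)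
    {s M : ℝ} (hs0 : 0 < s) (hs1 : s < 1) (hM : 0 < M) (hCB : 1 ≤ CB)
    (hsum : ∀ t : ℝ, 0 < t → ∑ ℓ ∈ Finset.range (L + 1), scaleWeight s (h ℓ) t ≤ M)
    {φ : H} (hφ : φ ∈ P L) :
    dualInterpNorm ι s φ ^ 2 ≤
      ENNReal.ofReal (CB ^ 2 * (16 * M)) * ENNReal.ofReal (multilevelSum ι s L P h φ) := by
  have hex : ∀ ℓ, ∃ ψ : H, ℓ ≤ L → ψ ∈ P ℓ ∧ toDualSpace ι ψ = multilevelPart ι P φ ℓ := by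
    intro ℓ
    by_cases hℓ : ℓ ≤ L
    · obtain ⟨ψ, h1, h2⟩ := multilevelPart_mem (ι := ι) hms.nested φ hℓ
      exact ⟨ψ, fun _ => ⟨h1, h2⟩⟩
    · exact ⟨0, fun h => absurd h hℓ⟩
  choose ψ hψ using hex
  have hsumψ := hms.sum_eq hφ (fun ℓ hℓ => (hψ ℓ hℓ).1) (fun ℓ hℓ => (hψ ℓ hℓ).2)
  set S := multilevelSum ι s L P h φ with hS
  have hS0 : 0 ≤ S := Finset.sum_nonneg fun ℓ hℓ => by
    have := hms.size_pos ℓ (Nat.lt_succ_iff.1 (Finset.mem_range.1 hℓ))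
    positivity
  have hmain : dualInterpNorm ι s φ ≤ ENNReal.ofReal (CB * √(16 * M) * √S) := by
    refine iSup_le fun v => iSup_le fun _ => iSup_le fun hvt => ?_
    refine ENNReal.div_le_of_le_mul ?_
    obtain ⟨i, hi⟩ : ∃ i : ℝ≥0, interpNorm ι s v = i := ⟨_, (ENNReal.coe_toNNReal hvt.ne).symm⟩
    have hK := sum_kFunctional_sq_le (ι := ι) hs0 hs1 hms.size_pos hsum v
    set X := ∑ ℓ ∈ Finset.range (L + 1), (h ℓ ^ (-s) * kFunctional ι (h ℓ) v) ^ 2 with hX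
    rw [hi] at hK ⊢
    rw [← ENNReal.ofReal_coe_nnreal, ← ENNReal.ofReal_pow i.coe_nonneg,
      ← ENNReal.ofReal_mul (by positivity),
      ENNReal.ofReal_le_ofReal_iff (by positivity)] at hK
    rw [← ENNReal.ofReal_coe_nnreal, ← ENNReal.ofReal_mul (by positivity)]
    refine ENNReal.ofReal_le_ofReal ?_
    have hXle : √X ≤ √(16 * M) * i := by
      refine (Real.sqrt_le_sqrt hK).trans (le_of_eq ?_)
      rw [Real.sqrt_mul (by positivity), Real.sqrt_sq i.coe_nonneg]
    have hSeq : S = ∑ ℓ ∈ Finset.range (L + 1),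
        (h ℓ ^ (-1 + s) * ‖multilevelPart ι P φ ℓ‖) ^ 2 :=
      Finset.sum_congr rfl fun ℓ hℓ =>
        (sq_rpow_mul (hms.size_pos ℓ (Nat.lt_succ_iff.1 (Finset.mem_range.1 hℓ))) _ _).symm
    calc ⟪φ, v⟫ = ∑ ℓ ∈ Finset.range (L + 1), ⟪ψ ℓ, v⟫ := by rw [← hsumψ, sum_inner]
      _ ≤ ∑ ℓ ∈ Finset.range (L + 1), CB * ((h ℓ ^ (-1 + s) * ‖multilevelPart ι P φ ℓ‖) *
          (h ℓ ^ (-s) * kFunctional ι (h ℓ) v)) := by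
        refine Finset.sum_le_sum fun ℓ hℓ => ?_
        have hℓL := Nat.lt_succ_iff.1 (Finset.mem_range.1 hℓ)
        have hp := hms.size_pos ℓ hℓL
        refine (inner_le_kFunctional (ι := ι) hp hCB
          (hms.inverse ℓ hℓL _ (hψ ℓ hℓL).1) v).trans (le_of_eq ?_)
        rw [(hψ ℓ hℓL).2]
        have : h ℓ ^ (-1 + s) * h ℓ ^ (-s) = (h ℓ)⁻¹ := by
          rw [← Real.rpow_add hp, ← Real.rpow_neg_one]; congr 1; ring
        rw [div_eq_mul_inv, ← this]
        ring
      _ ≤ CB * (√S * √X) := by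
        rw [← Finset.mul_sum, hSeq, hX]
        gcongr
        exact Real.sum_mul_le_sqrt_mul_sqrt _ _ _
      _ ≤ CB * (√S * (√(16 * M) * i)) := by gcongr
      _ = _ := by ring
  calc dualInterpNorm ι s φ ^ 2 ≤ ENNReal.ofReal (CB * √(16 * M) * √S) ^ 2 := by gcongr
    _ = _ := by
      rw [← ENNReal.ofReal_pow (by positivity), ← ENNReal.ofReal_mul (by positivity)]
      congr 1
      rw [mul_pow, mul_pow, Real.sq_sqrt (by positivity), Real.sq_sqrt hS0]

theorem IsMultilevelScale.norm_riesz_le (hms : IsMultilevelScale ι CJ CB A θ κ c₀ L P h)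
    {D : ℝ} (hCJ : 0 ≤ CJ) (hDJ : CJ * κ ≤ D) (hDι : ‖ι‖ * c₀ ≤ D)
    (φ : H) {ℓ : ℕ} (hℓ : ℓ ≤ L) :
    ‖ι ((InnerProductSpace.toDual ℝ V).symm (multilevelPart ι P φ ℓ))‖ ≤
      D * h ℓ * ‖multilevelPart ι P φ ℓ‖ := by
  have hp := hms.size_pos ℓ hℓ
  cases ℓ with
  | zero =>
    refine (ι.le_opNorm _).trans ?_
    rw [LinearIsometryEquiv.norm_map]
    gcongr
    calc ‖ι‖ ≤ ‖ι‖ * (c₀ * h 0) := le_mul_of_one_le_right (norm_nonneg _) hms.coarse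
      _ = ‖ι‖ * c₀ * h 0 := by ring
      _ ≤ D * h 0 := by gcongr
  | succ ℓ =>
    have hp' := hms.size_pos ℓ (by omega)
    refine (norm_riesz_le_of_orthogonal (Q := P ℓ) (by positivity) (hms.direct ℓ (by omega)) _
      fun q hq => inner_multilevelPart_succ hms.nested φ hℓ hq).trans ?_
    refine mul_le_mul_of_nonneg_right ?_ (norm_nonneg _)
    calc CJ * h ℓ ≤ CJ * (κ * h (ℓ + 1)) := by gcongr; exact hms.ratio ℓ hℓ
      _ = CJ * κ * h (ℓ + 1) := by ring
      _ ≤ _ := by gcongr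

/-- The lower bound: `φ` is tested with the weighted sum of the Riesz representatives of its
increments, which are small in `H` by the direct estimate and orthogonality. -/
theorem IsMultilevelScale.multilevelSum_le (hms : IsMultilevelScale ι CJ CB A θ κ c₀ L P h)
    {s M D : ℝ} (hs0 : 0 < s) (hs1 : s < 1) (hM : 0 < M) (hD : 1 ≤ D)
    (hCJ : 0 ≤ CJ) (hDJ : CJ * κ ≤ D) (hDι : ‖ι‖ * c₀ ≤ D)
    (hsum : ∀ t : ℝ, 0 < t → ∑ ℓ ∈ Finset.range (L + 1), scaleWeight s (h ℓ) t ≤ M) (φ : H) :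
    ENNReal.ofReal (multilevelSum ι s L P h φ) ≤
      ENNReal.ofReal (D ^ 2 * M * (1 / (1 - s) + 1 / s)) * dualInterpNorm ι s φ ^ 2 := by
  set S := multilevelSum ι s L P h φ with hS
  have hpos' : ∀ ℓ ∈ Finset.range (L + 1), 0 < h ℓ := fun ℓ hℓ =>
    hms.size_pos ℓ (Nat.lt_succ_iff.1 (Finset.mem_range.1 hℓ))
  have hS0 : 0 ≤ S := Finset.sum_nonneg fun ℓ hℓ => by
    have := hpos' ℓ hℓ
    positivity
  rcases hS0.eq_or_lt with h0 | h0
  · rw [← h0]; simp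
  set E := D ^ 2 * M * (1 / (1 - s) + 1 / s) with hE
  have hs1' : 0 < 1 - s := sub_pos.2 hs1
  have hE0 : 0 < E := by positivity
  set w : ℕ → V := fun ℓ => (InnerProductSpace.toDual ℝ V).symm (multilevelPart ι P φ ℓ) with hw
  have hwn : ∀ ℓ, ‖w ℓ‖ = ‖multilevelPart ι P φ ℓ‖ := fun ℓ => LinearIsometryEquiv.norm_map _ _
  set v := ι (∑ ℓ ∈ Finset.range (L + 1), h ℓ ^ (-2 + 2 * s) • w ℓ) with hv
  have hφv : ⟪φ, v⟫ = S := by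
    rw [hv, map_sum, inner_sum, hS, multilevelSum]
    refine Finset.sum_congr rfl fun ℓ hℓ => ?_
    rw [map_smul, real_inner_smul_right, hw, ← dual_inner_toDualSpace,
      inner_toDualSpace_multilevelPart hms.nested φ (Nat.lt_succ_iff.1 (Finset.mem_range.1 hℓ))]
  have hint : interpNorm ι s v ^ 2 ≤ ENNReal.ofReal (E * S) := by
    have := interpNorm_sum_sq_le (ι := ι) hs0 hs1 hM hD hms.size_pos hsum w fun ℓ hℓ => by
      rw [hwn]; exact hms.norm_riesz_le hCJ hDJ hDι φ hℓ
    simp only [hwn] at this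
    exact this
  have hint' : interpNorm ι s v ≤ ENNReal.ofReal √(E * S) := by
    rw [← Real.sq_sqrt (by positivity : 0 ≤ E * S), ENNReal.ofReal_pow (by positivity)] at hint
    exact (ENNReal.pow_le_pow_left_iff two_ne_zero).1 hint
  have hv0 : v ≠ 0 := by
    intro hc
    rw [hc, inner_zero_right] at hφv
    exact h0.ne hφv
  have hle : ENNReal.ofReal S / interpNorm ι s v ≤ dualInterpNorm ι s φ := by
    rw [← hφv]
    exact le_iSup_of_le v (le_iSup_of_le hv0 (le_iSup_of_le
      (hint'.trans_lt ENNReal.ofReal_lt_top) le_rfl))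
  have hle2 : ENNReal.ofReal (S / √(E * S)) ≤ dualInterpNorm ι s φ := by
    refine le_trans ?_ hle
    rw [ENNReal.ofReal_div_of_pos (by positivity)]
    gcongr
  calc ENNReal.ofReal S = ENNReal.ofReal E * ENNReal.ofReal (S / √(E * S)) ^ 2 := by
        rw [← ENNReal.ofReal_pow (by positivity), ← ENNReal.ofReal_mul (by positivity), div_pow,
          Real.sq_sqrt (by positivity)]
        congr 1
        field_simp
    _ ≤ _ := by gcongr

end Equivalence

/-- Direct and inverse estimates on a geometrically decaying scale of mesh sizes imply the
equivalence of the dual interpolation norm with the multilevel norm. -/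
theorem exists_equivWith_multilevelSum (ι : V →L[ℝ] H) {s CJ CB A θ κ c₀ : ℝ}
    (hs0 : 0 < s) (hs1 : s < 1) (hCJ : 0 ≤ CJ) (hCB : 1 ≤ CB) (hA : 0 < A) (hθ0 : 0 < θ)
    (hθ1 : θ < 1) :
    ∃ C : ℝ, 0 < C ∧ ∀ (L : ℕ) (P : ℕ → Submodule ℝ H) [∀ ℓ, FiniteDimensional ℝ (P ℓ)]
      (h : ℕ → ℝ), IsMultilevelScale ι CJ CB A θ κ c₀ L P h → ∀ φ ∈ P L,
        EquivWith C (dualInterpNorm ι s φ ^ 2) (ENNReal.ofReal (multilevelSum ι s L P h φ)) := by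
  obtain ⟨M, hM, hsum⟩ := exists_sum_scaleWeight_le hs0 hs1 hA hθ0 hθ1
  set D := max 1 (max (CJ * κ) (‖ι‖ * c₀)) with hD
  refine ⟨max (CB ^ 2 * (16 * M)) (D ^ 2 * M * (1 / (1 - s) + 1 / s)),
    lt_max_of_lt_left (by positivity), fun L P _ h hms φ hφ => ⟨?_, ?_⟩⟩
  · refine (hms.dualInterpNorm_sq_le hs0 hs1 hM hCB (hsum L h hms.size_pos hms.decay) hφ).trans ?_
    gcongr
    exact le_max_left _ _
  · refine (hms.multilevelSum_le (D := D) hs0 hs1 hM (le_max_left _ _) hCJ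
      ((le_max_left _ _).trans (le_max_right _ _)) ((le_max_right _ _).trans (le_max_right _ _))
      (hsum L h hms.size_pos hms.decay) φ).trans ?_
    gcongr
    exact le_max_right _ _

end AbstractMultilevel

/-! ### Geometry of simplices -/

/-- The volume of the unit ball of `ℝᵈ`. -/
noncomputable def unitBallVol (d : ℕ) : ℝ := (volume : Measure (Eu d)).real (Metric.ball 0 1)

theorem unitBallVol_pos (d : ℕ) : 0 < unitBallVol d :=
  ENNReal.toReal_pos (Metric.measure_ball_pos _ _ one_pos).ne'
    Metric.isBounded_ball.measure_lt_top.ne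

theorem volume_real_closedBall {d : ℕ} (x : Eu d) {r : ℝ} (hr : 0 ≤ r) :
    (volume : Measure (Eu d)).real (Metric.closedBall x r) = r ^ d * unitBallVol d := by
  rw [Measure.addHaar_real_closedBall _ _ hr, finrank_euclideanSpace_fin, unitBallVol]

namespace MeshSimplex

variable {d : ℕ} (T : MeshSimplex d)

/-- The vertices of a non-degenerate simplex, as an affine basis; its coordinates are the
barycentric coordinates. -/
noncomputable def basis : AffineBasis T.verts ℝ (Eu d) where
  toFun := (↑)
  ind' := T.affineIndependent
  tot' := by
    refine T.affineIndependent.affineSpan_eq_top_iff_card_eq_finrank_add_one.2 ?_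
    rw [finrank_euclideanSpace_fin, Fintype.card_coe, T.card_verts]

theorem range_basis : range T.basis = (T.verts : Set (Eu d)) := Subtype.range_coe

theorem closedSet_eq : T.closedSet = {x | ∀ i, 0 ≤ T.basis.coord i x} := by
  rw [closedSet, ← range_basis, AffineBasis.convexHull_eq_nonneg_coord]

theorem openSet_eq : T.openSet = {x | ∀ i, 0 < T.basis.coord i x} := by
  rw [openSet, closedSet, ← range_basis, AffineBasis.interior_convexHull]

theorem isOpen_openSet : IsOpen T.openSet := isOpen_interior

theorem convex_openSet : Convex ℝ T.openSet := (convex_convexHull ℝ (T.verts : Set (Eu d))).interior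

theorem isCompact_closedSet : IsCompact T.closedSet := T.verts.finite_toSet.isCompact_convexHull ℝ

theorem openSet_subset : T.openSet ⊆ T.closedSet := interior_subset

theorem isBounded_openSet : Bornology.IsBounded T.openSet :=
  T.isCompact_closedSet.isBounded.subset interior_subset

theorem centroid_mem : Finset.univ.centroid ℝ T.basis ∈ T.openSet := by
  rw [openSet, closedSet, ← range_basis]
  exact T.basis.centroid_mem_interior_convexHull

theorem openSet_nonempty : T.openSet.Nonempty := ⟨_, T.centroid_mem⟩

theorem closure_openSet : closure T.openSet = T.closedSet := by
  have hc : Convex ℝ T.closedSet := convex_convexHull ℝ _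
  rw [openSet, hc.closure_interior_eq_closure_of_nonempty_interior T.openSet_nonempty]
  exact T.isCompact_closedSet.isClosed.closure_eq

theorem volume_openSet_ne_top : (volume : Measure (Eu d)) T.openSet ≠ ⊤ :=
  T.isBounded_openSet.measure_lt_top.ne

theorem vol_pos : 0 < T.vol :=
  ENNReal.toReal_pos (T.isOpen_openSet.measure_pos _ T.openSet_nonempty).ne' T.volume_openSet_ne_top

theorem diam_nonneg : 0 ≤ T.diam := Metric.diam_nonneg

theorem openSet_subset_closedBall {x : Eu d} (hx : x ∈ T.openSet) :
    T.openSet ⊆ Metric.closedBall x T.diam := fun _ hy =>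
  Metric.dist_le_diam_of_mem T.isBounded_openSet hy hx

theorem vol_le : T.vol ≤ T.diam ^ d * unitBallVol d := by
  obtain ⟨x, hx⟩ := T.openSet_nonempty
  rw [← volume_real_closedBall x T.diam_nonneg]
  exact measureReal_mono (T.openSet_subset_closedBall hx)
    Metric.isBounded_closedBall.measure_lt_top.ne

theorem diam_pos (hd : d ≠ 0) : 0 < T.diam := by
  refine T.diam_nonneg.lt_of_ne fun h => ?_
  have h1 := T.vol_le
  rw [← h, zero_pow hd, zero_mul] at h1
  exact absurd T.vol_pos (not_lt.2 h1)

theorem coord_le_one {x : Eu d} (hx : x ∈ T.openSet) (i : T.verts) : T.basis.coord i x ≤ 1 := by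
  rw [openSet_eq] at hx
  rw [← T.basis.sum_coord_apply_eq_one x]
  exact Finset.single_le_sum (f := fun i => T.basis.coord i x) (fun j _ => (hx j).le)
    (Finset.mem_univ i)

theorem coord_add (i : T.verts) (x v : Eu d) :
    T.basis.coord i (v + x) = (T.basis.coord i).linear v + T.basis.coord i x :=
  (T.basis.coord i).map_vadd x v

/-- The slopes of the barycentric coordinates of a shape regular simplex are bounded by the inverse
of its diameter: if `λᵢ` has slope `m` in the unit direction `v`, the translates of `T` by the
multiples `k v / m` are disjoint, and about `m · diam T` of them fit into a ball of
radius `2 diam T`. -/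
theorem coord_linear_le {Creg : ℝ} (hd : d ≠ 0) (hreg : T.diam ^ d ≤ Creg * T.vol)
    (i : T.verts) (v : Eu d) :
    (T.basis.coord i).linear v ≤ 2 ^ d * unitBallVol d * Creg / T.diam * ‖v‖ := by
  set lin := (T.basis.coord i).linear with hlin
  have hh := T.diam_pos hd
  have hω := unitBallVol_pos d
  have hC : 0 ≤ Creg := by
    by_contra hc
    push Not at hc
    have h1 := mul_neg_of_neg_of_pos hc T.vol_pos
    have h2 : 0 < T.diam ^ d := pow_pos hh d
    linarith
  rcases le_or_gt (lin v) 0 with hv | hv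
  · exact hv.trans (by positivity)
  have hv0 : v ≠ 0 := by
    rintro rfl
    simp at hv
  have hvn : 0 < ‖v‖ := norm_pos_iff.2 hv0
  set y : Eu d := (lin v)⁻¹ • v with hy
  have hliny : lin y = 1 := by
    rw [hy, map_smul, smul_eq_mul, inv_mul_cancel₀ hv.ne']
  set m := lin v / ‖v‖ with hm
  have hm0 : 0 < m := div_pos hv hvn
  have hny : ‖y‖ = m⁻¹ := by
    rw [hy, norm_smul, norm_inv, Real.norm_of_nonneg hv.le, hm, inv_div, div_eq_inv_mul]
  set N := ⌊T.diam * m⌋₊ with hN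
  obtain ⟨x₀, hx₀⟩ := T.openSet_nonempty
  let A : ℕ → Set (Eu d) := fun k => (fun x => (k : ℝ) • y + x) '' T.openSet
  have hAmeas : ∀ k, (volume : Measure (Eu d)) (A k) = volume T.openSet := fun k => by
    simp only [A, image_add_left, measure_preimage_add]
  have hAm : ∀ k, MeasurableSet (A k) := fun k => by
    simp only [A, image_add_left]
    exact measurable_const_add _ T.measurableSet_openSet
  have hAcoord : ∀ k, ∀ z ∈ A k, (k : ℝ) < T.basis.coord i z ∧ T.basis.coord i z ≤ k + 1 := by
    rintro k _ ⟨x, hx, rfl⟩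
    have h1 := T.coord_le_one hx i
    have h2 : 0 < T.basis.coord i x := by
      rw [openSet_eq] at hx; exact hx i
    simp only [coord_add, map_smul]
    rw [← hlin, hliny, smul_eq_mul, mul_one]
    constructor <;> linarith
  have hdisj : Set.PairwiseDisjoint (Finset.range (N + 1) : Set ℕ) A := by
    intro a _ b _ hab
    rw [Function.onFun, Set.disjoint_left]
    intro z ha hb
    have h1 := hAcoord a z ha
    have h2 := hAcoord b z hb
    rcases lt_or_gt_of_ne hab with h | h
    · have : (a : ℝ) + 1 ≤ b := by exact_mod_cast h
      linarith [h1.2, h2.1]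
    · have : (b : ℝ) + 1 ≤ a := by exact_mod_cast h
      linarith [h1.1, h2.2]
  have hsub : ⋃ k ∈ Finset.range (N + 1), A k ⊆ Metric.closedBall x₀ (2 * T.diam) := by
    refine iUnion₂_subset fun k hk => ?_
    rintro _ ⟨x, hx, rfl⟩
    have h1 := T.openSet_subset_closedBall hx₀ hx
    rw [Metric.mem_closedBall, dist_eq_norm] at h1 ⊢
    have hk' : (k : ℝ) ≤ T.diam * m := by
      have : k ≤ N := Nat.lt_succ_iff.1 (Finset.mem_range.1 hk)
      exact (Nat.cast_le.2 this).trans (Nat.floor_le (by positivity))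
    have h2 : ‖(k : ℝ) • y‖ ≤ T.diam := by
      rw [norm_smul, hny, Real.norm_natCast, ← div_eq_mul_inv, div_le_iff₀ hm0]
      exact hk'
    calc ‖(k : ℝ) • y + x - x₀‖ = ‖(k : ℝ) • y + (x - x₀)‖ := by congr 1; abel
      _ ≤ ‖(k : ℝ) • y‖ + ‖x - x₀‖ := norm_add_le _ _
      _ ≤ 2 * T.diam := by linarith
  have hvol : (N + 1 : ℝ) * T.vol ≤ (2 * T.diam) ^ d * unitBallVol d := by
    rw [← volume_real_closedBall x₀ (by positivity)]
    refine le_trans (le_of_eq ?_)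
      (measureReal_mono hsub Metric.isBounded_closedBall.measure_lt_top.ne)
    rw [measureReal_def, measure_biUnion_finset hdisj fun k _ => hAm k,
      Finset.sum_congr rfl fun k _ => hAmeas k, Finset.sum_const, Finset.card_range, nsmul_eq_mul,
      ENNReal.toReal_mul, ENNReal.toReal_natCast]
    simp [vol, measureReal_def]
  have hfl : T.diam * m < N + 1 := Nat.lt_floor_add_one _
  have hV := T.vol_pos
  have h3 : T.diam * m * T.vol ≤ 2 ^ d * unitBallVol d * Creg * T.vol :=
    calc T.diam * m * T.vol ≤ (N + 1 : ℝ) * T.vol := by gcongr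
      _ ≤ (2 * T.diam) ^ d * unitBallVol d := hvol
      _ = 2 ^ d * unitBallVol d * T.diam ^ d := by rw [mul_pow]; ring
      _ ≤ 2 ^ d * unitBallVol d * (Creg * T.vol) := by gcongr
      _ = _ := by ring
  have h4 := le_of_mul_le_mul_right h3 hV
  have h5 : m ≤ 2 ^ d * unitBallVol d * Creg / T.diam := by
    rw [le_div_iff₀ hh]; linarith
  calc lin v = m * ‖v‖ := by rw [hm, div_mul_cancel₀ _ hvn.ne']
    _ ≤ _ := by gcongr

/-- A shape regular simplex contains a ball of radius comparable to its diameter. -/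
theorem exists_closedBall_subset {Creg : ℝ} (hd : d ≠ 0) (hC : 0 < Creg)
    (hreg : T.diam ^ d ≤ Creg * T.vol) :
    ∃ x, Metric.closedBall x (T.diam / (2 * (d + 1) * (2 ^ d * unitBallVol d * Creg))) ⊆
      T.openSet := by
  have hh := T.diam_pos hd
  have hω := unitBallVol_pos d
  refine ⟨Finset.univ.centroid ℝ T.basis, fun z hz => ?_⟩
  rw [openSet_eq]
  intro i
  set c := Finset.univ.centroid ℝ T.basis with hc
  have h1 : T.basis.coord i c = ((d : ℝ) + 1)⁻¹ := by
    rw [hc, T.basis.coord_apply_centroid (Finset.mem_univ i)]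
    simp [T.card_verts]
  have h2 := T.coord_linear_le hd hreg i (c - z)
  rw [Metric.mem_closedBall, dist_eq_norm, norm_sub_rev] at hz
  have h3 := T.coord_add i z (c - z)
  rw [sub_add_cancel, h1] at h3
  set K := 2 ^ d * unitBallVol d * Creg with hK
  have hK0 : 0 < K := by positivity
  have h4 : (T.basis.coord i).linear (c - z) ≤ (2 * ((d : ℝ) + 1))⁻¹ :=
    calc _ ≤ K / T.diam * ‖c - z‖ := h2
      _ ≤ K / T.diam * (T.diam / (2 * (d + 1) * K)) := by gcongr
      _ = _ := by field_simp
  have h5 : (2 * ((d : ℝ) + 1))⁻¹ < ((d : ℝ) + 1)⁻¹ := by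
    rw [mul_inv]
    have : 0 < ((d : ℝ) + 1)⁻¹ := by positivity
    linarith
  linarith

theorem verts_subset_of_closedSet_eq {T T' : MeshSimplex d} (h : T.closedSet = T'.closedSet) :
    T.verts ⊆ T'.verts := by
  intro v hv
  have hext : v ∈ T.closedSet.extremePoints ℝ := by
    rw [mem_extremePoints_iff_left]
    refine ⟨subset_convexHull ℝ _ hv, fun x hx y hy hxy => ?_⟩
    obtain ⟨a, b, ha, hb, hab, hxy⟩ := hxy
    have hvb : T.basis ⟨v, hv⟩ = v := rfl
    rw [closedSet_eq] at hx hy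
    have hcoord : ∀ j, T.basis.coord j (a • x + b • y) =
        a * T.basis.coord j x + b * T.basis.coord j y := fun j => by
      exact Convex.combo_affine_apply (f := (T.basis.coord j : Eu d →ᵃ[ℝ] ℝ)) hab
    -- At a vertex, all barycentric coordinates but one vanish.
    have hz : ∀ j : T.verts, j ≠ ⟨v, hv⟩ → T.basis.coord j x = 0 := by
      intro j hj
      have h0 : T.basis.coord j (T.basis ⟨v, hv⟩) = 0 := T.basis.coord_apply_ne hj
      rw [hvb, ← hxy, hcoord] at h0
      have h1 := hx j
      have h2 := mul_nonneg hb.le (hy j)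
      have h3 : a * T.basis.coord j x = 0 := le_antisymm (by linarith) (mul_nonneg ha.le h1)
      exact (mul_eq_zero.1 h3).resolve_left ha.ne'
    have hone : T.basis.coord ⟨v, hv⟩ x = 1 := by
      have := T.basis.sum_coord_apply_eq_one x
      rwa [Finset.sum_eq_single ⟨v, hv⟩ (fun j _ hj => hz j hj) (by simp)] at this
    refine T.basis.ext_elem fun j => ?_
    by_cases hj : j = ⟨v, hv⟩
    · rw [hj, hone]
      exact (T.basis.coord_apply_eq ⟨v, hv⟩).symm
    · rw [hz j hj]
      exact (T.basis.coord_apply_ne hj).symm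
  rw [h] at hext
  exact extremePoints_convexHull_subset hext

theorem eq_of_closedSet_eq {T T' : MeshSimplex d} (h : T.closedSet = T'.closedSet) : T = T' := by
  have : T.verts = T'.verts :=
    (verts_subset_of_closedSet_eq h).antisymm (verts_subset_of_closedSet_eq h.symm)
  cases T; cases T'; simp_all

theorem volume_convexHull_verts_inter {T T' : MeshSimplex d} (h : T ≠ T') :
    (volume : Measure (Eu d)) (convexHull ℝ ((T.verts : Set (Eu d)) ∩ T'.verts)) = 0 := by
  have hne : ¬ T.verts ⊆ T'.verts := by
    intro hs
    have : T.verts = T'.verts := Finset.eq_of_subset_of_card_le hs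
      (by rw [T.card_verts, T'.card_verts])
    cases T; cases T'; simp_all
  obtain ⟨v, hv, hv'⟩ := Finset.not_subset.1 hne
  refine measure_mono_null (convexHull_subset_affineSpan _) (Measure.addHaar_affineSubspace _ _ ?_)
  intro htop
  have hle : affineSpan ℝ ((T.verts : Set (Eu d)) ∩ T'.verts) ≤
      affineSpan ℝ ((T.verts : Set (Eu d)) \ {v}) :=
    affineSpan_mono ℝ fun x hx =>
      ⟨hx.1, fun hxv => hv' (by rw [← mem_singleton_iff.1 hxv]; exact hx.2)⟩
  rw [htop] at hle
  have hmem : v ∈ affineSpan ℝ ((T.verts : Set (Eu d)) \ {v}) := hle trivial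
  have := T.affineIndependent.notMem_affineSpan_sdiff ⟨v, hv⟩ Set.univ
  apply this
  convert hmem using 2
  ext x
  simp [and_comm]

end MeshSimplex

/-! ### Geometry of meshes -/

/-- A Lipschitz domain lies locally on one side of its boundary, so it is the interior of its
closure. -/
theorem LipschitzDomain.interior_closure {d : ℕ} (Ω : LipschitzDomain d) :
    interior (closure Ω.carrier) = Ω.carrier := by
  refine Subset.antisymm (fun x hx => ?_) (interior_maximal subset_closure Ω.isOpen)
  by_contra hxΩ
  have hxf : x ∈ frontier Ω.carrier := by
    rw [frontier, Ω.isOpen.interior_eq]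
    exact ⟨interior_subset hx, hxΩ⟩
  obtain ⟨e, K, g, r, he, hg, hr, hgraph⟩ := Ω.hasLipschitzBoundary x hxf
  set pr := (Submodule.span ℝ {e})ᗮ.orthogonalProjectionOnto with hpr
  have hpe : pr e = 0 := by
    rw [hpr]
    refine Submodule.orthogonalProjectionOnto_eq_zero_iff.2 ?_
    exact Submodule.le_orthogonal_orthogonal _ (Submodule.mem_span_singleton_self e)
  -- The points below the graph are exterior points, and `x` lies on or below it.
  let D : Set (Eu d) := {y | ⟪e, y⟫ < g (pr y)}
  have hD : IsOpen D := isOpen_lt (by fun_prop) (hg.continuous.comp pr.continuous)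
  obtain ⟨r', hr', hball⟩ := Metric.isOpen_iff.1 isOpen_interior x hx
  set ε := min r r' / 2 with hε
  have hε0 : 0 < ε := by positivity
  set y := x - ε • e with hy
  have hdist : dist y x = ε := by
    rw [hy, dist_eq_norm, sub_sub_cancel_left, norm_neg, norm_smul, he, mul_one,
      Real.norm_of_nonneg hε0.le]
  have hyr : y ∈ Metric.ball x r := by
    rw [Metric.mem_ball, hdist, hε]; linarith [min_le_left r r', lt_min hr hr']
  have hyr' : y ∈ Metric.ball x r' := by
    rw [Metric.mem_ball, hdist, hε]; linarith [min_le_right r r', lt_min hr hr']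
  have hyD : y ∈ D := by
    have h1 : ¬ (g (pr x) < ⟪e, x⟫) := fun h => hxΩ ((hgraph x (Metric.mem_ball_self hr)).2 h)
    change ⟪e, y⟫ < g (pr y)
    rw [hy, map_sub, map_smul, hpe, smul_zero, sub_zero, inner_sub_right, real_inner_smul_right,
      real_inner_self_eq_norm_sq, he]
    linarith [not_lt.1 h1]
  have hyc : y ∈ closure Ω.carrier := interior_subset (hball hyr')
  obtain ⟨z, hz, hzΩ⟩ := mem_closure_iff.1 hyc (D ∩ Metric.ball x r) (hD.inter Metric.isOpen_ball)
    ⟨hyD, hyr⟩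
  exact lt_asymm hz.1 ((hgraph z hz.2).1 hzΩ)

theorem LipschitzDomain.dim_ne_zero {d : ℕ} (Ω : LipschitzDomain d) : d ≠ 0 := by
  have := Ω.two_le_dim
  omega

namespace Mesh

variable {d : ℕ} {Ω : LipschitzDomain d} (𝒯 : Mesh Ω)

theorem elems_nonempty : 𝒯.elems.Nonempty := by
  obtain ⟨x, hx⟩ : Ω.carrier.Nonempty := Ω.isSimplyConnected.nonempty
  have h := subset_closure hx
  rw [𝒯.cover] at h
  simp only [mem_iUnion, exists_prop] at h
  obtain ⟨T, hT, -⟩ := h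
  exact ⟨T, hT⟩

variable {𝒯}

theorem openSet_subset {T : MeshSimplex d} (hT : T ∈ 𝒯.elems) : T.openSet ⊆ Ω.carrier := by
  rw [← Ω.interior_closure, 𝒯.cover]
  exact interior_mono (subset_biUnion_of_mem (u := fun T : MeshSimplex d => T.closedSet) hT)

theorem volume_inter {T T' : MeshSimplex d} (hT : T ∈ 𝒯.elems) (hT' : T' ∈ 𝒯.elems) (h : T ≠ T') :
    (volume : Measure (Eu d)) (T.closedSet ∩ T'.closedSet) = 0 :=
  measure_mono_null (𝒯.conforming T hT T' hT') (MeshSimplex.volume_convexHull_verts_inter h)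

theorem disjoint_openSet {T T' : MeshSimplex d} (hT : T ∈ 𝒯.elems) (hT' : T' ∈ 𝒯.elems)
    (h : T ≠ T') : Disjoint T.openSet T'.openSet := by
  rw [disjoint_iff_inter_eq_empty]
  refine (T.isOpen_openSet.inter T'.isOpen_openSet).eq_empty_of_measure_zero (μ := volume) ?_
  exact measure_mono_null (inter_subset_inter T.openSet_subset T'.openSet_subset)
    (volume_inter hT hT' h)

theorem pairwiseDisjoint_openSet :
    (𝒯.elems : Set (MeshSimplex d)).PairwiseDisjoint MeshSimplex.openSet :=
  fun _ hT _ hT' h => disjoint_openSet hT hT' h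

theorem diam_le_size {T : MeshSimplex d} (hT : T ∈ 𝒯.elems) : T.diam ≤ 𝒯.size :=
  le_ciSup (f := fun T : 𝒯.elems => T.1.diam) (Set.finite_range _).bddAbove ⟨T, hT⟩

theorem size_le {a : ℝ} (h : ∀ T ∈ 𝒯.elems, T.diam ≤ a) : 𝒯.size ≤ a := by
  have : Nonempty 𝒯.elems := 𝒯.elems_nonempty.to_subtype
  exact ciSup_le fun T => h T.1 T.2

theorem size_pos : 0 < 𝒯.size := by
  obtain ⟨T, hT⟩ := 𝒯.elems_nonempty
  exact (T.diam_pos Ω.dim_ne_zero).trans_le (diam_le_size hT)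

theorem P0_le {𝒯' : Mesh Ω} (h : ∀ T ∈ 𝒯'.elems, ∃ T' ∈ 𝒯.elems, T.closedSet ⊆ T'.closedSet) :
    𝒯.P0 ≤ 𝒯'.P0 := by
  intro v hv T hT
  obtain ⟨T', hT', hsub⟩ := h T hT
  obtain ⟨c, hc⟩ := hv T' hT'
  exact ⟨c, hc.mono fun x hx hxT => hx (interior_mono hsub hxT)⟩

/-- If every element of a mesh is strictly refined, every element has a son of at most half its
volume: it has at least two sons, since the closed sons cover it. -/
theorem exists_son_two_mul_vol_le {𝒯' : Mesh Ω}
    (h : ∀ T ∈ 𝒯'.elems, ∃ T' ∈ 𝒯.elems, T.closedSet ⊆ T'.closedSet)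
    (hne : ∀ T ∈ 𝒯'.elems, T ∉ 𝒯.elems) {T' : MeshSimplex d} (hT' : T' ∈ 𝒯.elems) :
    ∃ T ∈ 𝒯'.elems, 2 * T.vol ≤ T'.vol := by
  have hcover : ∀ x ∈ T'.openSet, ∃ T ∈ 𝒯'.elems, x ∈ T.closedSet := by
    intro x hx
    have h1 : x ∈ closure Ω.carrier := subset_closure (openSet_subset hT' hx)
    rw [𝒯'.cover] at h1
    simpa using h1
  -- Any part of `T'` of positive measure meets a son of `T'`.
  have hson : ∀ U ⊆ T'.openSet, (volume : Measure (Eu d)) U ≠ 0 →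
      ∃ T ∈ 𝒯'.elems, T.closedSet ⊆ T'.closedSet ∧ (U ∩ T.closedSet).Nonempty := by
    intro U hU hU0
    by_contra! hcon
    refine hU0 (measure_mono_null (t := ⋃ T ∈ 𝒯'.elems, (U ∩ T.closedSet)) (fun x hx => ?_) ?_)
    · obtain ⟨T, hT, hxT⟩ := hcover x (hU hx)
      simp only [mem_iUnion, exists_prop]
      exact ⟨T, hT, hx, hxT⟩
    · refine (measure_biUnion_null_iff 𝒯'.elems.countable_toSet).2 fun T hT => ?_
      obtain ⟨F, hF, hTF⟩ := h T hT
      by_cases hFT : F = T'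
      · have := hcon T hT (hFT ▸ hTF)
        rw [this, measure_empty]
      · have hsub : U ∩ T.closedSet ⊆ F.closedSet ∩ T'.closedSet := fun x hx =>
          ⟨hTF hx.2, T'.openSet_subset (hU hx.1)⟩
        exact measure_mono_null hsub (volume_inter hF hT' hFT)
  obtain ⟨T₁, hT₁, hsub₁, -⟩ := hson T'.openSet Subset.rfl
    (T'.isOpen_openSet.measure_pos _ T'.openSet_nonempty).ne'
  have hcl : IsClosed T₁.closedSet := T₁.isCompact_closedSet.isClosed
  have hU : (T'.openSet \ T₁.closedSet).Nonempty := by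
    rw [sdiff_nonempty]
    intro hc
    have h1 : T'.closedSet ⊆ T₁.closedSet := by
      rw [← T'.closure_openSet]; exact closure_minimal hc hcl
    exact hne T₁ hT₁ (MeshSimplex.eq_of_closedSet_eq (hsub₁.antisymm h1) ▸ hT')
  obtain ⟨T₂, hT₂, hsub₂, z, hz⟩ := hson _ sdiff_subset
    ((T'.isOpen_openSet.sdiff hcl).measure_pos volume hU).ne'
  have h12 : T₁ ≠ T₂ := by
    rintro rfl
    exact hz.1.2 hz.2
  have hsum : T₁.vol + T₂.vol ≤ T'.vol := by
    rw [MeshSimplex.vol, MeshSimplex.vol, ← measureReal_union (disjoint_openSet hT₁ hT₂ h12)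
      T₂.measurableSet_openSet T₁.volume_openSet_ne_top T₂.volume_openSet_ne_top]
    exact measureReal_mono (union_subset (interior_mono hsub₁) (interior_mono hsub₂))
      T'.volume_openSet_ne_top
  rcases le_total T₁.vol T₂.vol with h3 | h3
  · exact ⟨T₁, hT₁, by linarith⟩
  · exact ⟨T₂, hT₂, by linarith⟩

end Mesh

theorem RefinementRule.IsDescendant.closedSet_subset {d : ℕ} {R : RefinementRule d} {n : ℕ}
    {T' T : MeshSimplex d} (h : R.IsDescendant n T' T) : T.closedSet ⊆ T'.closedSet := by
  obtain ⟨f, rfl, rfl, hf⟩ := h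
  induction n with
  | zero => exact Subset.rfl
  | succ n ih =>
    exact (R.subset _ _ (hf n (Nat.lt_succ_self n))).trans (ih fun i hi => hf i (by omega))

theorem RefinementRule.gen_eq_zero {d : ℕ} {R : RefinementRule d} {Ω : LipschitzDomain d}
    {𝒯₀ : Mesh Ω} {T : MeshSimplex d} (hT : T ∈ 𝒯₀.elems) : R.gen 𝒯₀ T = 0 :=
  Nat.sInf_eq_zero.2 (Or.inl ⟨T, hT, fun _ => T, rfl, rfl,
    fun i hi => absurd hi (Nat.not_lt_zero i)⟩)

section Sequences

variable {d : ℕ} {Ω : LipschitzDomain d} {R : RefinementRule d} {Creg qref Cref : ℝ} {kref L : ℕ}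
  {𝒯 : ℕ → Mesh Ω}

theorem IsMeshSequence.diam_pow_le (h : IsMeshSequence R Creg qref Cref kref L 𝒯) {ℓ : ℕ}
    (hℓ : ℓ ≤ L) {T : MeshSimplex d} (hT : T ∈ (𝒯 ℓ).elems) : T.diam ^ d ≤ Creg * T.vol :=
  (div_le_iff₀ T.vol_pos).1 (h.shape_regular ℓ hℓ T hT)

theorem IsMeshSequence.exists_father (h : IsMeshSequence R Creg qref Cref kref L 𝒯) {ℓ : ℕ}
    (hℓ : ℓ < L) : ∀ T ∈ (𝒯 (ℓ + 1)).elems, ∃ T' ∈ (𝒯 ℓ).elems, T.closedSet ⊆ T'.closedSet := by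
  intro T hT
  obtain ⟨T', hT', n, hn⟩ := h.refinement ℓ hℓ T hT
  exact ⟨T', hT', hn.closedSet_subset⟩

theorem IsMeshSequence.P0_le (h : IsMeshSequence R Creg qref Cref kref L 𝒯) {ℓ : ℕ}
    (hℓ : ℓ < L) : (𝒯 ℓ).P0 ≤ (𝒯 (ℓ + 1)).P0 :=
  Mesh.P0_le (h.exists_father hℓ)

theorem IsMeshSequence.one_le_size (h : IsMeshSequence R Creg qref Cref kref L 𝒯)
    (hCref : 0 < Cref) : 1 ≤ Cref * (𝒯 0).size := by
  obtain ⟨T, hT⟩ := (𝒯 0).elems_nonempty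
  have h1 := (h.diam_gen 0 (Nat.zero_le L) T hT).2
  rw [RefinementRule.gen_eq_zero hT, pow_zero] at h1
  exact h1.trans (mul_le_mul_of_nonneg_left (Mesh.diam_le_size hT) hCref.le)

namespace IsUniformMeshSequence

/-- Uniform meshes are quasi-uniform. -/
theorem size_le (h : IsUniformMeshSequence R Creg qref Cref kref L 𝒯) (hCref : 0 < Cref) {ℓ : ℕ}
    (hℓ : ℓ ≤ L) {T : MeshSimplex d} (hT : T ∈ (𝒯 ℓ).elems) :
    (𝒯 ℓ).size ≤ Cref ^ 2 * T.diam := by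
  refine Mesh.size_le fun T' hT' => ?_
  have h1 := (h.diam_gen ℓ hℓ T' hT').1
  have h2 := (h.diam_gen ℓ hℓ T hT).2
  rw [h.gen_eq ℓ hℓ T' hT' T hT, inv_mul_le_iff₀ hCref] at h1
  calc T'.diam ≤ Cref * qref ^ R.gen (𝒯 0) T := h1
    _ ≤ Cref * (Cref * T.diam) := by gcongr
    _ = _ := by ring

theorem size_le_size_succ (h : IsUniformMeshSequence R Creg qref Cref kref L 𝒯) (hq0 : 0 < qref)
    (hq1 : qref < 1) (hCref : 0 < Cref) {ℓ : ℕ} (hℓ : ℓ < L) :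
    (𝒯 ℓ).size ≤ Cref ^ 2 / qref ^ kref * (𝒯 (ℓ + 1)).size := by
  obtain ⟨T, hT⟩ := (𝒯 (ℓ + 1)).elems_nonempty
  obtain ⟨T', hT', n, hn⟩ := h.refinement ℓ hℓ T hT
  have hgen := (h.gen_father ℓ hℓ T hT (h.all_refined ℓ hℓ T hT) T' hT' ⟨n, hn⟩).2
  have hgen' : R.gen (𝒯 0) T ≤ R.gen (𝒯 0) T' + kref := by
    have := (abs_le.1 hgen).2
    omega
  refine Mesh.size_le fun T₁ hT₁ => ?_
  have h1 := (h.diam_gen ℓ hℓ.le T₁ hT₁).1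
  have h2 := (h.diam_gen (ℓ + 1) hℓ T hT).2
  rw [h.gen_eq ℓ hℓ.le T₁ hT₁ T' hT', inv_mul_le_iff₀ hCref] at h1
  have h3 : qref ^ R.gen (𝒯 0) T' * qref ^ kref ≤ qref ^ R.gen (𝒯 0) T := by
    rw [← pow_add]
    exact pow_le_pow_of_le_one hq0.le hq1.le hgen'
  have h4 : qref ^ R.gen (𝒯 0) T' ≤ Cref * (𝒯 (ℓ + 1)).size / qref ^ kref := by
    rw [le_div_iff₀ (by positivity)]
    exact h3.trans (h2.trans (mul_le_mul_of_nonneg_left (Mesh.diam_le_size hT) hCref.le))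
  calc T₁.diam ≤ Cref * qref ^ R.gen (𝒯 0) T' := h1
    _ ≤ Cref * (Cref * (𝒯 (ℓ + 1)).size / qref ^ kref) := by gcongr
    _ = _ := by ring

/-- Each element has a descendant `n` levels further with at most `2⁻ⁿ` of its volume. -/
theorem exists_vol_le (h : IsUniformMeshSequence R Creg qref Cref kref L 𝒯) {ℓ : ℕ} (n : ℕ)
    (hn : ℓ + n ≤ L) {T' : MeshSimplex d} (hT' : T' ∈ (𝒯 ℓ).elems) :
    ∃ T ∈ (𝒯 (ℓ + n)).elems, 2 ^ n * T.vol ≤ T'.vol := by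
  induction n with
  | zero => exact ⟨T', hT', by simp⟩
  | succ n ih =>
    obtain ⟨T₁, hT₁, h1⟩ := ih (by omega)
    obtain ⟨T, hT, h2⟩ := Mesh.exists_son_two_mul_vol_le (h.exists_father (ℓ := ℓ + n) (by omega))
      (h.all_refined (ℓ + n) (by omega)) hT₁
    refine ⟨T, hT, le_trans ?_ h1⟩
    rw [pow_succ, mul_assoc]
    gcongr

/-- The mesh sizes decay geometrically in the level, since the volumes are halved in every step.
The generations alone would not give this, as they need not be monotone in the level. -/
theorem size_decay (h : IsUniformMeshSequence R Creg qref Cref kref L 𝒯) (hCreg : 0 < Creg)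
    (hCref : 0 < Cref) {ℓ m : ℕ} (hℓm : ℓ ≤ m) (hm : m ≤ L) :
    (𝒯 m).size ≤ Cref ^ 2 * max 1 (Creg * unitBallVol d) *
      ((1 / 2 : ℝ) ^ (1 / (d : ℝ))) ^ (m - ℓ) * (𝒯 ℓ).size := by
  obtain ⟨n, rfl⟩ := Nat.exists_eq_add_of_le hℓm
  rw [Nat.add_sub_cancel_left]
  have hd := Ω.dim_ne_zero
  have hω := unitBallVol_pos d
  set θ : ℝ := (1 / 2 : ℝ) ^ (1 / (d : ℝ)) with hθ
  have hθ0 : 0 < θ := by positivity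
  have hθd : θ ^ d = 1 / 2 := by
    rw [hθ, one_div (d : ℝ), Real.rpow_inv_natCast_pow (by norm_num) hd]
  set A := max 1 (Creg * unitBallVol d) with hA
  have hA1 : 1 ≤ A := le_max_left _ _
  obtain ⟨T', hT'⟩ := (𝒯 ℓ).elems_nonempty
  obtain ⟨T, hT, hvol⟩ := h.exists_vol_le n hm hT'
  have hh' := T'.diam_nonneg
  have h1 : T.diam ^ d ≤ (A * θ ^ n * T'.diam) ^ d := by
    calc T.diam ^ d ≤ Creg * T.vol := h.diam_pow_le hm hT
      _ ≤ Creg * ((1 / 2) ^ n * T'.vol) := by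
        gcongr
        rw [one_div, inv_pow, ← div_eq_inv_mul, le_div_iff₀ (by positivity)]
        linarith
      _ ≤ Creg * ((1 / 2) ^ n * (T'.diam ^ d * unitBallVol d)) := by gcongr; exact T'.vol_le
      _ = Creg * unitBallVol d * ((θ ^ d) ^ n * T'.diam ^ d) := by rw [hθd]; ring
      _ ≤ A ^ d * ((θ ^ d) ^ n * T'.diam ^ d) := by
        gcongr
        exact (le_max_right _ _).trans (le_self_pow₀ hA1 hd)
      _ = _ := by ring
  have h2 : T.diam ≤ A * θ ^ n * T'.diam := le_of_pow_le_pow_left₀ hd (by positivity) h1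
  calc (𝒯 (ℓ + n)).size ≤ Cref ^ 2 * T.diam := h.size_le hCref hm hT
    _ ≤ Cref ^ 2 * (A * θ ^ n * (𝒯 ℓ).size) := by
      gcongr
      exact h2.trans (by gcongr; exact Mesh.diam_le_size hT')
    _ = _ := by ring

end IsUniformMeshSequence

end Sequences

/-! ### Test functions, weak gradients and translations -/

/-- The Cauchy–Schwarz inequality for square integrable functions. -/
theorem abs_integral_mul_le {α : Type*} [MeasurableSpace α] {μ : Measure α} {f g : α → ℝ}
    (hf : MemLp f 2 μ) (hg : MemLp g 2 μ) :
    |∫ x, f x * g x ∂μ| ≤ √(∫ x, f x ^ 2 ∂μ) * √(∫ x, g x ^ 2 ∂μ) := by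
  have key : ∀ {f : α → ℝ} (hf : MemLp f 2 μ), ‖hf.toLp‖ = √(∫ x, f x ^ 2 ∂μ) := by
    intro f hf
    rw [← Real.sqrt_sq (norm_nonneg (hf.toLp)), ← real_inner_self_eq_norm_sq, L2.inner_def]
    congr 1
    refine integral_congr_ae ?_
    filter_upwards [hf.coeFn_toLp] with x hx
    rw [hx, real_inner_self_eq_norm_sq, Real.norm_eq_abs, sq_abs]
  rw [← key hf, ← key hg]
  refine le_trans (le_of_eq ?_) (abs_real_inner_le_norm hf.toLp hg.toLp)
  rw [L2.inner_def]
  congr 1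
  refine integral_congr_ae ?_
  filter_upwards [hf.coeFn_toLp, hg.coeFn_toLp] with x h1 h2
  rw [h1, h2]
  exact mul_comm _ _

theorem integral_sq_eq_norm_sq {α : Type*} [MeasurableSpace α] {μ : Measure α} {E : Type*}
    [NormedAddCommGroup E] [InnerProductSpace ℝ E] (f : Lp E 2 μ) :
    ∫ x, ‖f x‖ ^ 2 ∂μ = ‖f‖ ^ 2 := by
  rw [← real_inner_self_eq_norm_sq, L2.inner_def]
  simp only [real_inner_self_eq_norm_sq]

/-- A bound for the `L²` norm on an open set follows from testing with smooth functions, which are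
dense there. -/
theorem integral_sq_le_of_forall_test {d : ℕ} {U : Set (Eu d)} (hU : IsOpen U) {w : Eu d → ℝ}
    (hw : MemLp w 2 (volume.restrict U)) {M : ℝ} (hM : 0 ≤ M)
    (h : ∀ ψ : Eu d → ℝ, ContDiff ℝ ∞ ψ → HasCompactSupport ψ → tsupport ψ ⊆ U →
      |∫ x in U, ψ x * w x| ≤ M * √(∫ x in U, ψ x ^ 2)) :
    ∫ x in U, w x ^ 2 ≤ M ^ 2 := by
  set μ : Measure (Eu d) := volume.restrict U with hμ
  let S : Submodule ℝ (Lp ℝ 2 μ) :=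
    { carrier := {f | ∃ ψ : Eu d → ℝ, (ContDiff ℝ ∞ ψ ∧ HasCompactSupport ψ ∧ tsupport ψ ⊆ U) ∧
        f =ᵐ[μ] ψ}
      zero_mem' := by
        refine ⟨fun _ => 0, ⟨contDiff_const, HasCompactSupport.zero, ?_⟩, Lp.coeFn_zero ℝ 2 μ⟩
        simp [tsupport]
      add_mem' := by
        rintro f g ⟨ψ, ⟨h1, h2, h3⟩, h4⟩ ⟨χ, ⟨k1, k2, k3⟩, k4⟩
        refine ⟨ψ + χ, ⟨h1.add k1, h2.add k2, (tsupport_add ψ χ).trans (union_subset h3 k3)⟩, ?_⟩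
        exact (Lp.coeFn_add f g).trans (h4.add k4)
      smul_mem' := by
        rintro c f ⟨ψ, ⟨h1, h2, h3⟩, h4⟩
        refine ⟨c • ψ, ⟨h1.const_smul c, h2.smul_left (f := fun _ => c),
          (closure_mono (Function.support_const_smul_subset c ψ)).trans h3⟩, ?_⟩
        exact (Lp.coeFn_smul c f).trans (h4.const_smul c) }
  have hdense : S.topologicalClosure = ⊤ := by
    rw [Submodule.topologicalClosure_eq_top_iff, Submodule.eq_bot_iff]
    intro f hf
    have hfl : LocallyIntegrableOn f U μ :=
      ((Lp.memLp f).locallyIntegrable (by norm_num)).locallyIntegrableOn U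
    have h0 := hU.ae_eq_zero_of_integral_contDiff_smul_eq_zero hfl (fun ψ h1 h2 h3 => by
      have hψ : MemLp ψ 2 μ := (h1.continuous.memLp_of_hasCompactSupport h2)
      have hmem : hψ.toLp ∈ S := ⟨ψ, ⟨h1, h2, h3⟩, hψ.coeFn_toLp⟩
      have hz := (Submodule.mem_orthogonal _ _).1 hf _ hmem
      rw [L2.inner_def] at hz
      rw [← hz]
      refine integral_congr_ae ?_
      filter_upwards [hψ.coeFn_toLp] with x hx
      rw [hx]
      exact mul_comm _ _)
    refine Lp.ext ?_
    filter_upwards [h0, ae_restrict_mem hU.measurableSet, Lp.coeFn_zero ℝ 2 μ] with x h1 h2 h3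
    rw [h1 h2, h3]
    rfl
  set W := hw.toLp with hW
  have hcl : IsClosed {f : Lp ℝ 2 μ | |⟪f, W⟫| ≤ M * ‖f‖} :=
    isClosed_le (by fun_prop) (by fun_prop)
  have hsub : (S : Set (Lp ℝ 2 μ)) ⊆ {f : Lp ℝ 2 μ | |⟪f, W⟫| ≤ M * ‖f‖} := by
    rintro f ⟨ψ, ⟨h1, h2, h3⟩, h4⟩
    have e1 : ⟪f, W⟫ = ∫ x in U, ψ x * w x := by
      rw [L2.inner_def]
      refine integral_congr_ae ?_
      filter_upwards [h4, hw.coeFn_toLp] with x a b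
      rw [a, b]
      exact mul_comm _ _
    have e2 : ‖f‖ = √(∫ x in U, ψ x ^ 2) := by
      rw [← Real.sqrt_sq (norm_nonneg f), ← integral_sq_eq_norm_sq]
      congr 1
      refine integral_congr_ae ?_
      filter_upwards [h4] with x a
      rw [a, Real.norm_eq_abs, sq_abs]
    simp only [mem_ofPred_eq]
    rw [e1, e2]
    exact h ψ h1 h2 h3
  have hall : W ∈ {f : Lp ℝ 2 μ | |⟪f, W⟫| ≤ M * ‖f‖} := by
    refine closure_minimal hsub hcl ?_
    have : W ∈ S.topologicalClosure := hdense ▸ Submodule.mem_top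
    exact this
  simp only [mem_ofPred_eq] at hall
  rw [real_inner_self_eq_norm_sq, abs_of_nonneg (sq_nonneg _)] at hall
  have hWM : ‖W‖ ≤ M := by
    rcases (norm_nonneg W).eq_or_lt with h0 | h0
    · rw [← h0]; exact hM
    · nlinarith
  have e : ∫ x in U, w x ^ 2 = ‖W‖ ^ 2 := by
    rw [← integral_sq_eq_norm_sq]
    refine integral_congr_ae ?_
    filter_upwards [hw.coeFn_toLp] with x a
    rw [a, Real.norm_eq_abs, sq_abs]
  rw [e]
  gcongr

namespace LipschitzDomain

variable {d : ℕ} {Ω : LipschitzDomain d}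

instance isFiniteMeasure_vol : IsFiniteMeasure Ω.vol :=
  ⟨by rw [Measure.restrict_apply_univ]; exact Ω.isBounded.measure_lt_top⟩

theorem fderiv_apply_eq_sum (ψ : Eu d → ℝ) (x z : Eu d) :
    fderiv ℝ ψ x z = ∑ i, z i * partialDeriv i ψ x := by
  have hz : z = ∑ i, z i • (EuclideanSpace.single i (1 : ℝ) : Eu d) := by
    ext j
    simp [Finset.sum_apply, Pi.single_apply]
  conv_lhs => rw [hz]
  simp [partialDeriv]

/-- The weak gradient tested in the direction `z`. -/
theorem IsWeakGradient.integral_fderiv {u : Ω.L2} {g : Ω.L2Vec} (h : Ω.IsWeakGradient u g)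
    {ψ : Eu d → ℝ} (hψ : Ω.IsTestFunction ψ) (z : Eu d) :
    ∫ x in Ω.carrier, u x * fderiv ℝ ψ x z = -∫ x in Ω.carrier, ψ x * ⟪g x, z⟫ := by
  have hψ2 : MemLp ψ 2 Ω.vol :=
    (hψ.contDiff.continuous.memLp_of_hasCompactSupport hψ.hasCompactSupport).restrict _
  have hgi : ∀ i : Fin d, MemLp (fun x => (g x) i) 2 Ω.vol := fun i =>
    (EuclideanSpace.proj i : Eu d →L[ℝ] ℝ).comp_memLp' (Lp.memLp g)
  have e1 : ∀ x, u x * fderiv ℝ ψ x z = ∑ i, z i * (u x * partialDeriv i ψ x) := by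
    intro x
    rw [fderiv_apply_eq_sum, Finset.mul_sum]
    exact Finset.sum_congr rfl fun i _ => by ring
  have e2 : ∀ x, ψ x * ⟪g x, z⟫ = ∑ i, z i * (ψ x * (g x) i) := by
    intro x
    rw [PiLp.inner_apply, Finset.mul_sum]
    refine Finset.sum_congr rfl fun i _ => ?_
    simp
    ring
  simp only [e1, e2]
  have i1 : ∀ i ∈ Finset.univ, Integrable (fun x => z i * (u x * partialDeriv i ψ x)) Ω.vol :=
    fun i _ => ((Lp.memLp u).integrable_mul (hψ.memLp_partialDeriv i)).const_mul (z i)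
  have i2 : ∀ i ∈ Finset.univ, Integrable (fun x => z i * (ψ x * (g x) i)) Ω.vol :=
    fun i _ => (hψ2.integrable_mul (hgi i)).const_mul (z i)
  rw [integral_finsetSum _ i1, integral_finsetSum _ i2, ← Finset.sum_neg_distrib]
  refine Finset.sum_congr rfl fun i _ => ?_
  rw [integral_const_mul, integral_const_mul, h ψ hψ i, mul_neg]

section Translation

variable {u : Ω.L2} {g : Ω.L2Vec} {T : Set (Eu d)} {z : Eu d} {ψ : Eu d → ℝ}

/-- The part of `T` that remains in `T` after the translation by `z`. -/
def translateCore (T : Set (Eu d)) (z : Eu d) : Set (Eu d) := T ∩ (fun x => x + z) ⁻¹' T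

theorem isOpen_translateCore (hT : IsOpen T) : IsOpen (translateCore T z) :=
  hT.inter (hT.preimage (by fun_prop))

/-- If `ψ` is supported in the part of the convex set `T` that remains in `T` after the translation
by `z`, all the intermediate translates of `ψ` are supported in `T`. -/
theorem tsupport_translate_subset (hconv : Convex ℝ T) (hsupp : tsupport ψ ⊆ translateCore T z)
    {t : ℝ} (ht : t ∈ Icc (0 : ℝ) 1) : tsupport (fun x => ψ (x - t • z)) ⊆ T := by
  intro x hx
  have h1 : x - t • z ∈ tsupport ψ :=
    tsupport_comp_subset_preimage ψ (f := fun x => x - t • z) (by fun_prop) hx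
  have h2 := hsupp h1
  have h3 := hconv h2.1 h2.2 (sub_nonneg.2 ht.2) ht.1 (by ring)
  have e : (1 - t) • (x - t • z) + t • (x - t • z + z) = x := by
    rw [smul_add, ← add_assoc, ← add_smul]
    simp
  rwa [e] at h3

theorem isTestFunction_translate (hTΩ : T ⊆ Ω.carrier) (hconv : Convex ℝ T)
    (h1 : ContDiff ℝ ∞ ψ) (h2 : HasCompactSupport ψ) (hsupp : tsupport ψ ⊆ translateCore T z)
    {t : ℝ} (ht : t ∈ Icc (0 : ℝ) 1) : Ω.IsTestFunction (fun x => ψ (x - t • z)) where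
  contDiff := h1.comp (by fun_prop)
  hasCompactSupport := h2.comp_homeomorph (Homeomorph.subRight (t • z))
  tsupport_subset := (tsupport_translate_subset hconv hsupp ht).trans hTΩ

theorem hasDerivAt_integral_translate (u : Ω.L2) (h1 : ContDiff ℝ ∞ ψ) (h2 : HasCompactSupport ψ)
    (z : Eu d) (t : ℝ) :
    HasDerivAt (fun t : ℝ => ∫ x in Ω.carrier, u x * ψ (x - t • z))
      (-∫ x in Ω.carrier, u x * fderiv ℝ ψ (x - t • z) z) t := by
  have hu : Integrable u Ω.vol := (Lp.memLp u).integrable (by norm_num)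
  have hc' : Continuous (fun x => fderiv ℝ ψ x) := h1.continuous_fderiv (by simp)
  obtain ⟨K, hK⟩ := (h2.fderiv (𝕜 := ℝ)).exists_bound_of_continuous hc'
  obtain ⟨K₀, hK₀⟩ := h2.exists_bound_of_continuous h1.continuous
  rw [← integral_neg]
  refine (hasDerivAt_integral_of_dominated_loc_of_deriv_le (s := univ) (μ := Ω.vol)
    (F := fun (t : ℝ) x => u x * ψ (x - t • z))
    (F' := fun (t : ℝ) x => -(u x * fderiv ℝ ψ (x - t • z) z))
    (bound := fun x => ‖u x‖ * (K * ‖z‖)) Filter.univ_mem ?_ ?_ ?_ ?_ ?_ ?_).2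
  · refine Filter.Eventually.of_forall fun t => hu.aestronglyMeasurable.mul ?_
    exact (h1.continuous.comp (by fun_prop)).aestronglyMeasurable
  · refine hu.mul_bdd (c := K₀) (h1.continuous.comp (by fun_prop)).aestronglyMeasurable ?_
    exact Filter.Eventually.of_forall fun x => hK₀ _
  · refine (hu.aestronglyMeasurable.mul ?_).neg
    exact ((hc'.comp (by fun_prop)).clm_apply continuous_const).aestronglyMeasurable
  · refine Filter.Eventually.of_forall fun x t _ => ?_
    rw [norm_neg, norm_mul]
    gcongr
    exact ((fderiv ℝ ψ (x - t • z)).le_opNorm z).trans (by gcongr; exact hK _)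
  · exact hu.norm.mul_const _
  · refine Filter.Eventually.of_forall fun x t _ => ?_
    have hd : HasFDerivAt ψ (fderiv ℝ ψ (x - t • z)) (x - t • z) :=
      (h1.differentiable (by simp) _).hasFDerivAt
    have hline : HasDerivAt (fun t : ℝ => x - t • z) (-z) t := by
      simpa using ((hasDerivAt_id t).smul_const z).const_sub x
    have := (hd.comp_hasDerivAt t hline).const_mul (u x)
    simpa using this

theorem memLp_translate (hTm : MeasurableSet T) (hTΩ : T ⊆ Ω.carrier) (u : Ω.L2) (z : Eu d) :
    MemLp (fun x => u (x + z)) 2 (volume.restrict ((fun x => x + z) ⁻¹' T)) :=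
  ((Lp.memLp u).mono_measure (Measure.restrict_mono hTΩ le_rfl)).comp_measurePreserving
    ((measurePreserving_add_right volume z).restrict_preimage hTm)

/-- Translates of an `H¹` function `u`: on the part of the convex set `T` that remains in `T`, the
difference `u(x + z) - u(x)` is bounded by the gradient in `T`. By duality, the translation is
moved to a test function, for which the estimate is the mean value inequality. -/
theorem integral_translate_sub_sq_le (hug : Ω.IsWeakGradient u g) (hT : IsOpen T)
    (hTΩ : T ⊆ Ω.carrier) (hconv : Convex ℝ T) (z : Eu d) :
    ∫ x in translateCore T z, (u (x + z) - u x) ^ 2 ≤ ‖z‖ ^ 2 * ∫ x in T, ‖g x‖ ^ 2 := by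
  have hG0 : 0 ≤ ∫ x in T, ‖g x‖ ^ 2 := integral_nonneg fun _ => sq_nonneg _
  set G := √(∫ x in T, ‖g x‖ ^ 2) with hG
  have hG2 : ∫ x in T, ‖g x‖ ^ 2 = G ^ 2 := (Real.sq_sqrt hG0).symm
  set U := translateCore T z with hUdef
  have hU : IsOpen U := isOpen_translateCore hT
  have hUΩ : U ⊆ Ω.carrier := inter_subset_left.trans hTΩ
  have hw1 : MemLp (fun x => u (x + z)) 2 (volume.restrict U) :=
    (memLp_translate hT.measurableSet hTΩ u z).mono_measure
      (Measure.restrict_mono inter_subset_right le_rfl)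
  have hw2 : MemLp u 2 (volume.restrict U) :=
    (Lp.memLp u).mono_measure (Measure.restrict_mono hUΩ le_rfl)
  have hgT : MemLp g 2 (volume.restrict T) :=
    (Lp.memLp g).mono_measure (Measure.restrict_mono hTΩ le_rfl)
  rw [hG2, ← mul_pow]
  refine integral_sq_le_of_forall_test hU (hw1.sub hw2) (by positivity) fun ψ h1 h2 hsupp => ?_
  have hψ0 : ∀ x, x ∉ U → ψ x = 0 := fun x hx =>
    image_eq_zero_of_notMem_tsupport fun h => hx (hsupp h)
  have hψU : ∫ x in U, ψ x ^ 2 = ∫ x, ψ x ^ 2 :=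
    setIntegral_eq_integral_of_forall_compl_eq_zero fun x hx => by simp [hψ0 x hx]
  -- `F 1 - F 0` is the integral of `ψ` against `u(· + z) - u`.
  let F : ℝ → ℝ := fun t => ∫ x in Ω.carrier, u x * ψ (x - t • z)
  have hder : ∀ t ∈ Icc (0 : ℝ) 1,
      HasDerivWithinAt F (-∫ x in Ω.carrier, u x * fderiv ℝ ψ (x - t • z) z) (Icc 0 1) t :=
    fun t _ => (hasDerivAt_integral_translate u h1 h2 z t).hasDerivWithinAt
  have hbound : ∀ t ∈ Ico (0 : ℝ) 1, ‖-∫ x in Ω.carrier, u x * fderiv ℝ ψ (x - t • z) z‖ ≤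
      ‖z‖ * G * √(∫ x in U, ψ x ^ 2) := by
    intro t ht
    have ht' : t ∈ Icc (0 : ℝ) 1 := ⟨ht.1, ht.2.le⟩
    have htest := isTestFunction_translate hTΩ hconv h1 h2 hsupp ht'
    have hfd : ∀ x, fderiv ℝ ψ (x - t • z) = fderiv ℝ (fun x => ψ (x - t • z)) x := fun x =>
      (fderiv_comp_sub (t • z)).symm
    have hsT : ∀ x, x ∉ T → ψ (x - t • z) = 0 := fun x hx =>
      image_eq_zero_of_notMem_tsupport (f := fun x => ψ (x - t • z))
        fun h => hx (tsupport_translate_subset hconv hsupp ht' h)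
    simp only [hfd]
    rw [hug.integral_fderiv htest z, neg_neg, Real.norm_eq_abs]
    have e1 : ∫ x in Ω.carrier, ψ (x - t • z) * ⟪g x, z⟫ =
        ∫ x in T, ψ (x - t • z) * ⟪g x, z⟫ :=
      (setIntegral_eq_of_subset_of_forall_sdiff_eq_zero Ω.isOpen.measurableSet hTΩ
        fun x hx => by rw [hsT x hx.2, zero_mul])
    have hψt : MemLp (fun x => ψ (x - t • z)) 2 (volume.restrict T) :=
      (htest.contDiff.continuous.memLp_of_hasCompactSupport htest.hasCompactSupport).restrict _
    have hgz : MemLp (fun x => ⟪g x, z⟫) 2 (volume.restrict T) := hgT.inner_const z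
    have e2 : ∫ x in T, ψ (x - t • z) ^ 2 = ∫ x in U, ψ x ^ 2 := by
      rw [hψU, ← integral_sub_right_eq_self (fun x => ψ x ^ 2) (t • z)]
      exact setIntegral_eq_integral_of_forall_compl_eq_zero fun x hx => by simp [hsT x hx]
    have e3 : ∫ x in T, ⟪g x, z⟫ ^ 2 ≤ (‖z‖ * G) ^ 2 := by
      rw [mul_pow, ← hG2, ← integral_const_mul]
      refine integral_mono hgz.integrable_sq (hgT.norm.integrable_sq.const_mul _) fun x => ?_
      have := abs_real_inner_le_norm (g x) z
      calc ⟪g x, z⟫ ^ 2 = |⟪g x, z⟫| ^ 2 := (sq_abs _).symm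
        _ ≤ (‖g x‖ * ‖z‖) ^ 2 := by gcongr
        _ = _ := by ring
    rw [e1]
    refine (abs_integral_mul_le hψt hgz).trans ?_
    rw [e2, mul_comm]
    gcongr
    exact (Real.sqrt_le_sqrt e3).trans_eq (Real.sqrt_sq (by positivity))
  have hF := norm_image_sub_le_of_norm_deriv_le_segment_01' hder hbound
  refine le_trans (le_of_eq ?_) hF
  have hF0 : F 0 = ∫ x in U, ψ x * u x := by
    have : F 0 = ∫ x in Ω.carrier, ψ x * u x := by
      simp only [F, zero_smul, sub_zero, mul_comm]
    rw [this]
    exact setIntegral_eq_of_subset_of_forall_sdiff_eq_zero Ω.isOpen.measurableSet hUΩ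
      fun x hx => by rw [hψ0 x hx.2, zero_mul]
  have hF1 : F 1 = ∫ x in U, ψ x * u (x + z) := by
    have hsT : ∀ x, x ∉ T → ψ (x - z) = 0 := fun x hx => hψ0 _ fun h => hx (by
      have := h.2
      simpa using this)
    have e1 : F 1 = ∫ x, T.indicator u x * ψ (x - z) := by
      have : F 1 = ∫ x in T, T.indicator u x * ψ (x - z) := by
        simp only [F, one_smul]
        rw [setIntegral_eq_of_subset_of_forall_sdiff_eq_zero Ω.isOpen.measurableSet hTΩ
          fun x hx => by rw [hsT x hx.2, mul_zero]]
        exact setIntegral_congr_fun hT.measurableSet fun x hx => by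
          simp only [indicator_of_mem hx]
      rw [this]
      exact setIntegral_eq_integral_of_forall_compl_eq_zero fun x hx => by rw [hsT x hx, mul_zero]
    rw [e1, ← integral_add_right_eq_self _ z]
    simp only [add_sub_cancel_right]
    rw [← setIntegral_eq_integral_of_forall_compl_eq_zero (s := U) fun x hx => by
      rw [hψ0 x hx, mul_zero]]
    refine setIntegral_congr_fun hU.measurableSet fun x hx => ?_
    have hx2 : x + z ∈ T := hx.2
    simp only [indicator_of_mem hx2, mul_comm]
  have hψm : MemLp ψ 2 (volume.restrict U) :=
    (h1.continuous.memLp_of_hasCompactSupport h2).restrict _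
  have i1 : Integrable (fun x => ψ x * u (x + z)) (volume.restrict U) := hψm.integrable_mul hw1
  have i2 : Integrable (fun x => ψ x * u x) (volume.restrict U) := hψm.integrable_mul hw2
  rw [hF0, hF1, ← integral_sub i1 i2, Real.norm_eq_abs]
  congr 1
  refine integral_congr_ae (Filter.Eventually.of_forall fun x => ?_)
  simp only [Pi.sub_apply]
  ring

end Translation

end LipschitzDomain

/-! ### The Poincaré inequality on simplices -/

namespace LipschitzDomain

variable {d : ℕ} {Ω : LipschitzDomain d} {u : Ω.L2} {g : Ω.L2Vec}

/-- The double integral of `(u(y) - u(x))²` over a simplex, as an integral over the translations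
`z = y - x`, none of which is longer than the diameter. -/
theorem lintegral_lintegral_sub_sq_le (hug : Ω.IsWeakGradient u g) {T : MeshSimplex d}
    (hTΩ : T.openSet ⊆ Ω.carrier) :
    ∫⁻ x in T.openSet, ∫⁻ y in T.openSet, ENNReal.ofReal ((u y - u x) ^ 2) ≤
      ENNReal.ofReal (T.diam ^ 2 * (∫ x in T.openSet, ‖g x‖ ^ 2) *
        (T.diam ^ d * unitBallVol d)) := by
  set G2 := ∫ x in T.openSet, ‖g x‖ ^ 2 with hG2
  have hG0 : 0 ≤ G2 := integral_nonneg fun _ => sq_nonneg _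
  have hum : Measurable u := (Lp.stronglyMeasurable u).measurable
  have hTm := T.measurableSet_openSet
  have hmeas : Measurable (Function.uncurry fun x z : Eu d =>
      T.openSet.indicator (fun y => ENNReal.ofReal ((u y - u x) ^ 2)) (x + z)) := by
    have e : (Function.uncurry fun x z : Eu d =>
        T.openSet.indicator (fun y => ENNReal.ofReal ((u y - u x) ^ 2)) (x + z)) =
        ((fun p : Eu d × Eu d => p.1 + p.2) ⁻¹' T.openSet).indicator
          (fun p => ENNReal.ofReal ((u (p.1 + p.2) - u p.1) ^ 2)) := by
      ext ⟨x, z⟩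
      rfl
    rw [e]
    refine Measurable.indicator ?_ ((measurable_fst.add measurable_snd) hTm)
    exact (((hum.comp (measurable_fst.add measurable_snd)).sub
      (hum.comp measurable_fst)).pow_const 2).ennreal_ofReal
  calc ∫⁻ x in T.openSet, ∫⁻ y in T.openSet, ENNReal.ofReal ((u y - u x) ^ 2)
      = ∫⁻ x in T.openSet, ∫⁻ z,
          T.openSet.indicator (fun y => ENNReal.ofReal ((u y - u x) ^ 2)) (x + z) := by
        refine lintegral_congr fun x => ?_
        rw [← lintegral_indicator hTm]
        exact (lintegral_add_left_eq_self _ x).symm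
    _ = ∫⁻ z, ∫⁻ x in T.openSet,
          T.openSet.indicator (fun y => ENNReal.ofReal ((u y - u x) ^ 2)) (x + z) :=
        lintegral_lintegral_swap hmeas.aemeasurable
    _ ≤ ∫⁻ z, (Metric.closedBall (0 : Eu d) T.diam).indicator
          (fun _ => ENNReal.ofReal (T.diam ^ 2 * G2)) z := by
        refine lintegral_mono fun z => ?_
        have e : ∫⁻ x in T.openSet,
            T.openSet.indicator (fun y => ENNReal.ofReal ((u y - u x) ^ 2)) (x + z) =
            ∫⁻ x in translateCore T.openSet z, ENNReal.ofReal ((u (x + z) - u x) ^ 2) := by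
          rw [translateCore, inter_comm, ← setLIntegral_indicator (measurable_add_const z hTm)]
          rfl
        rw [e]
        by_cases hz : z ∈ Metric.closedBall (0 : Eu d) T.diam
        · rw [indicator_of_mem hz]
          have hUT : translateCore T.openSet z ⊆ T.openSet := inter_subset_left
          have hw1 : MemLp (fun x => u (x + z)) 2 (volume.restrict (translateCore T.openSet z)) :=
            (memLp_translate hTm hTΩ u z).mono_measure
              (Measure.restrict_mono inter_subset_right le_rfl)
          have hw2 : MemLp u 2 (volume.restrict (translateCore T.openSet z)) :=
            (Lp.memLp u).mono_measure (Measure.restrict_mono (hUT.trans hTΩ) le_rfl)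
          have hint : Integrable (fun x => (u (x + z) - u x) ^ 2)
              (volume.restrict (translateCore T.openSet z)) := (hw1.sub hw2).integrable_sq
          rw [← ofReal_integral_eq_lintegral_ofReal hint
            (Filter.Eventually.of_forall fun _ => sq_nonneg _)]
          refine ENNReal.ofReal_le_ofReal ?_
          refine (integral_translate_sub_sq_le hug T.isOpen_openSet hTΩ T.convex_openSet z).trans ?_
          rw [mem_closedBall_zero_iff] at hz
          gcongr
        · have : translateCore T.openSet z = ∅ := by
            rw [eq_empty_iff_forall_notMem]
            rintro x ⟨hx, hxz⟩
            refine hz ?_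
            have := T.openSet_subset_closedBall hx hxz
            rw [Metric.mem_closedBall, dist_eq_norm, add_sub_cancel_left] at this
            rwa [mem_closedBall_zero_iff]
          rw [this, Measure.restrict_empty, lintegral_zero_measure]
          exact zero_le
    _ = _ := by
        rw [lintegral_indicator Metric.isClosed_closedBall.measurableSet, setLIntegral_const,
          ← volume_real_closedBall 0 T.diam_nonneg,
          ENNReal.ofReal_mul (p := T.diam ^ 2 * G2) (by positivity), measureReal_def,
          ENNReal.ofReal_toReal Metric.isBounded_closedBall.measure_lt_top.ne]

/-- The Poincaré inequality on a shape regular simplex, with a suitable value of the function in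
place of its mean. -/
theorem exists_integral_sub_sq_le (hug : Ω.IsWeakGradient u g) {T : MeshSimplex d}
    (hTΩ : T.openSet ⊆ Ω.carrier) {Creg : ℝ} (hreg : T.diam ^ d ≤ Creg * T.vol) :
    ∃ c : ℝ, ∫ x in T.openSet, (u x - c) ^ 2 ≤
      Creg * unitBallVol d * T.diam ^ 2 * ∫ x in T.openSet, ‖g x‖ ^ 2 := by
  set G2 := ∫ x in T.openSet, ‖g x‖ ^ 2 with hG2
  have hG0 : 0 ≤ G2 := integral_nonneg fun _ => sq_nonneg _
  have hum : Measurable u := (Lp.stronglyMeasurable u).measurable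
  have hω := unitBallVol_pos d
  have hV := T.vol_pos
  have hm : Measurable (Function.uncurry fun x y : Eu d => ENNReal.ofReal ((u y - u x) ^ 2)) :=
    (((hum.comp measurable_snd).sub (hum.comp measurable_fst)).pow_const 2).ennreal_ofReal
  -- A point `x` at which the inner integral is at most its average over `T`.
  obtain ⟨x, hx, hle⟩ := exists_le_setLAverage (μ := volume)
    (T.isOpen_openSet.measure_pos volume T.openSet_nonempty).ne' T.volume_openSet_ne_top
    (f := fun x => ∫⁻ y in T.openSet, ENNReal.ofReal ((u y - u x) ^ 2))
    hm.lintegral_prod_right.aemeasurable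
  refine ⟨u x, ?_⟩
  have hint : Integrable (fun y => (u y - u x) ^ 2) (volume.restrict T.openSet) := by
    have : IsFiniteMeasure (volume.restrict T.openSet) :=
      ⟨by rw [Measure.restrict_apply_univ]; exact T.isBounded_openSet.measure_lt_top⟩
    exact (((Lp.memLp u).mono_measure (Measure.restrict_mono hTΩ le_rfl)).sub
      (memLp_const (u x))).integrable_sq
  rw [setLAverage_eq] at hle
  have h1 := hle.trans (ENNReal.div_le_div_right (lintegral_lintegral_sub_sq_le hug hTΩ) _)
  have hVe : volume T.openSet = ENNReal.ofReal T.vol :=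
    (ENNReal.ofReal_toReal T.volume_openSet_ne_top).symm
  rw [hVe, ← hG2, ← ENNReal.ofReal_div_of_pos hV, ← ofReal_integral_eq_lintegral_ofReal hint
      (Filter.Eventually.of_forall fun _ => sq_nonneg _), ENNReal.ofReal_le_ofReal_iff
      (div_nonneg (by have := T.diam_nonneg; positivity) hV.le)] at h1
  refine h1.trans ?_
  have hreg' : T.diam ^ d / T.vol ≤ Creg := (div_le_iff₀ hV).2 hreg
  calc T.diam ^ 2 * G2 * (T.diam ^ d * unitBallVol d) / T.vol
      = T.diam ^ 2 * G2 * unitBallVol d * (T.diam ^ d / T.vol) := by ring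
    _ ≤ T.diam ^ 2 * G2 * unitBallVol d * Creg := by
      have := T.diam_nonneg
      gcongr
    _ = _ := by ring

end LipschitzDomain

/-! ### Approximation by piecewise constants -/

namespace Mesh

variable {d : ℕ} {Ω : LipschitzDomain d} {𝒯 : Mesh Ω}

theorem integral_eq_sum {F : Eu d → ℝ} (hF : Integrable F Ω.vol) :
    ∫ x in Ω.carrier, F x = ∑ T ∈ 𝒯.elems, ∫ x in T.openSet, F x := by
  have hsub : ⋃ T ∈ 𝒯.elems, T.openSet ⊆ Ω.carrier := iUnion₂_subset fun T hT => openSet_subset hT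
  have hae : (⋃ T ∈ 𝒯.elems, T.openSet : Set (Eu d)) =ᵐ[volume] Ω.carrier := by
    have h := (ae_restrict_iff' Ω.isOpen.measurableSet).1 𝒯.ae_mem
    filter_upwards [h] with x hx
    refine propext ⟨fun hxU => hsub hxU, fun hxΩ => ?_⟩
    obtain ⟨T, hT, hxT⟩ := hx hxΩ
    exact mem_biUnion hT hxT
  rw [← setIntegral_congr_set hae]
  exact integral_biUnion_finset _ (fun T _ => T.measurableSet_openSet) pairwiseDisjoint_openSet
    fun T hT => IntegrableOn.mono_set hF (openSet_subset hT)

theorem exists_mem_P0 (𝒯 : Mesh Ω) (c : MeshSimplex d → ℝ) :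
    ∃ q ∈ 𝒯.P0, ∀ T ∈ 𝒯.elems, ∀ᵐ x ∂Ω.vol, x ∈ T.openSet → q x = c T := by
  let Q : Eu d → ℝ := fun x => ∑ T ∈ 𝒯.elems, T.openSet.indicator (fun _ => c T) x
  have hQ : MemLp Q 2 Ω.vol := memLp_finsetSum _ fun T _ =>
    memLp_indicator_const 2 T.measurableSet_openSet (c T) (Or.inr (measure_ne_top _ _))
  have hval : ∀ T ∈ 𝒯.elems, ∀ x ∈ T.openSet, Q x = c T := by
    intro T hT x hx
    simp only [Q]
    rw [Finset.sum_eq_single T, indicator_of_mem hx]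
    · intro T' hT' hne
      exact indicator_of_notMem
        (fun hx' => Set.disjoint_left.1 (disjoint_openSet hT' hT hne) hx' hx) _
    · exact fun h => absurd hT h
  have key : ∀ T ∈ 𝒯.elems, ∀ᵐ x ∂Ω.vol, x ∈ T.openSet → (hQ.toLp Q : Eu d → ℝ) x = c T := by
    intro T hT
    filter_upwards [hQ.coeFn_toLp] with x hx hxT
    rw [hx, hval T hT x hxT]
  exact ⟨hQ.toLp Q, fun T hT => ⟨c T, key T hT⟩, key⟩

/-- The direct estimate for piecewise constants. -/
theorem exists_mem_P0_norm_sub_le {Creg : ℝ} (hCreg : 0 ≤ Creg)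
    (hreg : ∀ T ∈ 𝒯.elems, T.diam ^ d ≤ Creg * T.vol) {u : Ω.L2} {g : Ω.L2Vec}
    (hug : Ω.IsWeakGradient u g) :
    ∃ q ∈ 𝒯.P0, ‖u - q‖ ≤ √(Creg * unitBallVol d) * 𝒯.size * ‖g‖ := by
  have hω := unitBallVol_pos d
  have hex : ∀ T : MeshSimplex d, ∃ c : ℝ, T ∈ 𝒯.elems → ∫ x in T.openSet, (u x - c) ^ 2 ≤
      Creg * unitBallVol d * T.diam ^ 2 * ∫ x in T.openSet, ‖g x‖ ^ 2 := by
    intro T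
    by_cases hT : T ∈ 𝒯.elems
    · obtain ⟨c, hc⟩ := LipschitzDomain.exists_integral_sub_sq_le hug (openSet_subset hT)
        (hreg T hT)
      exact ⟨c, fun _ => hc⟩
    · exact ⟨0, fun h => absurd h hT⟩
  choose c hc using hex
  obtain ⟨q, hq, hqc⟩ := 𝒯.exists_mem_P0 c
  refine ⟨q, hq, ?_⟩
  have hs := (size_pos (𝒯 := 𝒯)).le
  refine le_of_sq_le_sq ?_ (by positivity)
  rw [mul_pow, mul_pow, Real.sq_sqrt (by positivity), ← integral_sq_eq_norm_sq (u - q),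
    ← integral_sq_eq_norm_sq g, integral_eq_sum (𝒯 := 𝒯) (Lp.memLp (u - q)).norm.integrable_sq,
    integral_eq_sum (𝒯 := 𝒯) (Lp.memLp g).norm.integrable_sq, Finset.mul_sum]
  refine Finset.sum_le_sum fun T hT => ?_
  have e : ∫ x in T.openSet, ‖(u - q) x‖ ^ 2 = ∫ x in T.openSet, (u x - c T) ^ 2 := by
    have h1 := ae_mono (Measure.restrict_mono (openSet_subset hT) le_rfl) (hqc T hT)
    have h2 := ae_mono (Measure.restrict_mono (openSet_subset hT) le_rfl) (Lp.coeFn_sub u q)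
    refine integral_congr_ae ?_
    filter_upwards [h1, h2, ae_restrict_mem T.measurableSet_openSet] with x a b hx
    rw [b, Pi.sub_apply, a hx, Real.norm_eq_abs, sq_abs]
  rw [e]
  refine (hc T hT).trans ?_
  have := T.diam_nonneg
  have hG0 : 0 ≤ ∫ x in T.openSet, ‖g x‖ ^ 2 := integral_nonneg fun _ => sq_nonneg _
  gcongr
  exact diam_le_size hT

end Mesh

/-! ### The inverse estimate for piecewise constants -/

/-- Shape regular simplices carry smooth bump functions with the scaling of their size: a fixed
profile, transplanted to a ball inside the simplex. -/
theorem MeshSimplex.exists_bump {d : ℕ} (hd : d ≠ 0) {Creg : ℝ} (hC : 0 < Creg) :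
    ∃ κ K : ℝ, 0 < κ ∧ 0 < K ∧ ∀ T : MeshSimplex d, T.diam ^ d ≤ Creg * T.vol →
      ∃ η : Eu d → ℝ, ContDiff ℝ ∞ η ∧ HasCompactSupport η ∧ tsupport η ⊆ T.openSet ∧
        κ * T.vol ≤ ∫ x in T.openSet, η x ∧ ∀ x, ‖fderiv ℝ η x‖ ≤ K / T.diam := by
  have hω := unitBallVol_pos d
  let b : ContDiffBump (0 : Eu d) := ⟨1 / 2, 1, by norm_num, by norm_num⟩
  have hb : ContDiff ℝ ∞ b := b.contDiff
  obtain ⟨K₀, hK₀⟩ := (b.hasCompactSupport.fderiv (𝕜 := ℝ)).exists_bound_of_continuous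
    (hb.continuous_fderiv (by simp))
  set c : ℝ := 1 / (2 * (d + 1) * (2 ^ d * unitBallVol d * Creg)) with hc
  have hc0 : 0 < c := by positivity
  refine ⟨(c / 2) ^ d, (max K₀ 1) / c, by positivity, by positivity, fun T hreg => ?_⟩
  have hh := T.diam_pos hd
  obtain ⟨a, ha⟩ := T.exists_closedBall_subset hd hC hreg
  set r := T.diam * c with hr
  have hr' : T.diam / (2 * (d + 1) * (2 ^ d * unitBallVol d * Creg)) = r := by
    rw [hr, hc]; ring
  rw [hr'] at ha
  have hr0 : 0 < r := by positivity
  let η : Eu d → ℝ := fun x => b (r⁻¹ • (x - a))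
  have hη : ContDiff ℝ ∞ η := hb.comp (by fun_prop)
  have hsupp : Function.support η ⊆ Metric.closedBall a r := by
    intro x hx
    have h1 : r⁻¹ • (x - a) ∈ Function.support b := hx
    rw [b.support_eq, mem_ball_zero_iff, norm_smul, Real.norm_of_nonneg (by positivity),
      inv_mul_lt_iff₀ hr0] at h1
    rw [Metric.mem_closedBall, dist_eq_norm]
    linarith
  have htsupp : tsupport η ⊆ Metric.closedBall a r :=
    closure_minimal hsupp Metric.isClosed_closedBall
  have hcs : HasCompactSupport η := (isCompact_closedBall a r).of_isClosed_subset
    (isClosed_tsupport η) htsupp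
  refine ⟨η, hη, hcs, htsupp.trans ha, ?_, fun x => ?_⟩
  · have hsub : Metric.closedBall a (r / 2) ⊆ T.openSet :=
      (Metric.closedBall_subset_closedBall (by linarith)).trans ha
    have hint : IntegrableOn η T.openSet :=
      (hη.continuous.integrable_of_hasCompactSupport hcs).restrict
    calc (c / 2) ^ d * T.vol ≤ (c / 2) ^ d * (T.diam ^ d * unitBallVol d) := by
          gcongr; exact T.vol_le
      _ = (r / 2) ^ d * unitBallVol d := by rw [hr, ← mul_assoc, ← mul_pow]; ring
      _ = ∫ _ in Metric.closedBall a (r / 2), (1 : ℝ) := by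
          rw [setIntegral_const, volume_real_closedBall a (by positivity), smul_eq_mul, mul_one]
      _ = ∫ x in Metric.closedBall a (r / 2), η x := by
          refine setIntegral_congr_fun Metric.isClosed_closedBall.measurableSet fun x hx => ?_
          refine (b.one_of_mem_closedBall ?_).symm
          rw [Metric.mem_closedBall, dist_eq_norm] at hx
          rw [mem_closedBall_zero_iff, norm_smul, Real.norm_of_nonneg (by positivity),
            inv_mul_le_iff₀ hr0]
          change ‖x - a‖ ≤ r * (1 / 2)
          linarith
      _ ≤ ∫ x in T.openSet, η x :=
          setIntegral_mono_set hint (Filter.Eventually.of_forall fun x => b.nonneg)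
            (LE.le.eventuallyLE hsub)
  · have hlin : HasFDerivAt (fun x : Eu d => r⁻¹ • (x - a))
        (r⁻¹ • ContinuousLinearMap.id ℝ (Eu d)) x :=
      ((hasFDerivAt_id x).sub_const a).const_smul r⁻¹
    have hder : HasFDerivAt η ((fderiv ℝ b (r⁻¹ • (x - a))).comp
        (r⁻¹ • ContinuousLinearMap.id ℝ (Eu d))) x :=
      HasFDerivAt.comp (g := b) (f := fun x => r⁻¹ • (x - a)) x
        (hb.differentiable (by simp) (r⁻¹ • (x - a))).hasFDerivAt hlin
    rw [hder.fderiv]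
    calc _ ≤ ‖fderiv ℝ b (r⁻¹ • (x - a))‖ * ‖r⁻¹ • ContinuousLinearMap.id ℝ (Eu d)‖ :=
          ContinuousLinearMap.opNorm_comp_le _ _
      _ ≤ max K₀ 1 * r⁻¹ := by
          gcongr
          · exact (hK₀ _).trans (le_max_left _ _)
          · rw [norm_smul, Real.norm_of_nonneg (by positivity)]
            exact mul_le_of_le_one_right (by positivity) ContinuousLinearMap.norm_id_le
      _ = _ := by rw [hr]; field_simp

namespace LipschitzDomain

variable {d : ℕ} {Ω : LipschitzDomain d}

/-- Test functions belong to `H¹₀(Ω)`, with their classical gradient. -/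
theorem IsTestFunction.exists_H10 {Ψ : Eu d → ℝ} (hΨ : Ω.IsTestFunction Ψ) :
    ∃ v : Ω.H10, H10.toL2 Ω v =ᵐ[Ω.vol] Ψ ∧
      ∀ᵐ x ∂Ω.vol, ‖H10.grad Ω v x‖ = ‖fderiv ℝ Ψ x‖ := by
  let G : Eu d → Eu d := fun x => (InnerProductSpace.toDual ℝ (Eu d)).symm (fderiv ℝ Ψ x)
  have hGi : ∀ x i, (G x) i = partialDeriv i Ψ x := by
    intro x i
    have h1 : ⟪G x, EuclideanSpace.single i (1 : ℝ)⟫ = partialDeriv i Ψ x := by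
      rw [← InnerProductSpace.toDual_apply_apply (𝕜 := ℝ)]
      simp [G, partialDeriv]
    rw [← h1, EuclideanSpace.inner_single_right]
    simp
  have hGc : Continuous G := (InnerProductSpace.toDual ℝ (Eu d)).symm.continuous.comp
    (hΨ.contDiff.continuous_fderiv (by simp))
  have hGs : HasCompactSupport G := (hΨ.hasCompactSupport.fderiv (𝕜 := ℝ)).comp_left
    (g := fun F => (InnerProductSpace.toDual ℝ (Eu d)).symm F) (by simp)
  have hGm : MemLp G 2 Ω.vol := (hGc.memLp_of_hasCompactSupport hGs).restrict _
  have hΨm : MemLp Ψ 2 Ω.vol :=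
    (hΨ.contDiff.continuous.memLp_of_hasCompactSupport hΨ.hasCompactSupport).restrict _
  have hweak : Ω.IsWeakGradient hΨm.toLp hGm.toLp := by
    intro χ hχ i
    have e1 : ∫ x in Ω.carrier, hΨm.toLp Ψ x * partialDeriv i χ x =
        ∫ x, Ψ x * partialDeriv i χ x := by
      refine Eq.trans ?_ (setIntegral_eq_integral_of_forall_compl_eq_zero (s := Ω.carrier)
        fun x hx => by
          rw [image_eq_zero_of_notMem_tsupport fun h => hx (hΨ.tsupport_subset h), zero_mul])
      refine integral_congr_ae ?_
      filter_upwards [hΨm.coeFn_toLp] with x hx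
      rw [hx]
    have e2 : ∫ x in Ω.carrier, χ x * (hGm.toLp G x) i = ∫ x, partialDeriv i Ψ x * χ x := by
      refine Eq.trans ?_ (setIntegral_eq_integral_of_forall_compl_eq_zero (s := Ω.carrier)
        fun x hx => by
          rw [image_eq_zero_of_notMem_tsupport fun h => hx (hχ.tsupport_subset h), mul_zero])
      refine integral_congr_ae ?_
      filter_upwards [hGm.coeFn_toLp] with x hx
      rw [hx, hGi, mul_comm]
    rw [e1, e2]
    have hc1 := hΨ.contDiff.continuous
    have hc2 := hχ.contDiff.continuous
    exact integral_mul_fderiv_eq_neg_fderiv_mul_of_integrable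
      (((hΨ.continuous_partialDeriv i).mul hc2).integrable_of_hasCompactSupport
        hχ.hasCompactSupport.mul_left)
      ((hc1.mul (hχ.continuous_partialDeriv i)).integrable_of_hasCompactSupport
        hΨ.hasCompactSupport.mul_right)
      ((hc1.mul hc2).integrable_of_hasCompactSupport hΨ.hasCompactSupport.mul_right)
      (fun x _ => hΨ.contDiff.differentiable (by simp) x)
      (fun x _ => hχ.contDiff.differentiable (by simp) x)
  let p : Ω.H1 := ⟨WithLp.toLp 2 (hΨm.toLp, hGm.toLp), hweak⟩
  have hp : p ∈ Ω.testSpace := by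
    refine ⟨Ψ, hΨ, hΨm.coeFn_toLp, fun i => ?_⟩
    filter_upwards [hGm.coeFn_toLp] with x hx
    have : p.1.snd = hGm.toLp := rfl
    rw [this, hx, hGi]
  refine ⟨⟨p, Ω.testSpace.le_topologicalClosure hp⟩, hΨm.coeFn_toLp, ?_⟩
  filter_upwards [hGm.coeFn_toLp] with x hx
  have e : H10.grad Ω ⟨p, Ω.testSpace.le_topologicalClosure hp⟩ = hGm.toLp := rfl
  rw [e, hx]
  exact LinearIsometryEquiv.norm_map _ _

end LipschitzDomain

namespace Mesh

/-- The inverse estimate between `L²(Ω)` and `H⁻¹(Ω)` on a quasi-uniform shape regular mesh: a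
piecewise constant function is tested with the combination of bump functions that has the same
coefficients. -/
theorem exists_norm_le_of_mem_P0 {d : ℕ} (hd : d ≠ 0) {Creg Cq : ℝ} (hCreg : 0 < Creg)
    (hCq : 0 < Cq) :
    ∃ C : ℝ, 1 ≤ C ∧ ∀ (Ω : LipschitzDomain d) (𝒯 : Mesh Ω),
      (∀ T ∈ 𝒯.elems, T.diam ^ d ≤ Creg * T.vol) → (∀ T ∈ 𝒯.elems, 𝒯.size ≤ Cq * T.diam) →
      ∀ ψ ∈ 𝒯.P0, ‖ψ‖ ≤ C / 𝒯.size * ‖toDualSpace (LipschitzDomain.H10.toL2 Ω) ψ‖ := by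
  obtain ⟨κ, K, hκ, hK, hbump⟩ := MeshSimplex.exists_bump hd hCreg
  refine ⟨max 1 (K * Cq / κ), le_max_left _ _, fun Ω 𝒯 hreg hqu ψ hψ => ?_⟩
  have hs := size_pos (𝒯 := 𝒯)
  have hexη : ∀ T : MeshSimplex d, ∃ η : Eu d → ℝ, T ∈ 𝒯.elems →
      ContDiff ℝ ∞ η ∧ HasCompactSupport η ∧ tsupport η ⊆ T.openSet ∧
        κ * T.vol ≤ ∫ x in T.openSet, η x ∧ ∀ x, ‖fderiv ℝ η x‖ ≤ K / T.diam := by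
    intro T
    by_cases hT : T ∈ 𝒯.elems
    · obtain ⟨η, h⟩ := hbump T (hreg T hT)
      exact ⟨η, fun _ => h⟩
    · exact ⟨fun _ => 0, fun h => absurd h hT⟩
  choose η hη using hexη
  have hexc : ∀ T : MeshSimplex d, ∃ c : ℝ, T ∈ 𝒯.elems →
      ∀ᵐ x ∂Ω.vol, x ∈ T.openSet → ψ x = c := by
    intro T
    by_cases hT : T ∈ 𝒯.elems
    · obtain ⟨c, hc⟩ := hψ T hT
      exact ⟨c, fun _ => hc⟩
    · exact ⟨0, fun h => absurd h hT⟩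
  choose c hc using hexc
  let Ψ : Eu d → ℝ := fun x => ∑ T ∈ 𝒯.elems, c T * η T x
  have hη0 : ∀ T ∈ 𝒯.elems, ∀ x, x ∉ T.openSet → η T x = 0 := fun T hT x hx =>
    image_eq_zero_of_notMem_tsupport fun h => hx ((hη T hT).2.2.1 h)
  have hΨT : ∀ T ∈ 𝒯.elems, ∀ x ∈ T.openSet, Ψ x = c T * η T x := by
    intro T hT x hx
    simp only [Ψ]
    refine Finset.sum_eq_single_of_mem T hT fun T' hT' hne => ?_
    rw [hη0 T' hT' x fun hx' => Set.disjoint_left.1 (disjoint_openSet hT' hT hne) hx' hx, mul_zero]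
  have htest : Ω.IsTestFunction Ψ := by
    have hsub : Function.support Ψ ⊆ ⋃ T ∈ 𝒯.elems, tsupport (η T) := by
      intro x hx
      by_contra hcon
      simp only [mem_iUnion, not_exists] at hcon
      refine hx (Finset.sum_eq_zero fun T hT => ?_)
      rw [image_eq_zero_of_notMem_tsupport (hcon T hT), mul_zero]
    have hcomp : IsCompact (⋃ T ∈ 𝒯.elems, tsupport (η T)) :=
      𝒯.elems.isCompact_biUnion fun T hT => (hη T hT).2.1
    have hts : tsupport Ψ ⊆ ⋃ T ∈ 𝒯.elems, tsupport (η T) := closure_minimal hsub hcomp.isClosed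
    refine ⟨ContDiff.sum fun T hT => contDiff_const.mul (hη T hT).1,
      hcomp.of_isClosed_subset (isClosed_tsupport Ψ) hts,
      hts.trans (iUnion₂_subset fun T hT => (hη T hT).2.2.1.trans (openSet_subset hT))⟩
  obtain ⟨v, hv, hgrad⟩ := htest.exists_H10
  have hpt : ∀ᵐ x ∂Ω.vol, ∃ T ∈ 𝒯.elems, x ∈ T.openSet ∧ ψ x = c T := by
    filter_upwards [𝒯.ae_mem, (Filter.eventually_all_finset 𝒯.elems).2 fun T hT => hc T hT]
      with x ⟨T, hT, hxT⟩ h2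
    exact ⟨T, hT, hxT, h2 T hT hxT⟩
  have hnorm : ‖v‖ ≤ K * Cq / 𝒯.size * ‖ψ‖ := by
    rw [LipschitzDomain.H10.norm_def]
    refine Lp.norm_le_mul_norm_of_ae_le_mul ?_
    filter_upwards [hpt, hgrad] with x ⟨T, hT, hxT, hx⟩ h2
    rw [h2, hx]
    have hev : Ψ =ᶠ[nhds x] fun y => c T * η T y := by
      filter_upwards [T.isOpen_openSet.mem_nhds hxT] with y hy using hΨT T hT y hy
    have hh := T.diam_pos hd
    rw [hev.fderiv_eq, fderiv_const_mul ((hη T hT).1.differentiable (by simp) x), norm_smul,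
      mul_comm]
    gcongr
    refine ((hη T hT).2.2.2.2 x).trans ?_
    rw [div_le_div_iff₀ hh hs, mul_assoc]
    gcongr
    exact hqu T hT
  have hΨm : MemLp Ψ 2 Ω.vol :=
    (htest.contDiff.continuous.memLp_of_hasCompactSupport htest.hasCompactSupport).restrict _
  have hlow : κ * ‖ψ‖ ^ 2 ≤ toDualSpace (LipschitzDomain.H10.toL2 Ω) ψ v := by
    have e : toDualSpace (LipschitzDomain.H10.toL2 Ω) ψ v = ∫ x in Ω.carrier, ψ x * Ψ x := by
      rw [toDualSpace_apply, L2.inner_def]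
      refine integral_congr_ae ?_
      filter_upwards [hv] with x hx
      rw [hx]
      exact mul_comm _ _
    have i1 : Integrable (fun x => ψ x * Ψ x) Ω.vol := (Lp.memLp ψ).integrable_mul hΨm
    rw [e, ← integral_sq_eq_norm_sq, integral_eq_sum (𝒯 := 𝒯) (Lp.memLp ψ).norm.integrable_sq,
      integral_eq_sum (𝒯 := 𝒯) i1, Finset.mul_sum]
    refine Finset.sum_le_sum fun T hT => ?_
    have hcT := ae_mono (Measure.restrict_mono (openSet_subset hT) le_rfl) (hc T hT)
    have e1 : ∫ x in T.openSet, ‖ψ x‖ ^ 2 = c T ^ 2 * T.vol := by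
      rw [integral_congr_ae (g := fun _ => c T ^ 2), setIntegral_const, smul_eq_mul, mul_comm]
      · rfl
      · filter_upwards [hcT, ae_restrict_mem T.measurableSet_openSet] with x hx hxT
        rw [hx hxT, Real.norm_eq_abs, sq_abs]
    have e2 : ∫ x in T.openSet, ψ x * Ψ x = c T ^ 2 * ∫ x in T.openSet, η T x := by
      rw [← integral_const_mul]
      refine integral_congr_ae ?_
      filter_upwards [hcT, ae_restrict_mem T.measurableSet_openSet] with x hx hxT
      rw [hx hxT, hΨT T hT x hxT]
      ring
    rw [e1, e2]
    calc κ * (c T ^ 2 * T.vol) = c T ^ 2 * (κ * T.vol) := by ring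
      _ ≤ _ := by gcongr; exact (hη T hT).2.2.2.1
  set F := toDualSpace (LipschitzDomain.H10.toL2 Ω) ψ with hF
  have hup : κ * ‖ψ‖ ^ 2 ≤ ‖F‖ * (K * Cq / 𝒯.size * ‖ψ‖) :=
    hlow.trans ((Real.le_norm_self _).trans ((F.le_opNorm v).trans (by gcongr)))
  have hfin : ‖ψ‖ ≤ K * Cq / κ / 𝒯.size * ‖F‖ := by
    rcases (norm_nonneg ψ).eq_or_lt with h0 | h0
    · rw [← h0]; positivity
    · have h1 : κ * ‖ψ‖ ≤ ‖F‖ * (K * Cq / 𝒯.size) := by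
        refine le_of_mul_le_mul_right ?_ h0
        calc κ * ‖ψ‖ * ‖ψ‖ = κ * ‖ψ‖ ^ 2 := by ring
          _ ≤ _ := hup
          _ = _ := by ring
      calc ‖ψ‖ = κ * ‖ψ‖ / κ := by field_simp
        _ ≤ ‖F‖ * (K * Cq / 𝒯.size) / κ := by gcongr
        _ = _ := by ring
  refine hfin.trans ?_
  gcongr
  exact le_max_right _ _

end Mesh

/-! ### Uniform mesh sequences as multilevel scales -/

namespace LipschitzDomain

variable {d : ℕ} {Ω : LipschitzDomain d}

theorem restrictDual_toDualSpace (φ : Ω.L2) :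
    restrictDual (toDualSpace (H1.toL2 Ω) φ) = toDualSpace (H10.toL2 Ω) φ := rfl

theorem norm_restrictDual_le (F : StrongDual ℝ Ω.H1) :
    ‖restrictDual F‖ ≤ (Ω.friedrichsConst + 1) * ‖F‖ := by
  have h0 := Ω.friedrichsConst_nonneg
  refine ContinuousLinearMap.opNorm_le_bound _ (by positivity) fun v => ?_
  calc ‖F (H10.toH1 Ω v)‖ ≤ ‖F‖ * ‖H10.toH1 Ω v‖ := F.le_opNorm _
    _ ≤ ‖F‖ * ((Ω.friedrichsConst + 1) * ‖v‖) := by gcongr; exact H10.norm_coe_le Ω v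
    _ = _ := by ring

theorem norm_snd_le (p : Ω.H1) : ‖p.1.snd‖ ≤ ‖p‖ := by
  have e : ‖p‖ ^ 2 = ‖p.1.fst‖ ^ 2 + ‖p.1.snd‖ ^ 2 := WithLp.prod_norm_sq_eq_of_L2 p.1
  refine le_of_sq_le_sq ?_ (norm_nonneg _)
  rw [e]
  exact le_add_of_nonneg_left (sq_nonneg _)

theorem levelPart_eq (𝒯 : ℕ → Mesh Ω) (φ : Ω.L2) (ℓ : ℕ) :
    levelPart 𝒯 φ ℓ = multilevelPart (H10.toL2 Ω) (fun ℓ => (𝒯 ℓ).P0) φ ℓ := by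
  cases ℓ <;> rfl

theorem levelPartTilde_eq (𝒯 : ℕ → Mesh Ω) (φ : Ω.L2) (ℓ : ℕ) :
    levelPartTilde 𝒯 φ ℓ = multilevelPart (H1.toL2 Ω) (fun ℓ => (𝒯 ℓ).P0) φ ℓ := by
  cases ℓ <;> rfl

end LipschitzDomain

open LipschitzDomain

/-- Piecewise constants on uniform meshes satisfy the direct and inverse estimates, with respect to
both `H¹₀(Ω)` and `H¹(Ω)`; the inverse estimate for `H¹(Ω)` follows from the one for `H¹₀(Ω)`. -/
theorem exists_isMultilevelScale {d : ℕ} (Ω : LipschitzDomain d) {Creg qref Cref : ℝ} (kref : ℕ)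
    (hCreg : 0 < Creg) (hq0 : 0 < qref) (hq1 : qref < 1) (hCref : 0 < Cref) :
    ∃ CJ CB A θ κ : ℝ, 0 ≤ CJ ∧ 1 ≤ CB ∧ 0 < A ∧ 0 < θ ∧ θ < 1 ∧ 0 ≤ κ ∧
      ∀ (R : RefinementRule d) (L : ℕ) (𝒯 : ℕ → Mesh Ω),
        IsUniformMeshSequence R Creg qref Cref kref L 𝒯 →
          IsMultilevelScale (H10.toL2 Ω) CJ CB A θ κ Cref L (fun ℓ => (𝒯 ℓ).P0)
            (fun ℓ => (𝒯 ℓ).size) ∧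
          IsMultilevelScale (H1.toL2 Ω) CJ (CB * (Ω.friedrichsConst + 1)) A θ κ Cref L
            (fun ℓ => (𝒯 ℓ).P0) (fun ℓ => (𝒯 ℓ).size) := by
  have hd := Ω.dim_ne_zero
  have hF := Ω.friedrichsConst_nonneg
  obtain ⟨CB, hCB, hinv⟩ := Mesh.exists_norm_le_of_mem_P0 hd hCreg (sq_pos_of_pos hCref)
  have hθ0 : (0 : ℝ) < (1 / 2 : ℝ) ^ (1 / (d : ℝ)) := by positivity
  have hθ1 : (1 / 2 : ℝ) ^ (1 / (d : ℝ)) < 1 :=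
    Real.rpow_lt_one (by norm_num) (by norm_num) (by positivity)
  refine ⟨√(Creg * unitBallVol d), CB, Cref ^ 2 * max 1 (Creg * unitBallVol d),
    (1 / 2 : ℝ) ^ (1 / (d : ℝ)), Cref ^ 2 / qref ^ kref, Real.sqrt_nonneg _, hCB, by positivity,
    hθ0, hθ1, by positivity, fun R L 𝒯 h => ?_⟩
  have hreg : ∀ ℓ ≤ L, ∀ T ∈ (𝒯 ℓ).elems, T.diam ^ d ≤ Creg * T.vol := fun ℓ hℓ T hT =>
    h.diam_pow_le hℓ hT
  have hinv' : ∀ ℓ ≤ L, ∀ ψ ∈ (𝒯 ℓ).P0,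
      ‖ψ‖ ≤ CB / (𝒯 ℓ).size * ‖toDualSpace (H10.toL2 Ω) ψ‖ := fun ℓ hℓ ψ hψ =>
    hinv Ω (𝒯 ℓ) (hreg ℓ hℓ) (fun T hT => h.size_le hCref hℓ hT) ψ hψ
  refine ⟨⟨fun ℓ hℓ => h.P0_le hℓ, fun ℓ _ => Mesh.size_pos,
    fun ℓ m hℓm hm => h.size_decay hCreg hCref hℓm hm,
    fun ℓ hℓ => h.size_le_size_succ hq0 hq1 hCref hℓ, h.one_le_size hCref, fun ℓ hℓ w => ?_, hinv'⟩,
    ⟨fun ℓ hℓ => h.P0_le hℓ, fun ℓ _ => Mesh.size_pos,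
    fun ℓ m hℓm hm => h.size_decay hCreg hCref hℓm hm,
    fun ℓ hℓ => h.size_le_size_succ hq0 hq1 hCref hℓ, h.one_le_size hCref, fun ℓ hℓ w => ?_,
    fun ℓ hℓ ψ hψ => ?_⟩⟩
  · exact Mesh.exists_mem_P0_norm_sub_le hCreg.le (hreg ℓ hℓ) w.1.2
  · obtain ⟨q, hq, hle⟩ := Mesh.exists_mem_P0_norm_sub_le (𝒯 := 𝒯 ℓ) hCreg.le (hreg ℓ hℓ) w.2
    refine ⟨q, hq, hle.trans ?_⟩
    have := (Mesh.size_pos (𝒯 := 𝒯 ℓ)).le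
    gcongr
    exact norm_snd_le w
  · have hs := Mesh.size_pos (𝒯 := 𝒯 ℓ)
    refine (hinv' ℓ hℓ ψ hψ).trans ?_
    rw [← restrictDual_toDualSpace]
    calc CB / (𝒯 ℓ).size * ‖restrictDual (toDualSpace (H1.toL2 Ω) ψ)‖
        ≤ CB / (𝒯 ℓ).size * ((Ω.friedrichsConst + 1) * ‖toDualSpace (H1.toL2 Ω) ψ‖) := by
          gcongr
          exact norm_restrictDual_le _
      _ = _ := by ring

/-- On the increments of the `H̃⁻¹(Ω)` projections, the norm of `H̃⁻¹(Ω)` is controlled by the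
weaker norm of `H⁻¹(Ω)`, although this fails for general functionals: an increment is orthogonal to
the coarser level, hence its `H̃⁻¹(Ω)` norm is at most `h_ℓ` times its `L²(Ω)` norm, to which
the inverse estimate in `H⁻¹(Ω)` applies. -/
theorem norm_multilevelPart_le_restrictDual {d : ℕ} {Ω : LipschitzDomain d}
    {CJ CB CB' A θ κ c₀ : ℝ} {L : ℕ} {𝒯 : ℕ → Mesh Ω} (hCJ : 0 ≤ CJ)
    (h : IsMultilevelScale (H10.toL2 Ω) CJ CB A θ κ c₀ L (fun ℓ => (𝒯 ℓ).P0)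
      (fun ℓ => (𝒯 ℓ).size))
    (h' : IsMultilevelScale (H1.toL2 Ω) CJ CB' A θ κ c₀ L (fun ℓ => (𝒯 ℓ).P0)
      (fun ℓ => (𝒯 ℓ).size)) (φ : Ω.L2) {ℓ : ℕ} (hℓ : ℓ ≤ L) :
    ‖levelPartTilde 𝒯 φ ℓ‖ ≤
      max (‖H1.toL2 Ω‖ * c₀) (CJ * κ) * CB * ‖restrictDual (levelPartTilde 𝒯 φ ℓ)‖ := by
  rw [levelPartTilde_eq]
  obtain ⟨ψ, hψ, hψ'⟩ := multilevelPart_mem (ι := H1.toL2 Ω) h'.nested φ hℓ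
  rw [← hψ', restrictDual_toDualSpace]
  set F := toDualSpace (H10.toL2 Ω) ψ with hF
  have hs : 0 < (𝒯 ℓ).size := Mesh.size_pos
  have hinv : ‖ψ‖ ≤ CB / (𝒯 ℓ).size * ‖F‖ := h.inverse ℓ hℓ ψ hψ
  set D := max (‖H1.toL2 Ω‖ * c₀) (CJ * κ) with hD
  have key : ‖toDualSpace (H1.toL2 Ω) ψ‖ ≤ D * (𝒯 ℓ).size * ‖ψ‖ := by
    cases ℓ with
    | zero =>
      refine (norm_toDualSpace_le _ ψ).trans ?_
      gcongr
      calc ‖H1.toL2 Ω‖ ≤ ‖H1.toL2 Ω‖ * (c₀ * (𝒯 0).size) :=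
            le_mul_of_one_le_right (ContinuousLinearMap.opNorm_nonneg _) h.coarse
        _ = ‖H1.toL2 Ω‖ * c₀ * (𝒯 0).size := by ring
        _ ≤ _ := by gcongr; exact le_max_left _ _
    | succ ℓ =>
      have hs' : 0 < (𝒯 ℓ).size := Mesh.size_pos
      refine (norm_toDualSpace_le_of_orthogonal (Q := (𝒯 ℓ).P0) (δ := CJ * (𝒯 ℓ).size)
        (by positivity) (h'.direct ℓ (by omega)) ψ fun q hq => ?_).trans ?_
      · rw [hψ']
        exact inner_multilevelPart_succ h'.nested φ hℓ hq
      · refine mul_le_mul_of_nonneg_right ?_ (norm_nonneg _)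
        calc CJ * (𝒯 ℓ).size ≤ CJ * (κ * (𝒯 (ℓ + 1)).size) := by gcongr; exact h.ratio ℓ hℓ
          _ = CJ * κ * (𝒯 (ℓ + 1)).size := by ring
          _ ≤ _ := by gcongr; exact le_max_right _ _
  have hD0 : 0 ≤ D := by
    have h1 : 0 ≤ c₀ := by
      have h2 : 1 ≤ c₀ * (𝒯 0).size := h.coarse
      have h3 : 0 < (𝒯 0).size := Mesh.size_pos
      by_contra hc
      have := mul_neg_of_neg_of_pos (not_le.1 hc) h3
      linarith
    exact (mul_nonneg (ContinuousLinearMap.opNorm_nonneg _) h1).trans (le_max_left _ _)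
  calc _ ≤ D * (𝒯 ℓ).size * ‖ψ‖ := key
    _ ≤ D * (𝒯 ℓ).size * (CB / (𝒯 ℓ).size * ‖F‖) := by gcongr
    _ = _ := by field_simp

/-! ### The multilevel norm equivalences -/

theorem EquivWith.mono {C C' : ℝ} (hC : C ≤ C') {a b : ℝ≥0∞} (h : EquivWith C a b) :
    EquivWith C' a b :=
  ⟨h.1.trans (by gcongr), h.2.trans (by gcongr)⟩

theorem EquivWith.trans_ofReal {C D : ℝ} (hC : 0 ≤ C) (hD : 0 ≤ D) {a : ℝ≥0∞} {x y : ℝ}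
    (h : EquivWith C a (ENNReal.ofReal x)) (hxy : x ≤ D * y) (hyx : y ≤ D * x) :
    EquivWith (C * D) a (ENNReal.ofReal y) := by
  refine ⟨h.1.trans ?_, ?_⟩
  · rw [ENNReal.ofReal_mul hC, mul_assoc, ← ENNReal.ofReal_mul hD]
    gcongr
  · calc ENNReal.ofReal y ≤ ENNReal.ofReal D * ENNReal.ofReal x := by
          rw [← ENNReal.ofReal_mul hD]; gcongr
      _ ≤ ENNReal.ofReal D * (ENNReal.ofReal C * a) := by gcongr; exact h.2
      _ = _ := by rw [← mul_assoc, ← ENNReal.ofReal_mul hD, mul_comm D C]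

theorem mainTheorem6 (d : ℕ) (Ω : LipschitzDomain d) (s : ℝ) (hs0 : 0 < s) (hs1 : s < 1)
    (Creg qref Cref : ℝ) (kref : ℕ) (hCreg : 0 < Creg) (hq0 : 0 < qref) (hq1 : qref < 1)
    (hCref : 0 < Cref) :
    ∃ C : ℝ, 0 < C ∧
      ∀ (R : RefinementRule d) (L : ℕ) (𝒯 : ℕ → Mesh Ω),
        IsUniformMeshSequence R Creg qref Cref kref L 𝒯 →
        ∀ φ ∈ (𝒯 L).P0,
          EquivWith C (Ω.normNeg s φ ^ 2)
            (ENNReal.ofReal (∑ ℓ ∈ Finset.range (L + 1),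
              (𝒯 ℓ).size ^ (-2 + 2 * s) * ‖LipschitzDomain.levelPart 𝒯 φ ℓ‖ ^ 2)) ∧
          EquivWith C (Ω.normNegTilde s φ ^ 2)
            (ENNReal.ofReal (∑ ℓ ∈ Finset.range (L + 1),
              (𝒯 ℓ).size ^ (-2 + 2 * s) * ‖LipschitzDomain.levelPartTilde 𝒯 φ ℓ‖ ^ 2)) ∧
          EquivWith C (Ω.normNegTilde s φ ^ 2)
            (ENNReal.ofReal (∑ ℓ ∈ Finset.range (L + 1),
              (𝒯 ℓ).size ^ (-2 + 2 * s) *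
                ‖LipschitzDomain.restrictDual (LipschitzDomain.levelPartTilde 𝒯 φ ℓ)‖ ^ 2)) := by
  obtain ⟨CJ, CB, A, θ, κ, hCJ, hCB, hA, hθ0, hθ1, hκ, hscale⟩ :=
    exists_isMultilevelScale Ω kref hCreg hq0 hq1 hCref
  have hF := Ω.friedrichsConst_nonneg
  have hCB' : 1 ≤ CB * (Ω.friedrichsConst + 1) := one_le_mul_of_one_le_of_one_le hCB (by linarith)
  obtain ⟨C₁, hC₁, h₁⟩ := exists_equivWith_multilevelSum (H10.toL2 Ω) (c₀ := Cref) (κ := κ)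
    hs0 hs1 hCJ hCB hA hθ0 hθ1
  obtain ⟨C₂, hC₂, h₂⟩ := exists_equivWith_multilevelSum (H1.toL2 Ω) (c₀ := Cref) (κ := κ)
    hs0 hs1 hCJ hCB' hA hθ0 hθ1
  set E := max (‖H1.toL2 Ω‖ * Cref) (CJ * κ) * CB with hE
  set D := max 1 (max (E ^ 2) ((Ω.friedrichsConst + 1) ^ 2)) with hD
  have hD0 : 0 < D := lt_max_of_lt_left one_pos
  refine ⟨max C₁ (max C₂ (C₂ * D)), lt_max_of_lt_left hC₁, fun R L 𝒯 h𝒯 φ hφ => ?_⟩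
  obtain ⟨hms, hms'⟩ := hscale R L 𝒯 h𝒯
  have e1 := h₁ L _ _ hms φ hφ
  have e2 := h₂ L _ _ hms' φ hφ
  simp only [multilevelSum, ← levelPart_eq] at e1
  simp only [multilevelSum, ← levelPartTilde_eq] at e2
  refine ⟨e1.mono (le_max_left _ _), e2.mono ((le_max_left _ _).trans (le_max_right _ _)), ?_⟩
  refine EquivWith.mono ((le_max_right _ _).trans (le_max_right _ _))
    (e2.trans_ofReal hC₂.le hD0.le ?_ ?_)
  · rw [Finset.mul_sum]
    refine Finset.sum_le_sum fun ℓ hℓ => ?_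
    have hs : 0 < (𝒯 ℓ).size := Mesh.size_pos
    have h1 := norm_multilevelPart_le_restrictDual hCJ hms hms' φ
      (Nat.lt_succ_iff.1 (Finset.mem_range.1 hℓ))
    have h2 : ‖levelPartTilde 𝒯 φ ℓ‖ ^ 2 ≤ D * ‖restrictDual (levelPartTilde 𝒯 φ ℓ)‖ ^ 2 := by
      refine (pow_le_pow_left₀ (ContinuousLinearMap.opNorm_nonneg _) h1 2).trans ?_
      rw [mul_pow]
      gcongr
      exact (le_max_left _ _).trans (le_max_right _ _)
    calc _ ≤ (𝒯 ℓ).size ^ (-2 + 2 * s) * (D * ‖restrictDual (levelPartTilde 𝒯 φ ℓ)‖ ^ 2) := by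
          gcongr
      _ = _ := by ring
  · rw [Finset.mul_sum]
    refine Finset.sum_le_sum fun ℓ _ => ?_
    have hs : 0 < (𝒯 ℓ).size := Mesh.size_pos
    have h2 : ‖restrictDual (levelPartTilde 𝒯 φ ℓ)‖ ^ 2 ≤ D * ‖levelPartTilde 𝒯 φ ℓ‖ ^ 2 := by
      refine (pow_le_pow_left₀ (ContinuousLinearMap.opNorm_nonneg _) (norm_restrictDual_le _)
        2).trans ?_
      rw [mul_pow]
      gcongr
      exact (le_max_right _ _).trans (le_max_right _ _)
    calc _ ≤ (𝒯 ℓ).size ^ (-2 + 2 * s) * (D * ‖levelPartTilde 𝒯 φ ℓ‖ ^ 2) := by gcongr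
      _ = _ := by ring
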